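/- Fix $\varepsilon\in(0,1/2)$. There are constants $C>0$ and $\delta>0$, depending only on $\varepsilon$, such that the following holds for all $\rho,\mathfrak a>0$ with $\rho\mathfrak a^3<\delta$. Let $\ell=(\rho\mathfrak a)^{-1/2}(\rho\mathfrak a^3)^{\varepsilon}$, and let $f_\ell$ be the ground state of the Neumann problem $-\Delta f_\ell=\lambda_\ell f_\ell$ for $\mathfrak a<|x|<\ell$, $f_\ell(x)=0$ for $|x|<\mathfrak a$, $\partial_r f_\ell(x)=0$ for $|x|=\ell$, on the ball $\{x\in\mathbb R^3:|x|\le\ell\}$ (the eigenfunction, continuous on the closed ball, for the smallest eigenvalue $\lambda_\ell$), normalized by $f_\ell(x)=1$ for $|x|=\ell$ and extended by $f_\ell(x)=1$ for $|x|\ge\ell$; such a function exists and is unique. For $N\ge 3$ let $L=(N/\rho)^{1/3}$, let $\Lambda=[-L/2,L/2]^3$ with periodic boundary conditions (so $N/|\Lambda|=\rho$), and, for $x_1,\dots,x_N\in\Lambda$, write $f_{ij}=f_\ell(x_i-x_j)$ and $\nabla f_{ij}=\nabla f_\ell(x_i-x_j)$, where differences are taken on the torus. Then, for all sufficiently large $N$,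 both integrands below are integrable over $\Lambda^N$ and the denominator is positive, and \[ \limsup_{\substack{N,|\Lambda|\to\infty:\\ N/|\Lambda|=\rho}}\left|(N-1)(N-2)\,\frac{\int_{\Lambda^N}\frac{\nabla f_{12}}{f_{12}}\cdot\frac{\nabla f_{13}}{f_{13}}\prod_{1\le i<j\le N}f_{ij}^2\,dx_1\cdots dx_N}{\int_{\Lambda^N}\prod_{1\le i<j\le N}f_{ij}^2\,dx_1\cdots dx_N}\right|\le C\,\rho\mathfrak a\,(\rho\mathfrak a^3)^{1/2+\varepsilon}. \] -/

import Mathlib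

open scoped Laplacian Gradient

noncomputable section

/-- Three-dimensional Euclidean space. -/
abbrev Space3 : Type := EuclideanSpace ℝ (Fin 3)

/-- `g` is an eigenfunction with eigenvalue `lam` of the Neumann problem with hard core of radius `a`
on the ball of radius `ℓ`: it is continuous on the closed ball (so that the Dirichlet condition holds
up to `‖x‖ = a`), satisfies `-Δ g = lam g` classically outside of the core, vanishes in the core, has
vanishing radial derivative (taken from inside) on the sphere of radius `ℓ`, and is not zero.
Only the values of `g` on the closed ball matter. -/
structure IsHardCoreNeumannEigenfunction (a ℓ lam : ℝ) (g : Space3 → ℝ) : Prop where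
  continuousOn : ContinuousOn g (Metric.closedBall 0 ℓ)
  contDiffOn : ContDiffOn ℝ 2 g {x | a < ‖x‖ ∧ ‖x‖ < ℓ}
  eigen : ∀ x, a < ‖x‖ → ‖x‖ < ℓ → -(Δ g) x = lam * g x
  hardCore : ∀ x, ‖x‖ < a → ‖x‖ ≤ ℓ → g x = 0
  neumann : ∀ x, ‖x‖ = ℓ → HasDerivWithinAt (fun t : ℝ => g (t • x)) 0 (Set.Iic 1) 1
  nontrivial : ∃ x, ‖x‖ ≤ ℓ ∧ g x ≠ 0

/-- `f` is the ground state of the hard-core Neumann problem on the ball of radius `ℓ` (eigenfunction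
for the smallest eigenvalue), normalized to `1` on `‖x‖ = ℓ` and extended by `1` outside of the ball. -/
def IsHardCoreGroundState (a ℓ : ℝ) (f : Space3 → ℝ) : Prop :=
  ∃ lam : ℝ,
    IsLeast {μ : ℝ | ∃ g : Space3 → ℝ, IsHardCoreNeumannEigenfunction a ℓ μ g} lam ∧
    IsHardCoreNeumannEigenfunction a ℓ lam f ∧
    ∀ x, ℓ ≤ ‖x‖ → f x = 1

/-- The box `Λ = [-L/2, L/2]³`. -/
def torusBox (L : ℝ) : Set Space3 := {x | ∀ k, x k ∈ Set.Icc (-(L / 2)) (L / 2)}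

/-- The representative of `x` modulo `L ℤ³` in the cube of side `L` centred at the origin; its norm
is the distance of `x` to the origin on the torus. -/
def torusRep (L : ℝ) (x : Space3) : Space3 :=
  WithLp.toLp 2 fun k => x k - L * (round (x k / L) : ℝ)

/-- The `L ℤ³`-periodic function that agrees with `f` on the cube centred at the origin, that is,
`f` viewed as a function on the torus. -/
def torusExtend (L : ℝ) (f : Space3 → ℝ) : Space3 → ℝ := fun x => f (torusRep L x)

/-- The squared Jastrow function `∏_{i<j} f(x_i - x_j)²` on the torus of side `L`. -/
def jastrowSq (f : Space3 → ℝ) (L : ℝ) {N : ℕ} (x : Fin N → Space3) : ℝ :=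
  ∏ i : Fin N, ∏ j ∈ Finset.Ioi i, torusExtend L f (x i - x j) ^ 2

/-- The logarithmic gradient `∇f(y) / f(y)` on the torus of side `L`. -/
def logGrad (f : Space3 → ℝ) (L : ℝ) (y : Space3) : Space3 :=
  (torusExtend L f y)⁻¹ • (∇ (torusExtend L f)) y

/-- The integrand `(∇f_{ij} / f_{ij}) · (∇f_{ik} / f_{ik}) ∏_{p<q} f_{pq}²`. -/
def threeBodyIntegrand (f : Space3 → ℝ) (L : ℝ) {N : ℕ} (i j k : Fin N) (x : Fin N → Space3) : ℝ :=
  inner ℝ (logGrad f L (x i - x j)) (logGrad f L (x i - x k)) * jastrowSq f L x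

/-- The configuration space `Λ^N`. -/
def configBox (L : ℝ) (N : ℕ) : Set (Fin N → Space3) := Set.univ.pi fun _ => torusBox L

/-- The side `L` of the box with `N / L³ = ρ`. -/
def boxSide (ρ : ℝ) (N : ℕ) : ℝ := ((N : ℝ) / ρ) ^ (1 / 3 : ℝ)

/-- The length `ℓ = (ρ a)^{-1/2} (ρ a³)^ε`. -/
def corrLength (ρ a ε : ℝ) : ℝ := (ρ * a) ^ (-(1 / 2) : ℝ) * (ρ * a ^ 3) ^ ε

/-- The three-body term
`(N-1)(N-2) ∫ (∇f₁₂/f₁₂)·(∇f₁₃/f₁₃) ∏ f_{ij}² / ∫ ∏ f_{ij}²` for `N = n + 3` particles at density `ρ`;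
the particles `1, 2, 3` are the indices `0, 1, 2`. -/
def threeBodyTerm (f : Space3 → ℝ) (ρ : ℝ) (n : ℕ) : ℝ :=
  (((n + 3 : ℕ) : ℝ) - 1) * (((n + 3 : ℕ) : ℝ) - 2) *
    ((∫ x in configBox (boxSide ρ (n + 3)) (n + 3),
        threeBodyIntegrand f (boxSide ρ (n + 3)) (0 : Fin (n + 3)) 1 2 x) /
      ∫ x in configBox (boxSide ρ (n + 3)) (n + 3), jastrowSq f (boxSide ρ (n + 3)) x)

end

/-!
The three-body term is the expectation of `(∇f₁₂ / f₁₂) · (∇f₁₃ / f₁₃)` in a gas of particles with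
the pair Boltzmann factor `e = f²`. Bounding it by absolute values would cost the factor
`(ρ ∫ |f ∇f|)² ∼ (ρ a ℓ)²`, which is too large: the gain comes from the oddness of the force.

Fix the position `x` of particle `1` and one coordinate `F` of the force `f ∇f`. If `e(y, z)` is
replaced by `1` for the particles `2` and `3` at `y` and `z`, the two force factors decouple, and
what remains is the second moment of `B(X) = ∫ F(x, y) ∏_j e(y, X_j) dy` under the law of the other
particles `X` pinned by the one at `x`. This law is invariant under the reflection about `x`, and
`B` is odd, so `B` has mean zero and its second moment is a variance
(`IsRepulsive.integral_pinnedField_eq_zero`). The gas is dilute, since `ρ ∫ (1 - e) ≲ ρ a ℓ²` is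
small, so its variances are controlled by a Poincaré inequality (`IsGibbsDensity.poincare`):
Dobrushin's condition makes the Glauber dynamics contract the Hamming-Lipschitz seminorm at rate
`1 - 1 / (2 n)`, and because the dynamics is self-adjoint the norms of its iterates are log-convex,
which turns this rate into an `L²` spectral gap. Removing a particle at `z` changes `B` by at most
`(|F| * (1 - e))(z)`, and Young's inequality bounds the variance by
`ρ ‖F‖₁² ‖1 - e‖₂² ≲ ρ a⁴ ℓ³`. The error made by replacing `e(y, z)` by `1` is at most
`∫∫ |F| |F| (1 - e) ≲ a³ ℓ`. All of this is collected in `IsRepulsive.abs_integral_threeBody_le`;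
the ratio of the partition functions with `n + 3` and `n + 1` particles, which normalizes it,
is at least `(|Λ| / 2)²`, again by diluteness.

The ground state is explicit, `f(x) = A sin (k (|x| - a)) / |x|`, where `k` is the smallest positive
solution of the Neumann condition. That it belongs to the smallest eigenvalue, and that it is the
only ground state, follows from a comparison principle: the quotient of an eigenfunction by a
positive strict supersolution of the same form has no positive interior maximum
(`nonpos_of_no_boundary_max`). No radial symmetry of a general eigenfunction is needed. Concavity of
the sine gives `1 - f ≤ a / |x|` and `|∇f| ≤ 4 a / |x|²`, and the integrals above become elementary.
With `τ = ρ a³` one has `ρ a ℓ² = τ ^ (2 ε)` and `ρ a² ℓ = τ ^ (1 / 2 + ε)`, so that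
`ρ² (ρ a⁴ ℓ³ + a³ ℓ) ≲ ρ a τ ^ (1 / 2 + ε)`.
-/

open MeasureTheory Function

set_option linter.unusedSectionVars false

/-! ### Bounded measurable functions -/

/-- Bounded measurable real-valued functions. -/
structure BddMeas {X : Type*} [MeasurableSpace X] (g : X → ℝ) : Prop where
  measurable : Measurable g
  bound : ∃ C, ∀ x, |g x| ≤ C

namespace BddMeas

variable {X Y ι : Type*} [MeasurableSpace X] [MeasurableSpace Y] {g h : X → ℝ}

lemma const (c : ℝ) : BddMeas fun _ : X => c := ⟨measurable_const, |c|, fun _ => le_rfl⟩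

lemma add (hg : BddMeas g) (hh : BddMeas h) : BddMeas fun x => g x + h x := by
  obtain ⟨C, hC⟩ := hg.bound
  obtain ⟨D, hD⟩ := hh.bound
  exact ⟨hg.measurable.add hh.measurable, C + D, fun x =>
    (abs_add_le _ _).trans (add_le_add (hC x) (hD x))⟩

lemma mul (hg : BddMeas g) (hh : BddMeas h) : BddMeas fun x => g x * h x := by
  obtain ⟨C, hC⟩ := hg.bound
  obtain ⟨D, hD⟩ := hh.bound
  refine ⟨hg.measurable.mul hh.measurable, C * D, fun x => ?_⟩
  rw [abs_mul]
  exact mul_le_mul (hC x) (hD x) (abs_nonneg _) ((abs_nonneg _).trans (hC x))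

lemma const_mul (c : ℝ) (hg : BddMeas g) : BddMeas fun x => c * g x := (const c).mul hg

lemma neg (hg : BddMeas g) : BddMeas fun x => - g x := by
  simpa using (const (X := X) (-1)).mul hg

lemma sub (hg : BddMeas g) (hh : BddMeas h) : BddMeas fun x => g x - h x := by
  simpa [sub_eq_add_neg] using hg.add hh.neg

lemma abs (hg : BddMeas g) : BddMeas fun x => |g x| :=
  ⟨measurable_norm.comp hg.measurable, by simpa using hg.bound⟩

lemma pow (hg : BddMeas g) (n : ℕ) : BddMeas fun x => g x ^ n := by
  induction n with
  | zero => simpa using const (X := X) 1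
  | succ n ih => simpa [pow_succ] using ih.mul hg

lemma comp (hg : BddMeas g) {φ : Y → X} (hφ : Measurable φ) : BddMeas fun y => g (φ y) :=
  ⟨hg.measurable.comp hφ, hg.bound.imp fun _ hC y => hC (φ y)⟩

lemma sum (s : Finset ι) {g : ι → X → ℝ} (hg : ∀ i, BddMeas (g i)) :
    BddMeas fun x => ∑ i ∈ s, g i x := by
  classical
  induction s using Finset.induction_on with
  | empty => simpa using const (X := X) 0
  | insert a s ha ih => simpa [Finset.sum_insert ha] using (hg a).add ih

lemma prod (s : Finset ι) {g : ι → X → ℝ} (hg : ∀ i, BddMeas (g i)) :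
    BddMeas fun x => ∏ i ∈ s, g i x := by
  classical
  induction s using Finset.induction_on with
  | empty => simpa using const (X := X) 1
  | insert a s ha ih => simpa [Finset.prod_insert ha] using (hg a).mul ih

lemma integrable (hg : BddMeas g) (μ : Measure X) [IsFiniteMeasure μ] : Integrable g μ := by
  obtain ⟨C, hC⟩ := hg.bound
  exact Integrable.of_bound hg.measurable.aestronglyMeasurable C (.of_forall hC)

lemma integral {g : X × Y → ℝ} (hg : BddMeas g) (μ : Measure Y) [IsFiniteMeasure μ] :
    BddMeas fun x => ∫ y, g (x, y) ∂μ := by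
  obtain ⟨C, hC⟩ := hg.bound
  refine ⟨hg.measurable.stronglyMeasurable.integral_prod_right'.measurable, C * μ.real Set.univ,
    fun x => ?_⟩
  exact norm_integral_le_of_norm_le_const (f := fun y => g (x, y)) (.of_forall fun y => hC (x, y))

end BddMeas

/-- Bounding the integral of a product by the supremum of the first factor. -/
lemma abs_integral_mul_le {X : Type*} [MeasurableSpace X] (μ : Measure X) [IsFiniteMeasure μ]
    {g h : X → ℝ} (hg : BddMeas g) (hh : BddMeas h) {δ : ℝ} (hδ : ∀ x, |g x| ≤ δ) :
    |∫ x, g x * h x ∂μ| ≤ δ * ∫ x, |h x| ∂μ := by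
  rw [← integral_const_mul]
  refine abs_integral_le_integral_abs.trans (integral_mono ((hg.mul hh).abs.integrable _)
    (((BddMeas.const δ).mul hh.abs).integrable _) fun x => ?_)
  simp only [abs_mul]
  exact mul_le_mul_of_nonneg_right (hδ x) (abs_nonneg _)

/-- Cauchy–Schwarz with a weight. -/
lemma sq_integral_mul_le {X : Type*} [MeasurableSpace X] (μ : Measure X) [IsFiniteMeasure μ]
    {g h D : X → ℝ} (hg : BddMeas g) (hh : BddMeas h) (hD : BddMeas D) (hD0 : ∀ x, 0 ≤ D x) :
    (∫ x, g x * h x * D x ∂μ) ^ 2 ≤ (∫ x, g x ^ 2 * D x ∂μ) * ∫ x, h x ^ 2 * D x ∂μ := by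
  have key : ∀ t : ℝ, 0 ≤ (∫ x, g x ^ 2 * D x ∂μ) * (t * t) +
      (2 * ∫ x, g x * h x * D x ∂μ) * t + ∫ x, h x ^ 2 * D x ∂μ := fun t => by
    have : 0 ≤ ∫ x, (t * g x + h x) ^ 2 * D x ∂μ :=
      integral_nonneg fun x => mul_nonneg (sq_nonneg _) (hD0 x)
    have e : ∀ x, (t * g x + h x) ^ 2 * D x =
        (t * t) * (g x ^ 2 * D x) + (2 * t) * (g x * h x * D x) + h x ^ 2 * D x :=
      fun x => by ring
    simp only [e] at this
    have i1 := (hg.pow 2).mul hD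
    have i2 := (hg.mul hh).mul hD
    have i3 := (hh.pow 2).mul hD
    rw [integral_add (((i1.const_mul _).add (i2.const_mul _)).integrable _) (i3.integrable _),
      integral_add ((i1.const_mul _).integrable _) ((i2.const_mul _).integrable _),
      integral_const_mul, integral_const_mul] at this
    linarith
  have := discrim_le_zero key
  rw [discrim] at this
  linarith

/-! ### Resampling a coordinate -/

section Update

variable {Ω ι : Type*} [MeasurableSpace Ω] [Fintype ι] [DecidableEq ι]

lemma measurable_update_prod (i : ι) :
    Measurable fun p : (ι → Ω) × Ω => update p.1 i p.2 := by
  refine measurable_pi_lambda _ fun j => ?_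
  by_cases h : j = i
  · subst h; simpa using measurable_snd
  · simp only [update_of_ne h]
    exact (measurable_pi_apply j).comp measurable_fst

/-- Resampling one coordinate of a product measure reproduces the product measure. -/
lemma map_update_prod (μ : Measure Ω) [IsFiniteMeasure μ] (i : ι) :
    ((Measure.pi fun _ : ι => μ).prod μ).map (fun p => update p.1 i p.2) =
      μ Set.univ • Measure.pi fun _ : ι => μ := by
  by_cases hμ : μ Set.univ = 0
  · have : μ = 0 := Measure.measure_univ_eq_zero.1 hμ
    subst this; simp
  have key : (μ Set.univ)⁻¹ • ((Measure.pi fun _ : ι => μ).prod μ).map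
      (fun p => update p.1 i p.2) = Measure.pi fun _ : ι => μ := by
    symm
    refine Measure.pi_eq fun s hs => ?_
    rw [Measure.smul_apply, Measure.map_apply (measurable_update_prod i)
      (MeasurableSet.univ_pi hs)]
    have : (fun p : (ι → Ω) × Ω => update p.1 i p.2) ⁻¹' Set.univ.pi s =
        (Set.univ.pi (update s i Set.univ)) ×ˢ s i := by
      ext p
      simp only [Set.mem_preimage, Set.mem_pi, Set.mem_univ, true_implies, Set.mem_prod]
      constructor
      · intro h
        refine ⟨fun j => ?_, by simpa using h i⟩
        by_cases hj : j = i
        · subst hj; simp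
        · simpa [update_of_ne hj] using h j
      · rintro ⟨h, h'⟩ j
        by_cases hj : j = i
        · subst hj; simpa using h'
        · simpa [update_of_ne hj] using h j
    rw [this, Measure.prod_prod, Measure.pi_pi, ← Finset.mul_prod_erase _ _ (Finset.mem_univ i),
      ← Finset.mul_prod_erase Finset.univ (fun j => μ (s j)) (Finset.mem_univ i)]
    have h2 : ∏ j ∈ Finset.univ.erase i, μ (update s i Set.univ j) =
        ∏ j ∈ Finset.univ.erase i, μ (s j) :=
      Finset.prod_congr rfl fun j hj => by rw [update_of_ne (Finset.ne_of_mem_erase hj)]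
    rw [h2, update_self, smul_eq_mul, mul_assoc, ← mul_assoc (μ Set.univ)⁻¹,
      ENNReal.inv_mul_cancel hμ (measure_ne_top _ _), one_mul, mul_comm]
  conv_rhs => rw [← key]
  rw [smul_smul, ENNReal.mul_inv_cancel hμ (measure_ne_top _ _), one_smul]

lemma integral_update (μ : Measure Ω) [IsFiniteMeasure μ] (i : ι) {g : (ι → Ω) → ℝ}
    (hg : BddMeas g) :
    μ.real Set.univ * ∫ X, g X ∂Measure.pi (fun _ : ι => μ) =
      ∫ X, ∫ y, g (update X i y) ∂μ ∂Measure.pi fun _ : ι => μ := by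
  have h1 : ∫ X, g X ∂(((Measure.pi fun _ : ι => μ).prod μ).map fun p => update p.1 i p.2) =
      ∫ p, g (update p.1 i p.2) ∂(Measure.pi fun _ : ι => μ).prod μ :=
    integral_map (measurable_update_prod i).aemeasurable hg.measurable.aestronglyMeasurable
  rw [map_update_prod, integral_smul_measure,
    integral_prod _ ((hg.comp (measurable_update_prod i)).integrable _)] at h1
  exact h1

end Update

/-- A log-convex sequence of exponential growth rate at most `q` starts with a ratio at most `q`. -/
lemma le_mul_of_logConvex {n : ℕ → ℝ} (h0 : ∀ k, 0 ≤ n k)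
    (hc : ∀ k, n (k + 1) ^ 2 ≤ n k * n (k + 2)) {K q : ℝ} (hq : 0 < q)
    (hK : ∀ k, n k ≤ K * q ^ k) : n 1 ≤ q * n 0 := by
  by_contra! hlt
  have hn0 : 0 < n 0 := by
    refine lt_of_le_of_ne (h0 0) fun h => ?_
    have := hc 0
    rw [← h] at this hlt
    simp only [zero_add, zero_mul, mul_zero] at this hlt
    nlinarith
  set s := n 1 / n 0 with hs
  have hsq : q < s := (lt_div_iff₀ hn0).2 hlt
  have hs0 : 0 < s := hq.trans hsq
  have step : ∀ k, 0 < n k ∧ s * n k ≤ n (k + 1) := by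
    intro k
    induction k with
    | zero => exact ⟨hn0, by rw [hs, zero_add, div_mul_cancel₀ _ hn0.ne']⟩
    | succ k ih =>
      have hp : 0 < n (k + 1) := (mul_pos hs0 ih.1).trans_le ih.2
      refine ⟨hp, le_of_mul_le_mul_left ?_ ih.1⟩
      calc n k * (s * n (k + 1)) = s * n k * n (k + 1) := by ring
        _ ≤ n (k + 1) * n (k + 1) := by gcongr; exact ih.2
        _ = n (k + 1) ^ 2 := by ring
        _ ≤ _ := hc k
  have low : ∀ k, n 0 * s ^ k ≤ n k := by
    intro k
    induction k with
    | zero => simp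
    | succ k ih =>
      calc n 0 * s ^ (k + 1) = s * (n 0 * s ^ k) := by ring
        _ ≤ s * n k := by gcongr
        _ ≤ _ := (step k).2
  have h1 : 1 < s / q := (one_lt_div hq).2 hsq
  obtain ⟨k, hk⟩ := pow_unbounded_of_one_lt (K / n 0) h1
  rw [div_pow, div_lt_div_iff₀ hn0 (by positivity)] at hk
  have := (low k).trans (hK k)
  linarith

/-! ### Poincaré inequality for weakly dependent particles -/

section HeatBath

variable {Ω ι : Type*} [MeasurableSpace Ω] [Fintype ι] [DecidableEq ι]

/-- A bounded density `D` on configurations `ι → Ω` together with its one-particle conditional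
densities: as a function of the coordinate `i`, the density `D` is proportional to `w i X`, which
depends only on the other coordinates of `X`, and so does the factor `R i X`. The normalization of `w i X` is at least `c`, and
`w i X` changes by at most `τ` in `L¹` when one other coordinate of `X` changes: `τ / c` plays the
role of Dobrushin's interdependence coefficient. -/
structure IsGibbsDensity (μ : Measure Ω) (D : (ι → Ω) → ℝ) (w : ι → (ι → Ω) → Ω → ℝ)
    (R : ι → (ι → Ω) → ℝ) (c τ : ℝ) : Prop where
  bddMeas : BddMeas D
  nonneg : ∀ X, 0 ≤ D X
  bddMeas_w : ∀ i, BddMeas fun p : (ι → Ω) × Ω => w i p.1 p.2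
  w_nonneg : ∀ i X y, 0 ≤ w i X y
  bddMeas_R : ∀ i, BddMeas (R i)
  update_eq : ∀ i X y, D (update X i y) = R i X * w i X y
  w_update : ∀ i X z, w i (update X i z) = w i X
  R_update : ∀ i X z, R i (update X i z) = R i X
  c_pos : 0 < c
  le_integral_w : ∀ i X, c ≤ ∫ y, w i X y ∂μ
  integral_w_sub_le : ∀ i k, k ≠ i → ∀ X z, ∫ y, |w i X y - w i (update X k z) y| ∂μ ≤ τ

/-- The heat bath at `i`: the conditional expectation of `g` given all coordinates but `i`. -/
noncomputable def heatBath (μ : Measure Ω) (w : ι → (ι → Ω) → Ω → ℝ) (i : ι) (g : (ι → Ω) → ℝ) :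
    (ι → Ω) → ℝ :=
  fun X => (∫ y, g (update X i y) * w i X y ∂μ) / ∫ y, w i X y ∂μ

/-- One step of the Glauber dynamics: the average of the heat baths over all coordinates. -/
noncomputable def glauber (μ : Measure Ω) (w : ι → (ι → Ω) → Ω → ℝ) (g : (ι → Ω) → ℝ) :
    (ι → Ω) → ℝ :=
  fun X => (Fintype.card ι : ℝ)⁻¹ * ∑ i, heatBath μ w i g X

/-- `g` changes by at most `δ` when one coordinate changes. -/
def HammingLipschitz (δ : ℝ) (g : (ι → Ω) → ℝ) : Prop :=
  ∀ X k z, |g X - g (update X k z)| ≤ δ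

omit [MeasurableSpace Ω] in
lemma HammingLipschitz.abs_sub_le {δ : ℝ} {g : (ι → Ω) → ℝ} (hg : HammingLipschitz δ g)
    (X Y : ι → Ω) : |g X - g Y| ≤ Fintype.card ι * δ := by
  have key : ∀ s : Finset ι, |g X - g (s.piecewise Y X)| ≤ s.card * δ := by
    intro s
    induction s using Finset.induction_on with
    | empty => simp
    | insert a s ha ih =>
      rw [Finset.piecewise_insert, Finset.card_insert_of_notMem ha]
      have := hg (s.piecewise Y X) a (Y a)
      have h3 := _root_.abs_sub_le (g X) (g (s.piecewise Y X)) (g (update (s.piecewise Y X) a (Y a)))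
      push_cast
      linarith
  simpa using key Finset.univ

namespace IsGibbsDensity

variable {μ : Measure Ω} [IsFiniteMeasure μ] {D : (ι → Ω) → ℝ} {w : ι → (ι → Ω) → Ω → ℝ}
  {R : ι → (ι → Ω) → ℝ} {c τ : ℝ} {g h : (ι → Ω) → ℝ}

lemma integral_w_pos (H : IsGibbsDensity μ D w R c τ) (i : ι) (X : ι → Ω) :
    0 < ∫ y, w i X y ∂μ := H.c_pos.trans_le (H.le_integral_w i X)

lemma bddMeas_w_right (H : IsGibbsDensity μ D w R c τ) (i : ι) (X : ι → Ω) :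
    BddMeas (w i X) := (H.bddMeas_w i).comp (measurable_const.prodMk measurable_id)

lemma bddMeas_update (hg : BddMeas g) (i : ι) (X : ι → Ω) :
    BddMeas fun y => g (update X i y) :=
  hg.comp ((measurable_update_prod i).comp (measurable_const.prodMk measurable_id))

lemma heatBath_update (H : IsGibbsDensity μ D w R c τ) (i : ι) (X : ι → Ω) (z : Ω) :
    heatBath μ w i g (update X i z) = heatBath μ w i g X := by
  simp [heatBath, H.w_update]

lemma bddMeas_heatBath (H : IsGibbsDensity μ D w R c τ) (hg : BddMeas g) (i : ι) :
    BddMeas (heatBath μ w i g) := by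
  have hm : BddMeas fun p : (ι → Ω) × Ω => g (update p.1 i p.2) * w i p.1 p.2 :=
    (hg.comp (measurable_update_prod i)).mul (H.bddMeas_w i)
  refine ⟨(hm.integral μ).measurable.div ((H.bddMeas_w i).integral μ).measurable, ?_⟩
  obtain ⟨C, hC⟩ := (hm.integral μ).bound
  refine ⟨C / c, fun X => ?_⟩
  rw [heatBath, abs_div, abs_of_pos (H.integral_w_pos i X)]
  exact div_le_div₀ ((abs_nonneg _).trans (hC X)) (hC X) H.c_pos (H.le_integral_w i X)

/-- The heat bath fixes functions that do not depend on the coordinate `i`, also as factors. -/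
lemma heatBath_mul {i : ι}
    (hh : ∀ X z, h (update X i z) = h X) :
    heatBath μ w i (fun X => g X * h X) = fun X => heatBath μ w i g X * h X := by
  ext X
  simp only [heatBath, hh]
  rw [div_mul_eq_mul_div, ← integral_mul_const]
  congr 1
  exact integral_congr_ae (.of_forall fun y => by ring)

lemma heatBath_one (H : IsGibbsDensity μ D w R c τ) (i : ι) :
    heatBath μ w i (fun _ => 1) = fun _ => 1 := by
  ext X
  simp [heatBath, (H.integral_w_pos i X).ne']

lemma heatBath_eq_self (H : IsGibbsDensity μ D w R c τ) {i : ι}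
    (hh : ∀ X z, h (update X i z) = h X) : heatBath μ w i h = h := by
  have := heatBath_mul (μ := μ) (w := w) (g := fun _ => 1) hh
  simpa [H.heatBath_one i] using this

/-- The heat bath is self-adjoint in `L²` of the Gibbs measure. -/
lemma integral_heatBath_mul (H : IsGibbsDensity μ D w R c τ) (hg : BddMeas g) (hh : BddMeas h)
    (i : ι) :
    ∫ X, heatBath μ w i g X * h X * D X ∂Measure.pi (fun _ => μ) =
      ∫ X, g X * heatBath μ w i h X * D X ∂Measure.pi fun _ => μ := by
  by_cases hV : μ.real Set.univ = 0
  · have h0 : Measure.pi (fun _ : ι => μ) = 0 := by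
      rw [← Measure.measure_univ_eq_zero, Measure.pi_univ]
      exact Finset.prod_eq_zero (Finset.mem_univ i) ((measureReal_eq_zero_iff).1 hV)
    simp [h0]
  have key : ∀ {g h : (ι → Ω) → ℝ}, BddMeas g → BddMeas h →
      μ.real Set.univ * ∫ X, heatBath μ w i g X * h X * D X ∂Measure.pi (fun _ => μ) =
      ∫ X, R i X / (∫ y, w i X y ∂μ) * ((∫ y, g (update X i y) * w i X y ∂μ) *
        ∫ y, h (update X i y) * w i X y ∂μ) ∂Measure.pi (fun _ => μ) := by
    intro g h hg hh
    rw [integral_update μ i (((H.bddMeas_heatBath hg i).mul hh).mul H.bddMeas)]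
    refine integral_congr_ae (.of_forall fun X => ?_)
    simp only [H.heatBath_update, H.update_eq]
    have : ∀ y, heatBath μ w i g X * h (update X i y) * (R i X * w i X y) =
        (heatBath μ w i g X * R i X) * (h (update X i y) * w i X y) := fun y => by ring
    simp only [this]
    rw [integral_const_mul, heatBath]
    ring
  refine mul_left_cancel₀ hV ?_
  have h2 := key hh hg
  rw [key hg hh]
  have : ∀ X, g X * heatBath μ w i h X * D X = heatBath μ w i h X * g X * D X :=
    fun X => by ring
  simp only [this]
  rw [h2]
  exact integral_congr_ae (.of_forall fun X => by ring)

lemma bddMeas_glauber (H : IsGibbsDensity μ D w R c τ) (hg : BddMeas g) :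
    BddMeas (glauber μ w g) :=
  (BddMeas.const _).mul (BddMeas.sum _ fun i => H.bddMeas_heatBath hg i)

lemma integral_glauber_mul (H : IsGibbsDensity μ D w R c τ) (hg : BddMeas g) (hh : BddMeas h) :
    ∫ X, glauber μ w g X * h X * D X ∂Measure.pi (fun _ => μ) =
      ∫ X, g X * glauber μ w h X * D X ∂Measure.pi fun _ => μ := by
  have e1 : ∀ X, glauber μ w g X * h X * D X =
      (Fintype.card ι : ℝ)⁻¹ * ∑ i, heatBath μ w i g X * h X * D X := fun X => by
    rw [glauber, Finset.mul_sum, Finset.mul_sum, Finset.sum_mul, Finset.sum_mul]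
    exact Finset.sum_congr rfl fun i _ => by ring
  have e2 : ∀ X, g X * glauber μ w h X * D X =
      (Fintype.card ι : ℝ)⁻¹ * ∑ i, g X * heatBath μ w i h X * D X := fun X => by
    rw [glauber, Finset.mul_sum, Finset.mul_sum, Finset.mul_sum, Finset.sum_mul]
    exact Finset.sum_congr rfl fun i _ => by ring
  simp only [e1, e2]
  rw [integral_const_mul, integral_const_mul, integral_finsetSum, integral_finsetSum]
  · simp only [H.integral_heatBath_mul hg hh]
  · exact fun i _ => ((hg.mul (H.bddMeas_heatBath hh i)).mul H.bddMeas).integrable _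
  · exact fun i _ => (((H.bddMeas_heatBath hg i).mul hh).mul H.bddMeas).integrable _

/-- A heat bath at `i` increases the dependence on another coordinate by at most `2 δ τ / c`, since
the conditional law at `i` changes by at most `2 τ / c` in total variation. -/
lemma abs_heatBath_sub_le (H : IsGibbsDensity μ D w R c τ) (hg : BddMeas g) {δ : ℝ}
    (hδ : HammingLipschitz δ g) {i k : ι} (hik : k ≠ i) (X : ι → Ω) (z : Ω) :
    |heatBath μ w i g X - heatBath μ w i g (update X k z)| ≤ δ * (1 + 2 * τ / c) := by
  have hδ0 : 0 ≤ δ := (abs_nonneg _).trans (hδ X k z)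
  set X' := update X k z with hX'
  set a := ∫ y, w i X y ∂μ with ha
  set a' := ∫ y, w i X' y ∂μ with ha'
  have hap : 0 < a := H.integral_w_pos i X
  have hap' : 0 < a' := H.integral_w_pos i X'
  have hτ := H.integral_w_sub_le i k hik X z
  have hac : c ≤ a := H.le_integral_w i X
  set G := fun y => g (update X i y) with hG
  set G' := fun y => g (update X' i y) with hG'
  have bG : BddMeas G := bddMeas_update hg i X
  have bG' : BddMeas G' := bddMeas_update hg i X'
  have bw := H.bddMeas_w_right i X
  have bw' := H.bddMeas_w_right i X'
  set m := G' z with hm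
  have h1 : ∀ y, |G y - G' y| ≤ δ := fun y => by
    have : update X' i y = update (update X i y) k z := by
      rw [hX', update_comm hik]
    simp only [hG, hG', this]
    exact hδ _ _ _
  have h2 : ∀ y, |G' y - m| ≤ δ := fun y => by
    have : update X' i z = update (update X' i y) i z := by simp
    simp only [hm, hG', this]
    exact hδ _ _ _
  have haa : |a' - a| ≤ τ := by
    rw [ha, ha', ← integral_sub (bw'.integrable _) (bw.integrable _)]
    refine (abs_integral_le_integral_abs).trans ?_
    simpa only [abs_sub_comm] using hτ
  set I1 := ∫ y, (G y - G' y) * w i X y ∂μ with hI1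
  set I2 := ∫ y, (G' y - m) * (w i X y - w i X' y) ∂μ with hI2
  set I3 := ∫ y, (G' y - m) * w i X' y ∂μ with hI3
  have b1 : |I1| ≤ δ * a := by
    simpa only [abs_of_nonneg (H.w_nonneg i X _)] using
      abs_integral_mul_le μ (bG.sub bG') bw h1
  have b2 : |I2| ≤ δ * τ :=
    (abs_integral_mul_le μ (bG'.sub (.const m)) (bw.sub bw') h2).trans (by gcongr)
  have b3 : |I3| ≤ δ * a' := by
    simpa only [abs_of_nonneg (H.w_nonneg i X' _)] using
      abs_integral_mul_le μ (bG'.sub (.const m)) bw' h2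
  have e1 : ∫ y, G y * w i X y ∂μ = I1 + I2 + I3 + m * a := by
    rw [hI1, hI2, hI3, ha, ← integral_const_mul, ← integral_add, ← integral_add, ← integral_add]
    · exact integral_congr_ae (.of_forall fun y => by simp only; ring)
    · exact ((((bG.sub bG').mul bw).add ((bG'.sub (.const m)).mul (bw.sub bw'))).add
        ((bG'.sub (.const m)).mul bw')).integrable _
    · exact ((BddMeas.const m).mul bw).integrable _
    · exact (((bG.sub bG').mul bw).add ((bG'.sub (.const m)).mul (bw.sub bw'))).integrable _
    · exact ((bG'.sub (.const m)).mul bw').integrable _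
    · exact ((bG.sub bG').mul bw).integrable _
    · exact ((bG'.sub (.const m)).mul (bw.sub bw')).integrable _
  have e2 : ∫ y, G' y * w i X' y ∂μ = I3 + m * a' := by
    rw [hI3, ha', ← integral_const_mul, ← integral_add]
    · exact integral_congr_ae (.of_forall fun y => by simp only; ring)
    · exact ((bG'.sub (.const m)).mul bw').integrable _
    · exact ((BddMeas.const m).mul bw').integrable _
  have e3 : heatBath μ w i g X - heatBath μ w i g X' =
      I1 / a + I2 / a + I3 / a' * ((a' - a) / a) := by
    rw [heatBath, heatBath, e1, e2, ← ha, ← ha']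
    field_simp
    ring
  rw [e3]
  have c1 : |I1 / a| ≤ δ := by
    rw [abs_div, abs_of_pos hap]; exact (div_le_iff₀ hap).2 b1
  have c2 : |I2 / a| ≤ δ * (τ / c) := by
    rw [abs_div, abs_of_pos hap, ← mul_div_assoc]
    exact div_le_div₀ ((abs_nonneg _).trans b2) b2 H.c_pos hac
  have c3 : |I3 / a'| ≤ δ := by
    rw [abs_div, abs_of_pos hap']; exact (div_le_iff₀ hap').2 b3
  have c4 : |(a' - a) / a| ≤ τ / c := by
    rw [abs_div, abs_of_pos hap]
    exact div_le_div₀ ((abs_nonneg _).trans haa) haa H.c_pos hac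
  calc _ ≤ |I1 / a| + |I2 / a| + |I3 / a'| * |(a' - a) / a| := by
        refine (abs_add_le _ _).trans ?_
        rw [abs_mul]
        gcongr
        exact abs_add_le _ _
    _ ≤ δ + δ * (τ / c) + δ * (τ / c) := by gcongr
    _ = _ := by ring

variable [Nonempty ι]

/-- In Dobrushin's regime the Glauber dynamics contracts the Hamming-Lipschitz seminorm. -/
lemma hammingLipschitz_glauber (H : IsGibbsDensity μ D w R c τ)
    (hτ : 4 * Fintype.card ι * τ ≤ c) (hg : BddMeas g) {δ : ℝ} (hδ : HammingLipschitz δ g) :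
    HammingLipschitz ((1 - (2 * Fintype.card ι : ℝ)⁻¹) * δ) (glauber μ w g) := by
  intro X k z
  have hδ0 : 0 ≤ δ := (abs_nonneg _).trans (hδ X k z)
  have hn : (0 : ℝ) < Fintype.card ι := by exact_mod_cast Fintype.card_pos
  have hc := H.c_pos
  have h1 : 2 * τ / c ≤ (2 * Fintype.card ι : ℝ)⁻¹ := by
    rw [div_le_iff₀ hc, inv_mul_eq_div, le_div_iff₀ (by positivity)]
    linarith
  have h2 : ∀ i ∈ Finset.univ.erase k,
      |heatBath μ w i g X - heatBath μ w i g (update X k z)| ≤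
        δ * (1 + (2 * Fintype.card ι : ℝ)⁻¹) := fun i hi =>
    (H.abs_heatBath_sub_le hg hδ (Finset.ne_of_mem_erase hi).symm X z).trans (by gcongr)
  have h3 : glauber μ w g X - glauber μ w g (update X k z) = (Fintype.card ι : ℝ)⁻¹ *
      ∑ i ∈ Finset.univ.erase k, (heatBath μ w i g X - heatBath μ w i g (update X k z)) := by
    rw [glauber, glauber, ← mul_sub, ← Finset.sum_sub_distrib,
      ← Finset.add_sum_erase _ _ (Finset.mem_univ k), H.heatBath_update, sub_self, zero_add]
  rw [h3, abs_mul, abs_of_pos (inv_pos.2 hn)]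
  have h4 := (Finset.abs_sum_le_sum_abs _ _).trans (Finset.sum_le_card_nsmul _ _ _ h2)
  rw [Finset.card_erase_of_mem (Finset.mem_univ k), Finset.card_univ, nsmul_eq_mul,
    Nat.cast_sub Fintype.card_pos, Nat.cast_one] at h4
  calc _ ≤ (Fintype.card ι : ℝ)⁻¹ *
        (((Fintype.card ι : ℝ) - 1) * (δ * (1 + (2 * Fintype.card ι : ℝ)⁻¹))) := by gcongr
    _ ≤ _ := by
      have : (Fintype.card ι : ℝ)⁻¹ *
          (((Fintype.card ι : ℝ) - 1) * (δ * (1 + (2 * Fintype.card ι : ℝ)⁻¹))) =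
          (1 - (2 * Fintype.card ι : ℝ)⁻¹) * δ - δ * (Fintype.card ι : ℝ)⁻¹ ^ 2 / 2 := by
        field_simp
        ring
      rw [this]
      have : 0 ≤ δ * (Fintype.card ι : ℝ)⁻¹ ^ 2 / 2 := by positivity
      linarith

/-- The Glauber dynamics preserves the mean. -/
lemma integral_glauber (H : IsGibbsDensity μ D w R c τ) (hg : BddMeas g) :
    ∫ X, glauber μ w g X * D X ∂Measure.pi (fun _ => μ) =
      ∫ X, g X * D X ∂Measure.pi fun _ => μ := by
  have h1 := H.integral_glauber_mul hg (BddMeas.const 1)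
  have hn : (Fintype.card ι : ℝ) ≠ 0 := by exact_mod_cast Fintype.card_ne_zero
  have h2 : glauber μ w (fun _ => (1 : ℝ)) = fun _ => 1 := by
    ext X
    simp [glauber, H.heatBath_one, hn]
  rw [h2] at h1
  simpa using h1

/-- A function of mean zero that is Hamming-Lipschitz with constant `δ` is bounded by `n δ`. -/
lemma integral_sq_le_of_hammingLipschitz (H : IsGibbsDensity μ D w R c τ) (hg : BddMeas g)
    (hg0 : ∫ X, g X * D X ∂Measure.pi (fun _ => μ) = 0) {δ : ℝ} (hδ : HammingLipschitz δ g) :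
    ∫ X, g X ^ 2 * D X ∂Measure.pi (fun _ => μ) ≤
      (Fintype.card ι * δ) ^ 2 * ∫ X, D X ∂Measure.pi fun _ => μ := by
  set m := ∫ X, D X ∂Measure.pi fun _ : ι => μ with hm
  have hm0 : 0 ≤ m := integral_nonneg H.nonneg
  have iD := H.bddMeas.integrable (Measure.pi fun _ : ι => μ)
  rcases hm0.eq_or_lt with h0 | hpos
  · have hz := (integral_eq_zero_iff_of_nonneg H.nonneg iD).1 (hm.symm.trans h0.symm)
    rw [← h0, mul_zero]
    refine (integral_eq_zero_of_ae ?_).le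
    filter_upwards [hz] with X hX
    simp [hX]
  · have hb : ∀ X, |g X| ≤ Fintype.card ι * δ := fun X => by
      have e : g X * m = ∫ Y, (g X - g Y) * D Y ∂Measure.pi fun _ : ι => μ := by
        simp only [sub_mul]
        rw [integral_sub (iD.const_mul _) ((hg.mul H.bddMeas).integrable _), hg0,
          integral_const_mul, sub_zero]
      have := abs_integral_mul_le (Measure.pi fun _ : ι => μ) ((BddMeas.const (g X)).sub hg)
        H.bddMeas (hδ.abs_sub_le X)
      rw [← e, abs_mul, abs_of_pos hpos] at this
      simp only [abs_of_nonneg (H.nonneg _)] at this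
      exact le_of_mul_le_mul_right this hpos
    rw [hm, ← integral_const_mul]
    refine integral_mono (((hg.pow 2).mul H.bddMeas).integrable _) (iD.const_mul _) fun X => ?_
    refine mul_le_mul_of_nonneg_right ?_ (H.nonneg X)
    rw [← sq_abs]
    exact pow_le_pow_left₀ (abs_nonneg _) (hb X) 2

/-- The spectral gap of the Glauber dynamics. The norms of the iterates of a self-adjoint operator
form a log-convex sequence, so the exponential rate `1 - 1 / (2 n)` of the Hamming-Lipschitz
seminorm already governs the first step in `L²`. -/
lemma integral_sq_glauber_le (H : IsGibbsDensity μ D w R c τ)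
    (hτ : 4 * Fintype.card ι * τ ≤ c) (hg : BddMeas g)
    (hg0 : ∫ X, g X * D X ∂Measure.pi (fun _ => μ) = 0) :
    ∫ X, glauber μ w g X ^ 2 * D X ∂Measure.pi (fun _ => μ) ≤
      (1 - (2 * Fintype.card ι : ℝ)⁻¹) ^ 2 * ∫ X, g X ^ 2 * D X ∂Measure.pi fun _ => μ := by
  set r := 1 - (2 * Fintype.card ι : ℝ)⁻¹ with hr
  have hn : (1 : ℝ) ≤ Fintype.card ι := by exact_mod_cast Fintype.card_pos
  have hr0 : 0 < r := by
    have : (2 * Fintype.card ι : ℝ)⁻¹ < 1 := inv_lt_one_of_one_lt₀ (by linarith)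
    linarith
  obtain ⟨C, hC⟩ := hg.bound
  set P := glauber μ w with hP
  have hb : ∀ k, BddMeas (P^[k] g) := fun k => by
    induction k with
    | zero => exact hg
    | succ k ih => rw [iterate_succ_apply']; exact H.bddMeas_glauber ih
  have hmean : ∀ k, ∫ X, (P^[k] g) X * D X ∂Measure.pi (fun _ => μ) = 0 := fun k => by
    induction k with
    | zero => exact hg0
    | succ k ih => rw [iterate_succ_apply', hP, H.integral_glauber (hb k)]; exact ih
  have hlip : ∀ k, HammingLipschitz (r ^ k * (2 * C)) (P^[k] g) := fun k => by
    induction k with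
    | zero =>
      intro X i z
      have := (abs_sub (g X) (g (update X i z))).trans (add_le_add (hC _) (hC _))
      simp only [pow_zero, iterate_zero, id]
      linarith
    | succ k ih =>
      rw [iterate_succ_apply', pow_succ', mul_assoc]
      exact H.hammingLipschitz_glauber hτ (hb k) ih
  set n : ℕ → ℝ := fun k => ∫ X, (P^[k] g) X ^ 2 * D X ∂Measure.pi fun _ => μ with hnk
  have h1 : n 1 ≤ r ^ 2 * n 0 := by
    refine le_mul_of_logConvex (n := n)
      (K := (Fintype.card ι * (2 * C)) ^ 2 * ∫ X, D X ∂Measure.pi fun _ : ι => μ)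
      (fun k => integral_nonneg fun X => mul_nonneg (sq_nonneg _) (H.nonneg X)) (fun k => ?_)
      (pow_pos hr0 2) fun k => ?_
    · have e : n (k + 1) =
          ∫ X, (P^[k] g) X * (P^[k + 2] g) X * D X ∂Measure.pi fun _ => μ := by
        have := H.integral_glauber_mul (hb k) (hb (k + 1))
        rw [← hP, ← iterate_succ_apply' P, ← iterate_succ_apply' P] at this
        rw [← this]
        exact integral_congr_ae (.of_forall fun X => by simp only [Nat.succ_eq_add_one]; ring)
      rw [e]
      exact sq_integral_mul_le _ (hb k) (hb (k + 2)) H.bddMeas H.nonneg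
    · have := H.integral_sq_le_of_hammingLipschitz (hb k) (hmean k) (hlip k)
      rwa [show (Fintype.card ι * (r ^ k * (2 * C))) ^ 2 =
        (Fintype.card ι * (2 * C)) ^ 2 * (r ^ 2) ^ k by
          rw [← pow_mul, mul_comm 2 k, pow_mul]; ring, mul_right_comm] at this
  simpa [hnk] using h1

/-- Poincaré inequality for the heat bath dynamics, with constant `2`. -/
theorem poincare (H : IsGibbsDensity μ D w R c τ)
    (hτ : 4 * Fintype.card ι * τ ≤ c) (hg : BddMeas g)
    (hg0 : ∫ X, g X * D X ∂Measure.pi (fun _ => μ) = 0) :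
    ∫ X, g X ^ 2 * D X ∂Measure.pi (fun _ => μ) ≤
      2 * ∑ i, ∫ X, (g X - heatBath μ w i g X) ^ 2 * D X ∂Measure.pi fun _ => μ := by
  have hn : (1 : ℝ) ≤ Fintype.card ι := by exact_mod_cast Fintype.card_pos
  set N : ℝ := (Fintype.card ι : ℝ) with hN
  set A := ∫ X, g X ^ 2 * D X ∂Measure.pi fun _ : ι => μ with hA
  have hA0 : 0 ≤ A := integral_nonneg fun X => mul_nonneg (sq_nonneg _) (H.nonneg X)
  set r := 1 - (2 * N)⁻¹ with hr
  have hr0 : 0 < r := by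
    have : (2 * N)⁻¹ < 1 := inv_lt_one_of_one_lt₀ (by linarith)
    linarith
  have hgap := H.integral_sq_glauber_le hτ hg hg0
  have hcs := sq_integral_mul_le (Measure.pi fun _ => μ) hg (H.bddMeas_glauber hg) H.bddMeas H.nonneg
  set Q := ∫ X, g X * glauber μ w g X * D X ∂Measure.pi fun _ : ι => μ with hQ
  have hQr : Q ≤ r * A := by
    refine abs_le_of_sq_le_sq' ?_ (by positivity) |>.2
    calc Q ^ 2 ≤ _ := hcs
      _ ≤ A * (r ^ 2 * A) := by gcongr
      _ = _ := by ring
  have hproj : ∀ i, ∫ X, (g X - heatBath μ w i g X) ^ 2 * D X ∂Measure.pi (fun _ => μ) =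
      A - ∫ X, g X * heatBath μ w i g X * D X ∂Measure.pi fun _ => μ := fun i => by
    have bE := H.bddMeas_heatBath hg i
    have h1 := H.integral_heatBath_mul hg bE i
    rw [H.heatBath_eq_self (H.heatBath_update i)] at h1
    have e : ∀ X, (g X - heatBath μ w i g X) ^ 2 * D X = g X ^ 2 * D X -
        2 * (g X * heatBath μ w i g X * D X) +
        heatBath μ w i g X * heatBath μ w i g X * D X := fun X => by ring
    simp only [e]
    have i1 := ((hg.pow 2).mul H.bddMeas)
    have i2 := ((hg.mul bE).mul H.bddMeas)
    have i3 := ((bE.mul bE).mul H.bddMeas)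
    rw [integral_add ((i1.sub (i2.const_mul _)).integrable _) (i3.integrable _),
      integral_sub (i1.integrable _) ((i2.const_mul _).integrable _),
      integral_const_mul, h1]
    ring
  have hsum : ∑ i, ∫ X, g X * heatBath μ w i g X * D X ∂Measure.pi (fun _ => μ) = N * Q := by
    rw [← integral_finsetSum _ fun i _ =>
      ((hg.mul (H.bddMeas_heatBath hg i)).mul H.bddMeas).integrable _, hQ, ← integral_const_mul]
    refine integral_congr_ae (.of_forall fun X => ?_)
    simp only [glauber, ← Finset.sum_mul, ← Finset.mul_sum, ← hN]
    field_simp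
  simp only [hproj]
  rw [Finset.sum_sub_distrib, hsum, Finset.sum_const, Finset.card_univ, nsmul_eq_mul, ← hN]
  have : N * r = N - 1 / 2 := by rw [hr]; field_simp
  nlinarith [mul_le_mul_of_nonneg_left hQr (zero_le_one.trans hn)]

/-- The conditional expectation is the best approximation by functions that do not depend on the
coordinate `i`. -/
lemma integral_sub_heatBath_sq_le (H : IsGibbsDensity μ D w R c τ) (hg : BddMeas g)
    (hh : BddMeas h) {i : ι} (hi : ∀ X z, h (update X i z) = h X) :
    ∫ X, (g X - heatBath μ w i g X) ^ 2 * D X ∂Measure.pi (fun _ => μ) ≤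
      ∫ X, (g X - h X) ^ 2 * D X ∂Measure.pi fun _ => μ := by
  have bE := H.bddMeas_heatBath hg i
  have h1 := H.integral_heatBath_mul hg (bE.sub hh) i
  rw [H.heatBath_eq_self (h := fun X => heatBath μ w i g X - h X)
    fun X z => by rw [H.heatBath_update, hi]] at h1
  have e : ∀ X, (g X - h X) ^ 2 * D X = (g X - heatBath μ w i g X) ^ 2 * D X +
      (heatBath μ w i g X - h X) ^ 2 * D X +
      2 * (g X * (heatBath μ w i g X - h X) * D X -
        heatBath μ w i g X * (heatBath μ w i g X - h X) * D X) := fun X => by ring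
  simp only [e]
  have i1 := (((hg.sub bE).pow 2).mul H.bddMeas)
  have i2 := (((bE.sub hh).pow 2).mul H.bddMeas)
  have i3 := ((hg.mul (bE.sub hh)).mul H.bddMeas)
  have i4 := ((bE.mul (bE.sub hh)).mul H.bddMeas)
  rw [integral_add ((i1.add i2).integrable _) (((i3.sub i4).const_mul _).integrable _),
    integral_add (i1.integrable _) (i2.integrable _),
    integral_const_mul, integral_sub (i3.integrable _) (i4.integrable _), h1, sub_self, mul_zero, add_zero]
  exact le_add_of_nonneg_right (integral_nonneg fun X => mul_nonneg (sq_nonneg _) (H.nonneg X))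

end IsGibbsDensity
end HeatBath

/-! ### Dilute repulsive gases -/

section PairWeight

variable {Ω : Type*} [MeasurableSpace Ω]

/-- The Boltzmann factor `e` of a repulsive pair interaction: a symmetric measurable function with
values in `[0, 1]` whose deviation from `1` has integral at most `U` in each variable. -/
structure IsRepulsive (μ : Measure Ω) (e : Ω → Ω → ℝ) (U : ℝ) : Prop where
  measurable : Measurable (uncurry e)
  nonneg : ∀ x y, 0 ≤ e x y
  le_one : ∀ x y, e x y ≤ 1
  symm : ∀ x y, e x y = e y x
  integral_le : ∀ x, ∫ y, (1 - e x y) ∂μ ≤ U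

/-- The weight `∏_{i<j} e(X_i, X_j)` of a configuration. -/
def pairWeight (e : Ω → Ω → ℝ) {n : ℕ} (X : Fin n → Ω) : ℝ :=
  ∏ i : Fin n, ∏ j ∈ Finset.Ioi i, e (X i) (X j)

lemma pairWeight_cons (e : Ω → Ω → ℝ) {n : ℕ} (x : Ω) (X : Fin n → Ω) :
    pairWeight e (Fin.cons x X : Fin (n + 1) → Ω) = (∏ j, e x (X j)) * pairWeight e X := by
  simp [pairWeight, Fin.prod_univ_succ, Fin.prod_Ioi_succ]

lemma integral_cons (μ : Measure Ω) [IsFiniteMeasure μ] {n : ℕ} {g : (Fin (n + 1) → Ω) → ℝ}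
    (hg : BddMeas g) :
    ∫ X, g X ∂Measure.pi (fun _ => μ) =
      ∫ x, ∫ X, g (Fin.cons x X) ∂Measure.pi (fun _ : Fin n => μ) ∂μ := by
  have h := (measurePreserving_piFinSuccAbove (fun _ : Fin (n + 1) => μ) 0).symm
  have hb : BddMeas fun p : Ω × (Fin n → Ω) => g (Fin.cons p.1 p.2) := by
    have := hg.comp h.measurable
    convert this using 2
    simp [MeasurableEquiv.piFinSuccAbove, Fin.consEquiv]
  rw [← integral_prod _ (hb.integrable _), ← h.integral_comp (MeasurableEquiv.measurableEmbedding _)]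
  simp [MeasurableEquiv.piFinSuccAbove, Fin.consEquiv]

lemma one_sub_sum_le_prod {ι : Type*} (s : Finset ι) {t : ι → ℝ} (h0 : ∀ i, 0 ≤ t i)
    (h1 : ∀ i, t i ≤ 1) : 1 - ∑ i ∈ s, (1 - t i) ≤ ∏ i ∈ s, t i := by
  classical
  induction s using Finset.induction_on with
  | empty => simp
  | insert a s ha ih =>
    rw [Finset.sum_insert ha, Finset.prod_insert ha]
    have h2 : ∏ i ∈ s, t i ≤ 1 := Finset.prod_le_one (fun i _ => h0 i) fun i _ => h1 i
    nlinarith [h0 a, h1 a]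

namespace IsRepulsive

variable {μ : Measure Ω} [IsFiniteMeasure μ] {e : Ω → Ω → ℝ} {U : ℝ} {n : ℕ}

lemma bddMeas (H : IsRepulsive μ e U) : BddMeas (uncurry e) :=
  ⟨H.measurable, 1, fun p => by
    rw [uncurry, abs_of_nonneg (H.nonneg _ _)]; exact H.le_one _ _⟩

lemma bddMeas_comp (H : IsRepulsive μ e U) {Y : Type*} [MeasurableSpace Y] {p q : Y → Ω}
    (hp : Measurable p) (hq : Measurable q) : BddMeas fun y => e (p y) (q y) :=
  H.bddMeas.comp (hp.prodMk hq)

lemma U_nonneg (H : IsRepulsive μ e U) (x : Ω) : 0 ≤ U :=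
  (integral_nonneg fun y => sub_nonneg.2 (H.le_one x y)).trans (H.integral_le x)

lemma bddMeas_pairWeight (H : IsRepulsive μ e U) :
    BddMeas (pairWeight e : (Fin n → Ω) → ℝ) :=
  BddMeas.prod _ fun i => BddMeas.prod _ fun j =>
    H.bddMeas_comp (measurable_pi_apply i) (measurable_pi_apply j)

lemma pairWeight_nonneg (H : IsRepulsive μ e U) (X : Fin n → Ω) : 0 ≤ pairWeight e X :=
  Finset.prod_nonneg fun _ _ => Finset.prod_nonneg fun _ _ => H.nonneg _ _

lemma prod_nonneg (H : IsRepulsive μ e U) {ι : Type*} (s : Finset ι) (x : Ω) (X : ι → Ω) :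
    0 ≤ ∏ j ∈ s, e x (X j) := Finset.prod_nonneg fun _ _ => H.nonneg _ _

lemma prod_le_one (H : IsRepulsive μ e U) {ι : Type*} (s : Finset ι) (x : Ω) (X : ι → Ω) :
    ∏ j ∈ s, e x (X j) ≤ 1 := Finset.prod_le_one (fun _ _ => H.nonneg _ _) fun _ _ => H.le_one _ _

lemma bddMeas_prod (H : IsRepulsive μ e U) {ι : Type*} (s : Finset ι) (X : ι → Ω) :
    BddMeas fun y => ∏ j ∈ s, e y (X j) :=
  BddMeas.prod _ fun _ => H.bddMeas_comp measurable_id measurable_const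

/-- The volume left free by finitely many particles. -/
lemma le_integral_prod (H : IsRepulsive μ e U) {ι : Type*} (s : Finset ι) (X : ι → Ω) :
    μ.real Set.univ - s.card * U ≤ ∫ y, ∏ j ∈ s, e y (X j) ∂μ := by
  have b : ∀ j, BddMeas fun y => 1 - e y (X j) := fun j =>
    (BddMeas.const 1).sub (H.bddMeas_comp measurable_id measurable_const)
  calc μ.real Set.univ - s.card * U ≤ ∫ y, (1 - ∑ j ∈ s, (1 - e y (X j))) ∂μ := by
        rw [integral_sub ((BddMeas.const 1).integrable _) ((BddMeas.sum s b).integrable _),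
          integral_finsetSum s fun j _ => (b j).integrable _, integral_const, smul_eq_mul, mul_one]
        refine sub_le_sub_left ?_ _
        rw [← nsmul_eq_mul]
        refine Finset.sum_le_card_nsmul _ _ _ fun j _ => ?_
        simp only [H.symm _ (X j)]
        exact H.integral_le _
    _ ≤ _ := integral_mono (((BddMeas.const 1).sub (BddMeas.sum s b)).integrable _)
        ((H.bddMeas_prod s X).integrable _) fun y =>
          one_sub_sum_le_prod s (fun j => H.nonneg _ _) fun j => H.le_one _ _

/-- Adding a particle multiplies the partition function by at least half of the volume. -/
lemma half_mul_integral_pairWeight_le (H : IsRepulsive μ e U)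
    (hU : 2 * (n * U) ≤ μ.real Set.univ) :
    μ.real Set.univ / 2 * ∫ X, pairWeight e X ∂Measure.pi (fun _ : Fin n => μ) ≤
      ∫ X, pairWeight e X ∂Measure.pi (fun _ : Fin (n + 1) => μ) := by
  have hb : BddMeas fun p : Ω × (Fin n → Ω) => (∏ j, e p.1 (p.2 j)) * pairWeight e p.2 :=
    (BddMeas.prod _ fun j => H.bddMeas_comp measurable_fst
      ((measurable_pi_apply j).comp measurable_snd)).mul (H.bddMeas_pairWeight.comp measurable_snd)
  rw [integral_cons μ H.bddMeas_pairWeight]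
  simp only [pairWeight_cons]
  rw [integral_integral_swap (hb.integrable _), ← integral_const_mul]
  refine integral_mono ((H.bddMeas_pairWeight.const_mul _).integrable _)
    (((hb.comp measurable_swap).integral μ).integrable _) fun X => ?_
  simp only [integral_mul_const]
  refine mul_le_mul_of_nonneg_right ?_ (H.pairWeight_nonneg X)
  have := H.le_integral_prod Finset.univ X
  rw [Finset.card_univ, Fintype.card_fin] at this
  linarith

lemma integral_pairWeight_pos (H : IsRepulsive μ e U) (hμ : 0 < μ.real Set.univ)
    (hU : 2 * (n * U) ≤ μ.real Set.univ) :
    0 < ∫ X, pairWeight e X ∂Measure.pi (fun _ : Fin n => μ) := by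
  by_cases hΩ : Nonempty Ω
  swap
  · rw [not_nonempty_iff] at hΩ
    simp [Set.eq_empty_of_isEmpty] at hμ
  have hU0 := H.U_nonneg hΩ.some
  induction n with
  | zero => simp [pairWeight, measureReal_def]
  | succ n ih =>
    push_cast at hU
    have h2 : 2 * (n * U) ≤ μ.real Set.univ := by nlinarith
    exact (mul_pos (half_pos hμ) (ih h2)).trans_le (H.half_mul_integral_pairWeight_le h2)

/-- The density of `n` particles in the field of a further particle at `x`. -/
def _root_.pinnedDensity (e : Ω → Ω → ℝ) (x : Ω) {n : ℕ} (X : Fin n → Ω) : ℝ :=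
  (∏ j, e x (X j)) * pairWeight e X

/-- The conditional density of particle `i` in the field of a particle at `x`. -/
def _root_.pinnedConditional (e : Ω → Ω → ℝ) (x : Ω) {n : ℕ} (i : Fin n) (X : Fin n → Ω)
    (y : Ω) : ℝ :=
  e x y * ∏ k ∈ Finset.univ.erase i, e y (X k)

/-- The weight of the particles other than `i` in the field of a particle at `x`. -/
def _root_.pinnedRest (e : Ω → Ω → ℝ) (x : Ω) {n : ℕ} (i : Fin n) (X : Fin n → Ω) : ℝ :=
  (∏ k ∈ Finset.univ.erase i, e x (X k)) *
    ∏ p : Fin n, ∏ q ∈ Finset.Ioi p, if p = i ∨ q = i then 1 else e (X p) (X q)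

lemma pinnedDensity_update (H : IsRepulsive μ e U) (x : Ω) (i : Fin n) (X : Fin n → Ω) (y : Ω) :
    pinnedDensity e x (update X i y) = pinnedRest e x i X * pinnedConditional e x i X y := by
  have h1 : ∏ j, e x (update X i y j) = e x y * ∏ k ∈ Finset.univ.erase i, e x (X k) := by
    rw [← Finset.mul_prod_erase _ _ (Finset.mem_univ i), update_self]
    congr 1
    exact Finset.prod_congr rfl fun k hk => by rw [update_of_ne (Finset.ne_of_mem_erase hk)]
  have h2 : pairWeight e (update X i y) =
      (∏ p : Fin n, ∏ q ∈ Finset.Ioi p, if p = i ∨ q = i then 1 else e (X p) (X q)) *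
      ∏ p : Fin n, ∏ q ∈ Finset.Ioi p,
        if p = i ∨ q = i then e (update X i y p) (update X i y q) else 1 := by
    rw [pairWeight, ← Finset.prod_mul_distrib]
    refine Finset.prod_congr rfl fun p _ => ?_
    rw [← Finset.prod_mul_distrib]
    refine Finset.prod_congr rfl fun q _ => ?_
    by_cases h : p = i ∨ q = i
    · simp [h]
    · rw [if_neg h, if_neg h, mul_one]
      push Not at h
      rw [update_of_ne h.1, update_of_ne h.2]
  have h3 : ∀ p : Fin n, (∏ q ∈ Finset.Ioi p,
        if p = i ∨ q = i then e (update X i y p) (update X i y q) else 1) =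
      if p = i then ∏ q ∈ Finset.Ioi i, e y (X q) else if p < i then e y (X p) else 1 := by
    intro p
    by_cases hp : p = i
    · subst hp
      simp only [true_or, if_true, update_self]
      exact Finset.prod_congr rfl fun q hq => by
        rw [update_of_ne (Finset.mem_Ioi.1 hq).ne']
    · simp only [hp, false_or, if_false]
      rw [Finset.prod_ite_eq']
      simp [update_of_ne hp, H.symm (X p) y]
  have h4 : (∏ p : Fin n, if p = i then ∏ q ∈ Finset.Ioi i, e y (X q) else
      if p < i then e y (X p) else 1) = ∏ k ∈ Finset.univ.erase i, e y (X k) := by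
    rw [← Finset.mul_prod_erase _ _ (Finset.mem_univ i), if_pos rfl]
    have : ∏ q ∈ Finset.Ioi i, e y (X q) =
        ∏ k ∈ Finset.univ.erase i, if i < k then e y (X k) else 1 := by
      rw [← Finset.prod_filter]
      refine Finset.prod_congr ?_ fun _ _ => rfl
      ext q
      simp only [Finset.mem_Ioi, Finset.mem_filter, Finset.mem_erase, Finset.mem_univ, and_true]
      exact ⟨fun h => ⟨h.ne', h⟩, fun h => h.2⟩
    rw [this, ← Finset.prod_mul_distrib]
    refine Finset.prod_congr rfl fun k hk => ?_
    have hki := Finset.ne_of_mem_erase hk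
    rw [if_neg hki]
    rcases lt_or_gt_of_ne hki with h | h
    · simp [h, h.not_gt]
    · simp [h, h.not_gt]
  rw [pinnedDensity, h1, h2, Finset.prod_congr rfl fun p _ => h3 p, h4, pinnedRest,
    pinnedConditional]
  ring

/-- At low density the particles in the field of a further particle satisfy Dobrushin's
condition. -/
lemma isGibbsDensity (H : IsRepulsive μ e U) (hμ : 0 < μ.real Set.univ)
    (hU : 2 * (n * U) ≤ μ.real Set.univ) (x : Ω) :
    IsGibbsDensity μ (pinnedDensity e x : (Fin n → Ω) → ℝ) (pinnedConditional e x)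
      (pinnedRest e x) (μ.real Set.univ / 2) (2 * U) where
  bddMeas := (BddMeas.prod _ fun j => H.bddMeas_comp measurable_const
    (measurable_pi_apply j)).mul H.bddMeas_pairWeight
  nonneg X := mul_nonneg (H.prod_nonneg _ _ _) (H.pairWeight_nonneg X)
  bddMeas_w i := (H.bddMeas_comp measurable_const measurable_snd).mul (BddMeas.prod _ fun j =>
    H.bddMeas_comp measurable_snd ((measurable_pi_apply j).comp measurable_fst))
  w_nonneg i X y := mul_nonneg (H.nonneg _ _) (H.prod_nonneg _ _ _)
  bddMeas_R i := by
    refine (BddMeas.prod _ fun j => H.bddMeas_comp measurable_const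
      (measurable_pi_apply j)).mul (BddMeas.prod _ fun p => BddMeas.prod _ fun q => ?_)
    by_cases h : p = i ∨ q = i
    · simpa [h] using BddMeas.const 1
    · simpa [h] using H.bddMeas_comp (measurable_pi_apply p) (measurable_pi_apply q)
  update_eq := H.pinnedDensity_update x
  w_update i X z := by
    ext y
    rw [pinnedConditional, pinnedConditional]
    congr 1
    exact Finset.prod_congr rfl fun k hk => by rw [update_of_ne (Finset.ne_of_mem_erase hk)]
  R_update i X z := by
    rw [pinnedRest, pinnedRest]
    congr 1
    · exact Finset.prod_congr rfl fun k hk => by rw [update_of_ne (Finset.ne_of_mem_erase hk)]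
    · refine Finset.prod_congr rfl fun p _ => Finset.prod_congr rfl fun q _ => ?_
      by_cases h : p = i ∨ q = i
      · simp [h]
      · rw [if_neg h, if_neg h]
        push Not at h
        rw [update_of_ne h.1, update_of_ne h.2]
  c_pos := half_pos hμ
  le_integral_w i X := by
    have b1 : BddMeas fun y => e x y := H.bddMeas_comp measurable_const measurable_id
    have b2 := H.bddMeas_prod (Finset.univ.erase i) X
    have h1 : ∀ y, e x y - (1 - ∏ k ∈ Finset.univ.erase i, e y (X k)) ≤
        pinnedConditional e x i X y := fun y => by
      rw [pinnedConditional]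
      nlinarith [H.nonneg x y, H.le_one x y, H.prod_nonneg (Finset.univ.erase i) y X,
        H.prod_le_one (Finset.univ.erase i) y X]
    have h2 := integral_mono ((b1.sub ((BddMeas.const 1).sub b2)).integrable μ)
      ((b1.mul b2).integrable μ) h1
    refine le_trans ?_ h2
    have h3 := H.le_integral_prod (Finset.univ.erase i) X
    have h4 := H.integral_le x
    rw [integral_sub ((BddMeas.const 1).integrable _) (b1.integrable _)] at h4
    rw [integral_sub (b1.integrable _) (((BddMeas.const 1).sub b2).integrable _),
      integral_sub ((BddMeas.const 1).integrable _) (b2.integrable _)]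
    rw [Finset.card_erase_of_mem (Finset.mem_univ i), Finset.card_univ, Fintype.card_fin,
      Nat.cast_sub i.pos, Nat.cast_one] at h3
    linarith
  integral_w_sub_le i k hki X z := by
    have b1 : BddMeas fun y => e (X k) y := H.bddMeas_comp measurable_const measurable_id
    have b2 : BddMeas fun y => e z y := H.bddMeas_comp measurable_const measurable_id
    have bw : ∀ X : Fin n → Ω, BddMeas (pinnedConditional e x i X) := fun X =>
      (H.bddMeas_comp measurable_const measurable_id).mul (H.bddMeas_prod _ X)
    have h1 : ∀ y, |pinnedConditional e x i X y - pinnedConditional e x i (update X k z) y| ≤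
        (1 - e (X k) y) + (1 - e z y) := fun y => by
      have hk : k ∈ Finset.univ.erase i := Finset.mem_erase.2 ⟨hki, Finset.mem_univ k⟩
      have : pinnedConditional e x i X y - pinnedConditional e x i (update X k z) y =
          (e x y * ∏ j ∈ (Finset.univ.erase i).erase k, e y (X j)) * (e (X k) y - e z y) := by
        rw [pinnedConditional, pinnedConditional, ← Finset.mul_prod_erase _ _ hk,
          ← Finset.mul_prod_erase _ (fun j => e y (update X k z j)) hk, update_self,
          show ∏ j ∈ (Finset.univ.erase i).erase k, e y (update X k z j) =
              ∏ j ∈ (Finset.univ.erase i).erase k, e y (X j) from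
            Finset.prod_congr rfl fun j hj => by
              rw [update_of_ne (Finset.ne_of_mem_erase hj)], H.symm y (X k), H.symm y z]
        ring
      rw [this, abs_mul, abs_of_nonneg (mul_nonneg (H.nonneg _ _) (H.prod_nonneg _ _ _))]
      have h2 : |e (X k) y - e z y| ≤ (1 - e (X k) y) + (1 - e z y) := by
        rw [abs_le]
        constructor <;> linarith [H.le_one (X k) y, H.le_one z y]
      refine le_trans (mul_le_of_le_one_left (abs_nonneg _) ?_) h2
      exact mul_le_one₀ (H.le_one _ _) (H.prod_nonneg _ _ _) (H.prod_le_one _ _ _)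
    have i1 := ((BddMeas.const 1).sub b1).integrable μ
    have i2 := ((BddMeas.const 1).sub b2).integrable μ
    calc _ ≤ ∫ y, ((1 - e (X k) y) + (1 - e z y)) ∂μ :=
          integral_mono (((bw _).sub (bw _)).abs.integrable _) (i1.add i2) h1
      _ ≤ 2 * U := by
          rw [integral_add i1 i2]
          linarith [H.integral_le (X k), H.integral_le z]

end IsRepulsive

end PairWeight

/-! ### The three-body integral -/

section ThreeBody

variable {Ω : Type*} [MeasurableSpace Ω]

/-- The force-like observable `∫ F(x, y) ∏_j e(y, X_j) dy` felt by a particle at `x`. -/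
noncomputable def pinnedField (μ : Measure Ω) (F e : Ω → Ω → ℝ) (x : Ω) {n : ℕ}
    (X : Fin n → Ω) : ℝ :=
  ∫ y, F x y * ∏ j, e y (X j) ∂μ

/-- The three-body integrand, with the particles `0`, `1`, `2` split off. -/
def threeBody (F e : Ω → Ω → ℝ) {n : ℕ} (X : Fin (n + 3) → Ω) : ℝ :=
  F (X 0) (X 1) * F (X 0) (X 2) * e (X 1) (X 2) *
    ((∏ j : Fin n, e (X 1) (X j.succ.succ.succ)) * ∏ j : Fin n, e (X 2) (X j.succ.succ.succ)) *
    pinnedDensity e (X 0) fun j : Fin n => X j.succ.succ.succ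

namespace IsRepulsive

variable {μ : Measure Ω} [IsFiniteMeasure μ] {F e : Ω → Ω → ℝ} {U : ℝ} {n : ℕ}

lemma bddMeas_prod_comp (H : IsRepulsive μ e U) {Y : Type*} [MeasurableSpace Y] {p : Y → Ω}
    {q : Y → Fin n → Ω} (hp : Measurable p) (hq : Measurable q) (s : Finset (Fin n)) :
    BddMeas fun y => ∏ j ∈ s, e (p y) (q y j) :=
  BddMeas.prod _ fun j => H.bddMeas_comp hp ((measurable_pi_apply j).comp hq)

lemma bddMeas_pinnedDensity_comp (H : IsRepulsive μ e U) {Y : Type*} [MeasurableSpace Y]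
    {p : Y → Ω} {q : Y → Fin n → Ω} (hp : Measurable p) (hq : Measurable q) :
    BddMeas fun y => pinnedDensity e (p y) (q y) :=
  (H.bddMeas_prod_comp hp hq _).mul (H.bddMeas_pairWeight.comp hq)

lemma pinnedDensity_nonneg (H : IsRepulsive μ e U) (x : Ω) (X : Fin n → Ω) :
    0 ≤ pinnedDensity e x X := mul_nonneg (H.prod_nonneg _ _ _) (H.pairWeight_nonneg X)

lemma bddMeas_pinnedField (H : IsRepulsive μ e U) (hF : BddMeas (uncurry F)) (x : Ω) :
    BddMeas (pinnedField μ F e x : (Fin n → Ω) → ℝ) := by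
  have : BddMeas fun p : (Fin n → Ω) × Ω => F x p.2 * ∏ j, e p.2 (p.1 j) :=
    (hF.comp (measurable_const.prodMk measurable_snd)).mul
      (H.bddMeas_prod_comp measurable_snd measurable_fst _)
  exact this.integral μ

/-- By reflection symmetry about `x` the observable `pinnedField` has mean zero. -/
lemma integral_pinnedField_eq_zero (H : IsRepulsive μ e U) (hF : BddMeas (uncurry F)) (x : Ω)
    {σ : Ω → Ω} (hσ : MeasurePreserving σ μ μ) (hσe : ∀ y z, e (σ y) (σ z) = e y z)
    (hσx : ∀ y, e x (σ y) = e x y) (hσF : ∀ y, F x (σ y) = - F x y) :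
    ∫ X, pinnedField μ F e x X * pinnedDensity e x X ∂Measure.pi (fun _ : Fin n => μ) = 0 := by
  have hpi : MeasurePreserving (fun (X : Fin n → Ω) j => σ (X j)) (Measure.pi fun _ => μ)
      (Measure.pi fun _ => μ) := measurePreserving_pi _ _ fun _ => hσ
  have hb : BddMeas fun X : Fin n → Ω => pinnedField μ F e x X * pinnedDensity e x X :=
    (H.bddMeas_pinnedField hF x).mul (H.bddMeas_pinnedDensity_comp measurable_const measurable_id)
  have hfield : ∀ X : Fin n → Ω, pinnedField μ F e x (fun j => σ (X j)) = - pinnedField μ F e x X :=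
    fun X => by
      have hb : BddMeas fun y => F x y * ∏ j, e y (σ (X j)) :=
        (hF.comp (measurable_const.prodMk measurable_id)).mul (H.bddMeas_prod _ _)
      rw [pinnedField, pinnedField, ← integral_neg]
      conv_lhs => rw [← hσ.map_eq]
      rw [integral_map hσ.measurable.aemeasurable hb.measurable.aestronglyMeasurable]
      simp [hσe, hσF]
  have hdens : ∀ X : Fin n → Ω, pinnedDensity e x (fun j => σ (X j)) = pinnedDensity e x X :=
    fun X => by simp [pinnedDensity, pairWeight, hσe, hσx]
  have h := integral_map (μ := Measure.pi fun _ : Fin n => μ) hpi.measurable.aemeasurable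
    (f := fun X => pinnedField μ F e x X * pinnedDensity e x X)
    hb.measurable.aestronglyMeasurable
  rw [hpi.map_eq] at h
  simp only [hfield, hdens, neg_mul, integral_neg] at h
  linarith

/-- The Poincaré inequality applied to `pinnedField`: removing the particle `i` changes it by at
most `K(X_i)`, where `K(z) = ∫ |F(x, y)| (1 - e(y, z)) dy`. -/
lemma integral_sq_pinnedField_le (H : IsRepulsive μ e U) (hF : BddMeas (uncurry F)) (x : Ω)
    (hμ : 0 < μ.real Set.univ) (hn : 0 < n) (hU : 16 * (n * U) ≤ μ.real Set.univ)
    (h0 : ∫ X, pinnedField μ F e x X * pinnedDensity e x X ∂Measure.pi (fun _ : Fin n => μ) = 0)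
    {κ : ℝ} (hκ : ∫ z, (∫ y, |F x y| * (1 - e y z) ∂μ) ^ 2 ∂μ ≤ κ) :
    ∫ X, pinnedField μ F e x X ^ 2 * pinnedDensity e x X ∂Measure.pi (fun _ : Fin n => μ) ≤
      4 * n * κ / μ.real Set.univ *
        ∫ X, pinnedDensity e x X ∂Measure.pi (fun _ : Fin n => μ) := by
  set V := μ.real Set.univ with hV
  have : Nonempty (Fin n) := ⟨⟨0, hn⟩⟩
  have hU0 := H.U_nonneg x
  have hnU : 0 ≤ n * U := by positivity
  have G := H.isGibbsDensity (n := n) hμ (by linarith) x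
  have hB := H.bddMeas_pinnedField (n := n) hF x
  set K : Ω → ℝ := fun z => ∫ y, |F x y| * (1 - e y z) ∂μ with hK
  have bF : BddMeas (F x) := hF.comp (measurable_const.prodMk measurable_id)
  have bK : BddMeas K := by
    have : BddMeas fun p : Ω × Ω => |F x p.2| * (1 - e p.2 p.1) :=
      (bF.comp measurable_snd).abs.mul
        ((BddMeas.const 1).sub (H.bddMeas_comp measurable_snd measurable_fst))
    exact this.integral μ
  have hp := G.poincare (by rw [Fintype.card_fin]; linarith) hB h0
  set Z := ∫ X, pinnedDensity e x X ∂Measure.pi (fun _ : Fin n => μ) with hZ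
  have hi : ∀ i : Fin n, ∫ X, (pinnedField μ F e x X -
      heatBath μ (pinnedConditional e x) i (pinnedField μ F e x) X) ^ 2 * pinnedDensity e x X
      ∂Measure.pi (fun _ : Fin n => μ) ≤ 2 * κ / V * Z := by
    intro i
    set h : (Fin n → Ω) → ℝ := fun X => ∫ y, F x y * ∏ j ∈ Finset.univ.erase i, e y (X j) ∂μ
      with hh
    have bh : BddMeas h := by
      have : BddMeas fun p : (Fin n → Ω) × Ω =>
          F x p.2 * ∏ j ∈ Finset.univ.erase i, e p.2 (p.1 j) :=
        (bF.comp measurable_snd).mul (H.bddMeas_prod_comp measurable_snd measurable_fst _)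
      exact this.integral μ
    have hup : ∀ X z, h (update X i z) = h X := fun X z => by
      simp only [hh]
      refine integral_congr_ae (.of_forall fun y => ?_)
      simp only
      congr 1
      exact Finset.prod_congr rfl fun k hk => by rw [update_of_ne (Finset.ne_of_mem_erase hk)]
    refine (G.integral_sub_heatBath_sq_le hB bh hup).trans ?_
    have hdiff : ∀ X, |pinnedField μ F e x X - h X| ≤ K (X i) := fun X => by
      have b1 := H.bddMeas_prod Finset.univ X
      have b2 := H.bddMeas_prod (Finset.univ.erase i) X
      have b3 : BddMeas fun y => e y (X i) := H.bddMeas_comp measurable_id measurable_const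
      rw [pinnedField, ← integral_sub ((bF.mul b1).integrable _) ((bF.mul b2).integrable _)]
      refine abs_integral_le_integral_abs.trans (integral_mono
        (((bF.mul b1).sub (bF.mul b2)).abs.integrable _)
        ((bF.abs.mul ((BddMeas.const 1).sub b3)).integrable _) fun y => ?_)
      have e1 : F x y * ∏ j, e y (X j) - F x y * ∏ j ∈ Finset.univ.erase i, e y (X j) =
          (F x y * (e y (X i) - 1)) * ∏ j ∈ Finset.univ.erase i, e y (X j) := by
        rw [← Finset.mul_prod_erase _ _ (Finset.mem_univ i)]
        ring
      simp only [e1]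
      rw [abs_mul, abs_mul, abs_sub_comm, abs_of_nonneg (sub_nonneg.2 (H.le_one _ _)),
        abs_of_nonneg (H.prod_nonneg _ _ _)]
      exact mul_le_of_le_one_right (mul_nonneg (abs_nonneg _) (sub_nonneg.2 (H.le_one _ _)))
        (H.prod_le_one _ _ _)
    have hR := (G.bddMeas_R i).integrable (Measure.pi fun _ : Fin n => μ)
    set r := ∫ X, pinnedRest e x i X ∂Measure.pi (fun _ : Fin n => μ) with hr
    have hR0 : ∀ X, 0 ≤ pinnedRest e x i X := fun X => by
      refine mul_nonneg (H.prod_nonneg _ _ _) (Finset.prod_nonneg fun p _ =>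
        Finset.prod_nonneg fun q _ => ?_)
      split_ifs
      exacts [zero_le_one, H.nonneg _ _]
    have hbD : BddMeas (pinnedDensity e x : (Fin n → Ω) → ℝ) := G.bddMeas
    have bKi : BddMeas fun X : Fin n → Ω => K (X i) := bK.comp (measurable_pi_apply i)
    have hZr : V / 2 * r ≤ V * Z := by
      rw [hZ, integral_update μ i hbD, hr, ← integral_const_mul]
      refine integral_mono (hR.const_mul _)
        (((hbD.comp (measurable_update_prod i)).integral μ).integrable _) fun X => ?_
      simp only [H.pinnedDensity_update, integral_const_mul]
      rw [mul_comm]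
      exact mul_le_mul_of_nonneg_left (G.le_integral_w i X) (hR0 X)
    have hKr : V * ∫ X, K (X i) ^ 2 * pinnedDensity e x X ∂Measure.pi (fun _ : Fin n => μ) ≤
        κ * r := by
      have hb := (bKi.pow 2).mul hbD
      rw [integral_update μ i hb, hr, ← integral_const_mul]
      refine integral_mono (((hb.comp (measurable_update_prod i)).integral μ).integrable _)
        (hR.const_mul _) fun X => ?_
      simp only [H.pinnedDensity_update, update_self]
      calc ∫ y, K y ^ 2 * (pinnedRest e x i X * pinnedConditional e x i X y) ∂μ
          ≤ ∫ y, K y ^ 2 * pinnedRest e x i X ∂μ := by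
            refine integral_mono (((bK.pow 2).mul
              ((G.bddMeas_w_right i X).const_mul _)).integrable _)
              (((bK.pow 2).mul (BddMeas.const _)).integrable _) fun y => ?_
            refine mul_le_mul_of_nonneg_left (mul_le_of_le_one_right (hR0 X) ?_) (sq_nonneg _)
            exact mul_le_one₀ (H.le_one _ _) (H.prod_nonneg _ _ _) (H.prod_le_one _ _ _)
        _ ≤ κ * pinnedRest e x i X := by
            rw [integral_mul_const]
            exact mul_le_mul_of_nonneg_right hκ (hR0 X)
    have hκ0 : 0 ≤ κ := (integral_nonneg fun z => sq_nonneg _).trans hκ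
    calc _ ≤ ∫ X, K (X i) ^ 2 * pinnedDensity e x X ∂Measure.pi (fun _ : Fin n => μ) := by
          refine integral_mono ((((hB.sub bh).pow 2).mul hbD).integrable _)
            (((bKi.pow 2).mul hbD).integrable _) fun X => ?_
          refine mul_le_mul_of_nonneg_right ?_ (H.pinnedDensity_nonneg x X)
          rw [← sq_abs]
          exact pow_le_pow_left₀ (abs_nonneg _) (hdiff X) 2
      _ ≤ _ := by
          have : r ≤ 2 * Z := by
            refine le_of_mul_le_mul_left ?_ (half_pos hμ)
            linarith
          rw [div_mul_eq_mul_div, le_div_iff₀ hμ, mul_comm]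
          nlinarith [mul_le_mul_of_nonneg_left this hκ0]
  refine hp.trans ?_
  have := Finset.sum_le_card_nsmul Finset.univ _ _ fun i _ => hi i
  rw [Finset.card_univ, Fintype.card_fin, nsmul_eq_mul] at this
  calc _ ≤ 2 * (n * (2 * κ / V * Z)) := by linarith
    _ = _ := by ring

/-- The three-body integral with the first particle fixed. Writing `e(y, z) = 1 - (1 - e(y, z))`
for the interaction of the other two, the `1` produces the variance of `pinnedField`, and the rest
is bounded by absolute values. -/
lemma abs_integral_threeBody_pinned_le (H : IsRepulsive μ e U) (hF : BddMeas (uncurry F)) (x : Ω)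
    {κ S : ℝ}
    (hκ : ∫ X, pinnedField μ F e x X ^ 2 * pinnedDensity e x X ∂Measure.pi (fun _ : Fin n => μ) ≤
      κ * ∫ X, pinnedDensity e x X ∂Measure.pi (fun _ : Fin n => μ))
    (hS : ∫ y, ∫ z, |F x y| * |F x z| * (1 - e y z) ∂μ ∂μ ≤ S) :
    |∫ y, ∫ z, ∫ X, F x y * F x z * e y z * ((∏ j, e y (X j)) * ∏ j, e z (X j)) *
        pinnedDensity e x X ∂Measure.pi (fun _ : Fin n => μ) ∂μ ∂μ| ≤
      (κ + S) * ∫ X, pinnedDensity e x X ∂Measure.pi (fun _ : Fin n => μ) := by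
  set π := Measure.pi (fun _ : Fin n => μ) with hπ
  have bF : BddMeas (F x) := hF.comp (measurable_const.prodMk measurable_id)
  -- the integrand as a function of `((y, z), X)`
  have b1 : BddMeas fun p : (Ω × Ω) × (Fin n → Ω) => F x p.1.1 * F x p.1.2 * e p.1.1 p.1.2 *
      ((∏ j, e p.1.1 (p.2 j)) * ∏ j, e p.1.2 (p.2 j)) * pinnedDensity e x p.2 :=
    ((((bF.comp (measurable_fst.comp measurable_fst)).mul
      (bF.comp (measurable_snd.comp measurable_fst))).mul
      (H.bddMeas_comp (measurable_fst.comp measurable_fst)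
        (measurable_snd.comp measurable_fst))).mul
      ((H.bddMeas_prod_comp (measurable_fst.comp measurable_fst) measurable_snd _).mul
        (H.bddMeas_prod_comp (measurable_snd.comp measurable_fst) measurable_snd _))).mul
      (H.bddMeas_pinnedDensity_comp measurable_const measurable_snd)
  have hswap : ∫ y, ∫ z, ∫ X, F x y * F x z * e y z * ((∏ j, e y (X j)) * ∏ j, e z (X j)) *
        pinnedDensity e x X ∂π ∂μ ∂μ =
      ∫ X, (∫ p, F x p.1 * F x p.2 * e p.1 p.2 * ((∏ j, e p.1 (X j)) * ∏ j, e p.2 (X j))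
        ∂μ.prod μ) * pinnedDensity e x X ∂π := by
    have h1 := integral_prod _ ((b1.integral π).integrable (μ.prod μ))
    simp only at h1
    rw [← h1, integral_integral_swap (b1.integrable _)]
    simp only [integral_mul_const]
  have hinner : ∀ X : Fin n → Ω,
      |∫ p, F x p.1 * F x p.2 * e p.1 p.2 * ((∏ j, e p.1 (X j)) * ∏ j, e p.2 (X j)) ∂μ.prod μ -
        pinnedField μ F e x X ^ 2| ≤ S := fun X => by
    have b2 : BddMeas fun y => F x y * ∏ j, e y (X j) := bF.mul (H.bddMeas_prod _ X)
    have b3 : BddMeas fun p : Ω × Ω => (F x p.1 * ∏ j, e p.1 (X j)) *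
        (F x p.2 * ∏ j, e p.2 (X j)) := (b2.comp measurable_fst).mul (b2.comp measurable_snd)
    have be : BddMeas fun p : Ω × Ω => e p.1 p.2 := H.bddMeas
    have b4 : BddMeas fun p : Ω × Ω => |F x p.1| * |F x p.2| * (1 - e p.1 p.2) :=
      ((bF.comp measurable_fst).abs.mul (bF.comp measurable_snd).abs).mul
        ((BddMeas.const 1).sub be)
    have b5 : BddMeas fun p : Ω × Ω => F x p.1 * F x p.2 * e p.1 p.2 *
        ((∏ j, e p.1 (X j)) * ∏ j, e p.2 (X j)) :=
      (((bF.comp measurable_fst).mul (bF.comp measurable_snd)).mul be).mul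
        (((H.bddMeas_prod _ X).comp measurable_fst).mul ((H.bddMeas_prod _ X).comp measurable_snd))
    have hsq : pinnedField μ F e x X ^ 2 = ∫ p, (F x p.1 * ∏ j, e p.1 (X j)) *
        (F x p.2 * ∏ j, e p.2 (X j)) ∂μ.prod μ := by
      rw [integral_prod_mul (fun y => F x y * ∏ j, e y (X j)) fun y => F x y * ∏ j, e y (X j),
        sq, pinnedField]
    rw [hsq, ← integral_sub (b5.integrable _) (b3.integrable _)]
    refine abs_integral_le_integral_abs.trans (le_trans ?_ hS)
    have h2 := integral_prod _ (b4.integrable (μ.prod μ))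
    simp only at h2
    rw [← h2]
    refine integral_mono ((b5.sub b3).abs.integrable _) (b4.integrable _) fun p => ?_
    simp only
    have e1 : F x p.1 * F x p.2 * e p.1 p.2 * ((∏ j, e p.1 (X j)) * ∏ j, e p.2 (X j)) -
        (F x p.1 * ∏ j, e p.1 (X j)) * (F x p.2 * ∏ j, e p.2 (X j)) =
        (F x p.1 * F x p.2 * (e p.1 p.2 - 1)) * ((∏ j, e p.1 (X j)) * ∏ j, e p.2 (X j)) := by ring
    rw [e1, abs_mul, abs_mul, abs_mul, abs_sub_comm, abs_of_nonneg (sub_nonneg.2 (H.le_one _ _)),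
      abs_of_nonneg (mul_nonneg (H.prod_nonneg _ _ _) (H.prod_nonneg _ _ _))]
    refine mul_le_of_le_one_right (mul_nonneg (mul_nonneg (abs_nonneg _) (abs_nonneg _))
      (sub_nonneg.2 (H.le_one _ _))) ?_
    exact mul_le_one₀ (H.prod_le_one _ _ _) (H.prod_nonneg _ _ _) (H.prod_le_one _ _ _)
  have hbD : BddMeas (pinnedDensity e x : (Fin n → Ω) → ℝ) :=
    H.bddMeas_pinnedDensity_comp measurable_const measurable_id
  have hbB := H.bddMeas_pinnedField (n := n) hF x
  have hbI : BddMeas fun X : Fin n → Ω => ∫ p, F x p.1 * F x p.2 * e p.1 p.2 *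
      ((∏ j, e p.1 (X j)) * ∏ j, e p.2 (X j)) ∂μ.prod μ := by
    have : BddMeas fun q : (Fin n → Ω) × (Ω × Ω) => F x q.2.1 * F x q.2.2 * e q.2.1 q.2.2 *
        ((∏ j, e q.2.1 (q.1 j)) * ∏ j, e q.2.2 (q.1 j)) :=
      (((bF.comp (measurable_fst.comp measurable_snd)).mul
        (bF.comp (measurable_snd.comp measurable_snd))).mul
        (H.bddMeas_comp (measurable_fst.comp measurable_snd)
          (measurable_snd.comp measurable_snd))).mul
        ((H.bddMeas_prod_comp (measurable_fst.comp measurable_snd) measurable_fst _).mul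
          (H.bddMeas_prod_comp (measurable_snd.comp measurable_snd) measurable_fst _))
    exact this.integral _
  rw [hswap]
  have hsplit : ∫ X, (∫ p, F x p.1 * F x p.2 * e p.1 p.2 *
        ((∏ j, e p.1 (X j)) * ∏ j, e p.2 (X j)) ∂μ.prod μ) * pinnedDensity e x X ∂π =
      ∫ X, pinnedField μ F e x X ^ 2 * pinnedDensity e x X ∂π +
      ∫ X, ((∫ p, F x p.1 * F x p.2 * e p.1 p.2 *
        ((∏ j, e p.1 (X j)) * ∏ j, e p.2 (X j)) ∂μ.prod μ) - pinnedField μ F e x X ^ 2) *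
          pinnedDensity e x X ∂π := by
    rw [← integral_add (((hbB.pow 2).mul hbD).integrable _)
      (((hbI.sub (hbB.pow 2)).mul hbD).integrable _)]
    exact integral_congr_ae (.of_forall fun X => by ring)
  have hlast := abs_integral_mul_le π (hbI.sub (hbB.pow 2)) hbD hinner
  simp only [abs_of_nonneg (H.pinnedDensity_nonneg x _)] at hlast
  have hpos : 0 ≤ ∫ X, pinnedField μ F e x X ^ 2 * pinnedDensity e x X ∂π :=
    integral_nonneg fun X => mul_nonneg (sq_nonneg _) (H.pinnedDensity_nonneg x X)
  rw [hsplit, add_mul]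
  refine (abs_add_le _ _).trans (add_le_add ?_ hlast)
  rwa [abs_of_nonneg hpos]

lemma bddMeas_threeBody (H : IsRepulsive μ e U) (hF : BddMeas (uncurry F)) :
    BddMeas (threeBody F e : (Fin (n + 3) → Ω) → ℝ) := by
  have ht : Measurable fun (X : Fin (n + 3) → Ω) (j : Fin n) => X j.succ.succ.succ :=
    measurable_pi_lambda _ fun j => measurable_pi_apply _
  have hF' : ∀ i j : Fin (n + 3), BddMeas fun X : Fin (n + 3) → Ω => F (X i) (X j) :=
    fun i j => hF.comp (φ := fun X : Fin (n + 3) → Ω => (X i, X j))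
      ((measurable_pi_apply i).prodMk (measurable_pi_apply j))
  exact ((((hF' 0 1).mul (hF' 0 2)).mul
    (H.bddMeas_comp (measurable_pi_apply 1) (measurable_pi_apply 2))).mul
    ((H.bddMeas_prod_comp (measurable_pi_apply 1) ht _).mul
      (H.bddMeas_prod_comp (measurable_pi_apply 2) ht _))).mul
    (H.bddMeas_pinnedDensity_comp (measurable_pi_apply 0) ht)

/-- The three-body integral is small compared with the partition function. Here `F` is odd under
the reflections `σ x` about each point `x`, `κ` bounds the squared `L²` norm of `|F| * (1 - e)`, and
`S` bounds the integral of `|F| |F| (1 - e)`. -/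
theorem abs_integral_threeBody_le (H : IsRepulsive μ e U) (hF : BddMeas (uncurry F))
    (hμ : 0 < μ.real Set.univ) (hn : 0 < n) (hU : 16 * ((n + 3 : ℕ) * U) ≤ μ.real Set.univ)
    {σ : Ω → Ω → Ω} (hσ : ∀ x, MeasurePreserving (σ x) μ μ)
    (hσe : ∀ x y z, e (σ x y) (σ x z) = e y z) (hσx : ∀ x y, e x (σ x y) = e x y)
    (hσF : ∀ x y, F x (σ x y) = - F x y) {κ S : ℝ}
    (hκ : ∀ x, ∫ z, (∫ y, |F x y| * (1 - e y z) ∂μ) ^ 2 ∂μ ≤ κ)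
    (hS : ∀ x, ∫ y, ∫ z, |F x y| * |F x z| * (1 - e y z) ∂μ ∂μ ≤ S) :
    |∫ X, threeBody F e X ∂Measure.pi (fun _ : Fin (n + 3) => μ)| ≤
      (4 * n * κ / μ.real Set.univ + S) * (2 / μ.real Set.univ) ^ 2 *
        ∫ X, pairWeight e X ∂Measure.pi (fun _ : Fin (n + 3) => μ) := by
  set V := μ.real Set.univ with hV
  have hΩ : Nonempty Ω := by
    by_contra hΩ
    rw [not_nonempty_iff] at hΩ
    simp [hV, Set.eq_empty_of_isEmpty] at hμ
  have hU0 := H.U_nonneg hΩ.some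
  push_cast at hU
  have hnU : 0 ≤ n * U := by positivity
  have hκ0 : 0 ≤ κ := (integral_nonneg fun z => sq_nonneg _).trans (hκ hΩ.some)
  have hS0 : 0 ≤ S := (integral_nonneg fun y => integral_nonneg fun z =>
    mul_nonneg (mul_nonneg (abs_nonneg _) (abs_nonneg _))
      (sub_nonneg.2 (H.le_one _ _))).trans (hS hΩ.some)
  set A := 4 * n * κ / V + S with hA
  have hA0 : 0 ≤ A := by positivity
  have hb := H.bddMeas_threeBody (n := n) hF
  have mc : ∀ m : ℕ, Measurable fun p : Ω × (Fin m → Ω) => (Fin.cons p.1 p.2 : Fin (m + 1) → Ω) :=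
    fun m => measurable_pi_lambda _ fun j => by
      refine Fin.cases ?_ (fun k => ?_) j
      · exact measurable_fst
      · exact (measurable_pi_apply k).comp measurable_snd
  have mcx : ∀ (m : ℕ) (x : Ω), Measurable fun X : Fin m → Ω =>
      (Fin.cons x X : Fin (m + 1) → Ω) := fun m x =>
    (mc m).comp (measurable_const.prodMk measurable_id)
  have hexp : ∫ X, threeBody F e X ∂Measure.pi (fun _ : Fin (n + 3) => μ) =
      ∫ x, ∫ y, ∫ z, ∫ X, F x y * F x z * e y z * ((∏ j, e y (X j)) * ∏ j, e z (X j)) *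
        pinnedDensity e x X ∂Measure.pi (fun _ : Fin n => μ) ∂μ ∂μ ∂μ := by
    rw [integral_cons μ hb]
    refine integral_congr_ae (.of_forall fun x => ?_)
    simp only
    rw [integral_cons μ (hb.comp (mcx _ x))]
    refine integral_congr_ae (.of_forall fun y => ?_)
    simp only
    rw [integral_cons μ ((hb.comp (mcx _ x)).comp (mcx _ y))]
    rfl
  have hpt := fun x => H.abs_integral_threeBody_pinned_le hF x
    (H.integral_sq_pinnedField_le hF x hμ hn (by linarith)
      (H.integral_pinnedField_eq_zero hF x (hσ x) (hσe x) (hσx x) (hσF x)) (hκ x)) (hS x)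
  have bI : BddMeas fun x => ∫ y, ∫ z, ∫ X, F x y * F x z * e y z *
      ((∏ j, e y (X j)) * ∏ j, e z (X j)) * pinnedDensity e x X
      ∂Measure.pi (fun _ : Fin n => μ) ∂μ ∂μ := by
    have h1 : BddMeas fun p : ((Ω × Ω) × Ω) × (Fin n → Ω) => threeBody F e
        (Fin.cons p.1.1.1 (Fin.cons p.1.1.2 (Fin.cons p.1.2 p.2)) : Fin (n + 3) → Ω) :=
      hb.comp ((mc _).comp ((measurable_fst.comp (measurable_fst.comp measurable_fst)).prodMk
        ((mc _).comp ((measurable_snd.comp (measurable_fst.comp measurable_fst)).prodMk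
          ((mc _).comp ((measurable_snd.comp measurable_fst).prodMk measurable_snd))))))
    exact ((h1.integral _).integral μ).integral μ
  have bD : BddMeas fun p : Ω × (Fin n → Ω) => pinnedDensity e p.1 p.2 :=
    H.bddMeas_pinnedDensity_comp measurable_fst measurable_snd
  have hZ1 : ∫ x, ∫ X, pinnedDensity e x X ∂Measure.pi (fun _ : Fin n => μ) ∂μ =
      ∫ X, pairWeight e X ∂Measure.pi (fun _ : Fin (n + 1) => μ) := by
    rw [integral_cons μ H.bddMeas_pairWeight]
    simp only [pairWeight_cons]
    rfl
  have hZ2 := H.half_mul_integral_pairWeight_le (n := n + 1) (by push_cast; linarith)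
  have hZ3 := H.half_mul_integral_pairWeight_le (n := n + 2) (by push_cast; linarith)
  calc _ ≤ ∫ x, A * ∫ X, pinnedDensity e x X ∂Measure.pi (fun _ : Fin n => μ) ∂μ := by
        rw [hexp]
        exact abs_integral_le_integral_abs.trans (integral_mono (bI.abs.integrable _)
          (((bD.integral _).const_mul _).integrable _) hpt)
    _ = A * ((2 / V) ^ 2 * (V / 2 * (V / 2 *
          ∫ X, pairWeight e X ∂Measure.pi (fun _ : Fin (n + 1) => μ)))) := by
        rw [integral_const_mul, hZ1]
        field_simp
    _ ≤ A * ((2 / V) ^ 2 * ∫ X, pairWeight e X ∂Measure.pi (fun _ : Fin (n + 3) => μ)) := by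
        gcongr
        exact (mul_le_mul_of_nonneg_left hZ2 (half_pos hμ).le).trans hZ3
    _ = _ := by ring

end IsRepulsive

end ThreeBody

/-! ### Functions on the torus -/

section Torus

/-- Reflection followed by reduction modulo `L` preserves Lebesgue measure on the period. -/
lemma measurePreserving_wrap_const_sub {L : ℝ} (hL : 0 < L) (c : ℝ) :
    MeasurePreserving (fun y : ℝ => (c - y) - L * (round ((c - y) / L) : ℝ))
      (volume.restrict (Set.Icc (-(L / 2)) (L / 2)))
      (volume.restrict (Set.Icc (-(L / 2)) (L / 2))) := by
  set wrap : ℝ → ℝ := fun x => x - L * (round (x / L) : ℝ) with hw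
  have hwm : Measurable wrap := by
    have : Measurable fun x : ℝ => (round (x / L) : ℝ) := by
      simp only [round_eq]
      exact measurable_from_top.comp (Int.measurable_floor.comp
        ((measurable_id.div_const L).add_const (1 / 2)))
    exact measurable_id.sub (this.const_mul L)
  have hper : ∀ (x : ℝ) (m : ℤ), wrap (m * L + x) = wrap x := fun x m => by
    simp only [hw, add_div, mul_div_cancel_right₀ _ hL.ne', round_intCast_add]
    push_cast
    ring
  have hid : ∀ x ∈ Set.Ico (-(L / 2)) (L / 2), wrap x = x := fun x hx => by
    have : round (x / L) = 0 := by
      rw [round_eq_zero_iff]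
      constructor
      · rw [le_div_iff₀ hL]; linarith [hx.1]
      · rw [div_lt_iff₀ hL]; linarith [hx.2]
    simp [hw, this]
  have hm : Measurable fun y : ℝ => wrap (c - y) := hwm.comp (measurable_const.sub measurable_id)
  refine ⟨hm, Measure.ext fun A hA => ?_⟩
  have hA' : MeasurableSet (wrap ⁻¹' A) := hwm hA
  rw [Measure.map_apply hm hA, Measure.restrict_apply (hm hA), Measure.restrict_apply hA]
  have hrefl := (Measure.measurePreserving_sub_left (volume : Measure ℝ) c).measure_preimage
    (s := wrap ⁻¹' A ∩ Set.Icc (c - L / 2) (c + L / 2)) (hA'.inter measurableSet_Icc).nullMeasurableSet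
  have e1 : (fun x => c - x) ⁻¹' (wrap ⁻¹' A ∩ Set.Icc (c - L / 2) (c + L / 2)) =
      (fun y => wrap (c - y)) ⁻¹' A ∩ Set.Icc (-(L / 2)) (L / 2) := by
    ext y
    simp only [Set.mem_preimage, Set.mem_inter_iff, Set.mem_Icc]
    refine and_congr_right fun _ => ⟨fun h => ⟨?_, ?_⟩, fun h => ⟨?_, ?_⟩⟩ <;> linarith [h.1, h.2]
  rw [e1] at hrefl
  have hdom := (isAddFundamentalDomain_Ioc hL (c - L / 2) volume).measure_set_eq
    (isAddFundamentalDomain_Ioc hL (-(L / 2)) volume) hA' (fun g => by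
      obtain ⟨g, m, rfl⟩ := g
      ext x
      have : (⟨m • L, m, rfl⟩ : AddSubgroup.zmultiples L) +ᵥ x = m * L + x := by
        simp [AddSubgroup.vadd_def]
      simp only [Set.mem_preimage]
      exact (congrArg (· ∈ A) ((congrArg wrap this).trans (hper x m))).to_iff)
  rw [show c - L / 2 + L = c + L / 2 by ring, show -(L / 2) + L = L / 2 by ring] at hdom
  rw [hrefl]
  calc volume (wrap ⁻¹' A ∩ Set.Icc (c - L / 2) (c + L / 2))
      = volume (wrap ⁻¹' A ∩ Set.Ioc (c - L / 2) (c + L / 2)) :=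
        measure_congr ((ae_eq_refl _).inter Ioc_ae_eq_Icc.symm)
    _ = volume (wrap ⁻¹' A ∩ Set.Ioc (-(L / 2)) (L / 2)) := hdom
    _ = volume (wrap ⁻¹' A ∩ Set.Ico (-(L / 2)) (L / 2)) :=
        measure_congr ((ae_eq_refl _).inter Ico_ae_eq_Ioc.symm)
    _ = volume (A ∩ Set.Ico (-(L / 2)) (L / 2)) := by
        congr 1
        ext x
        simp only [Set.mem_inter_iff, Set.mem_preimage]
        exact and_congr_left fun hx => by rw [hid x hx]
    _ = volume (A ∩ Set.Icc (-(L / 2)) (L / 2)) :=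
        measure_congr ((ae_eq_refl _).inter Ico_ae_eq_Icc)

/-- Lebesgue measure on the box. -/
noncomputable abbrev boxMeasure (L : ℝ) : Measure Space3 := volume.restrict (torusBox L)

lemma torusBox_eq_preimage (L : ℝ) : torusBox L =
    WithLp.ofLp ⁻¹' (Set.univ.pi fun _ : Fin 3 => Set.Icc (-(L / 2)) (L / 2)) := by
  ext x
  simp only [torusBox, Set.mem_ofPred_eq, Set.mem_preimage, Set.mem_univ_pi]

lemma measurePreserving_ofLp_box (L : ℝ) :
    MeasurePreserving (WithLp.ofLp : Space3 → Fin 3 → ℝ) (boxMeasure L)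
      (Measure.pi fun _ => volume.restrict (Set.Icc (-(L / 2)) (L / 2))) := by
  rw [← Measure.restrict_pi_pi, boxMeasure, torusBox_eq_preimage]
  exact (PiLp.volume_preserving_ofLp (Fin 3)).restrict_preimage
    (MeasurableSet.univ_pi fun _ => measurableSet_Icc)

lemma measurePreserving_toLp_box (L : ℝ) :
    MeasurePreserving (WithLp.toLp 2 : (Fin 3 → ℝ) → Space3)
      (Measure.pi fun _ => volume.restrict (Set.Icc (-(L / 2)) (L / 2))) (boxMeasure L) := by
  have h : (Set.univ.pi fun _ : Fin 3 => Set.Icc (-(L / 2)) (L / 2)) =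
      WithLp.toLp 2 ⁻¹' torusBox L := by
    ext x
    simp only [torusBox, Set.mem_ofPred_eq, Set.mem_preimage, Set.mem_univ_pi]
  rw [← Measure.restrict_pi_pi, h]
  refine (PiLp.volume_preserving_toLp (Fin 3)).restrict_preimage ?_
  rw [torusBox_eq_preimage]
  exact (PiLp.volume_preserving_ofLp (Fin 3)).measurable
    (MeasurableSet.univ_pi fun _ => measurableSet_Icc)

/-- Reflections of the torus preserve the measure. -/
lemma measurePreserving_torusRep_const_sub {L : ℝ} (hL : 0 < L) (c : Space3) :
    MeasurePreserving (fun y => torusRep L (c - y)) (boxMeasure L) (boxMeasure L) :=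
  (measurePreserving_toLp_box L).comp ((measurePreserving_pi _ _ fun k =>
    measurePreserving_wrap_const_sub hL (c k)).comp (measurePreserving_ofLp_box L))

lemma volume_torusBox {L : ℝ} (hL : 0 < L) : (boxMeasure L).real Set.univ = L ^ 3 := by
  have h := (measurePreserving_ofLp_box L).measure_preimage
    (s := Set.univ) MeasurableSet.univ.nullMeasurableSet
  rw [Set.preimage_univ] at h
  rw [measureReal_def, h, Measure.pi_univ]
  simp only [Measure.restrict_apply MeasurableSet.univ, Set.univ_inter, Real.volume_Icc]
  rw [show L / 2 - -(L / 2) = L by ring]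
  simp [ENNReal.toReal_ofReal hL.le]

instance isFiniteMeasure_boxMeasure (L : ℝ) : IsFiniteMeasure (boxMeasure L) := by
  constructor
  have h := (measurePreserving_ofLp_box L).measure_preimage
    (s := Set.univ) MeasurableSet.univ.nullMeasurableSet
  rw [Set.preimage_univ] at h
  rw [h]
  exact measure_lt_top _ _

lemma restrict_configBox (L : ℝ) (N : ℕ) :
    (volume : Measure (Fin N → Space3)).restrict (configBox L N) =
      Measure.pi fun _ => boxMeasure L := by
  rw [configBox, volume_pi, Measure.restrict_pi_pi]

/-- The vector `L m` of the lattice `L ℤ³`. -/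
def latticeVector (L : ℝ) (m : Fin 3 → ℤ) : Space3 := WithLp.toLp 2 fun k => L * (m k : ℝ)

variable {L : ℝ}

lemma torusRep_eq_sub (L : ℝ) (x : Space3) :
    torusRep L x = x - latticeVector L fun k => round (x k / L) := by
  ext k
  simp [torusRep, latticeVector]

lemma torusRep_sub_latticeVector (hL : 0 < L) (x : Space3) (m : Fin 3 → ℤ) :
    torusRep L (x - latticeVector L m) = torusRep L x := by
  ext k
  have : (x k - L * (m k : ℝ)) / L = x k / L - (m k : ℝ) := by field_simp
  simp only [torusRep, latticeVector, PiLp.sub_apply, this, round_sub_intCast]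
  push_cast
  ring

lemma norm_torusRep_le (hL : 0 < L) (x : Space3) (m : Fin 3 → ℤ) :
    ‖torusRep L x‖ ≤ ‖x - latticeVector L m‖ := by
  rw [EuclideanSpace.norm_eq, EuclideanSpace.norm_eq]
  refine Real.sqrt_le_sqrt (Finset.sum_le_sum fun k _ => ?_)
  refine pow_le_pow_left₀ (norm_nonneg _) ?_ 2
  have h := mul_le_mul_of_nonneg_left (round_le (x k / L) (m k)) hL.le
  have e : ∀ t : ℝ, |x k - L * t| = L * |x k / L - t| := fun t => by
    rw [← abs_of_pos hL, ← abs_mul, abs_of_pos hL]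
    congr 1
    field_simp
  simpa only [torusRep, latticeVector, PiLp.sub_apply, Real.norm_eq_abs, e] using h

lemma norm_torusRep_neg (hL : 0 < L) (x : Space3) : ‖torusRep L (-x)‖ = ‖torusRep L x‖ := by
  have key : ∀ x, ‖torusRep L (-x)‖ ≤ ‖torusRep L x‖ := fun x => by
    refine (norm_torusRep_le hL (-x) fun k => -round (x k / L)).trans_eq ?_
    rw [torusRep_eq_sub L x, ← norm_neg]
    congr 1
    ext k
    simp [latticeVector]
    ring
  refine le_antisymm (key x) ?_
  simpa using key (-x)

lemma norm_torusRep_le_add (hL : 0 < L) (x y : Space3) :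
    ‖torusRep L x‖ ≤ ‖x - y‖ + ‖torusRep L y‖ := by
  refine (norm_torusRep_le hL x fun k => round (y k / L)).trans ?_
  rw [torusRep_eq_sub L y]
  refine le_trans (le_of_eq ?_) (norm_add_le _ _)
  congr 1
  abel

lemma torusRep_eq_self (hL : 0 < L) {x : Space3} (hx : ‖x‖ < L / 2) : torusRep L x = x := by
  ext k
  have h1 : |x k| < L / 2 := (PiLp.norm_apply_le x k).trans_lt hx
  have h2 : round (x k / L) = 0 := by
    rw [abs_lt] at h1
    rw [round_eq_zero_iff]
    constructor
    · rw [le_div_iff₀ hL]; linarith [h1.1]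
    · rw [div_lt_iff₀ hL]; linarith [h1.2]
  simp [torusRep, h2]

lemma measurable_torusRep (L : ℝ) : Measurable (torusRep L) := by
  have h : ∀ k : Fin 3, Measurable fun x : Space3 => x k := fun k =>
    (measurable_pi_apply k).comp (PiLp.volume_preserving_ofLp (Fin 3)).measurable
  refine (PiLp.volume_preserving_toLp (Fin 3)).measurable.comp
    (measurable_pi_lambda _ fun k => (h k).sub (Measurable.const_mul ?_ L))
  simp only [round_eq]
  exact measurable_from_top.comp (Int.measurable_floor.comp
    (((h k).div_const L).add_const (1 / 2)))

variable {f : Space3 → ℝ}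

lemma torusExtend_sub_latticeVector (hL : 0 < L) (x : Space3) (m : Fin 3 → ℤ) :
    torusExtend L f (x - latticeVector L m) = torusExtend L f x := by
  rw [torusExtend, torusExtend, torusRep_sub_latticeVector hL]

lemma gradient_torusExtend_sub_latticeVector (hL : 0 < L) (x : Space3) (m : Fin 3 → ℤ) :
    (∇ (torusExtend L f)) (x - latticeVector L m) = (∇ (torusExtend L f)) x := by
  have h : (fun x => torusExtend L f (x - latticeVector L m)) = torusExtend L f :=
    funext fun x => torusExtend_sub_latticeVector hL x m
  rw [gradient, gradient, ← fderiv_comp_sub (latticeVector L m), h]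

lemma torusExtend_neg (hL : 0 < L) (hf : ∀ x y, ‖x‖ = ‖y‖ → f x = f y) (x : Space3) :
    torusExtend L f (-x) = torusExtend L f x := hf _ _ (norm_torusRep_neg hL x)

lemma gradient_torusExtend_neg (hL : 0 < L) (hf : ∀ x y, ‖x‖ = ‖y‖ → f x = f y) (x : Space3) :
    (∇ (torusExtend L f)) (-x) = - (∇ (torusExtend L f)) x := by
  have h : (fun x => torusExtend L f (-x)) = torusExtend L f :=
    funext fun x => torusExtend_neg hL hf x
  have h2 := (ContinuousLinearEquiv.neg ℝ (M := Space3)).comp_right_fderiv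
    (f := torusExtend L f) (x := x)
  have h3 : fderiv ℝ (torusExtend L f) x = -fderiv ℝ (torusExtend L f) (-x) := by
    rw [show torusExtend L f ∘ ContinuousLinearEquiv.neg ℝ (M := Space3) = torusExtend L f from h]
      at h2
    rw [h2]
    ext v
    simp
  rw [gradient, gradient, h3, map_neg, neg_neg]

/-- On the torus the gradient is the one of the representative near the origin. -/
lemma gradient_torusExtend (hL : 0 < L) {x : Space3} (hx : ‖torusRep L x‖ < L / 2) :
    (∇ (torusExtend L f)) x = (∇ f) (torusRep L x) := by
  rw [torusRep_eq_sub] at hx ⊢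
  set v := latticeVector L fun k => round (x k / L) with hv
  have h : torusExtend L f =ᶠ[nhds x] fun y => f (y - v) := by
    have : ∀ᶠ y in nhds x, ‖y - v‖ < L / 2 :=
      (continuous_id.sub continuous_const).norm.continuousAt.eventually_lt_const hx
    filter_upwards [this] with y hy
    rw [← torusExtend_sub_latticeVector hL y fun k => round (x k / L), torusExtend, ← hv,
      torusRep_eq_self hL hy]
  rw [h.gradient_eq, gradient, gradient, fderiv_comp_sub]

lemma gradient_torusExtend_eq_zero (hL : 0 < L) {ℓ : ℝ} (hf : ∀ x, ℓ ≤ ‖x‖ → f x = 1)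
    {x : Space3} (hx : ℓ < ‖torusRep L x‖) : (∇ (torusExtend L f)) x = 0 := by
  have h : torusExtend L f =ᶠ[nhds x] fun _ => 1 := by
    have : ∀ᶠ y in nhds x, ‖x - y‖ + ℓ < ‖torusRep L x‖ :=
      ((continuous_const.sub continuous_id).norm.add continuous_const).continuousAt.eventually_lt_const
        (by simpa using hx)
    filter_upwards [this] with y hy
    exact hf _ (by linarith [norm_torusRep_le_add hL x y])
  rw [h.gradient_eq, gradient_fun_const]

/-- Integrals of functions of the torus distance are bounded by integrals over the whole space. -/
lemma integral_torusRep_le (hL : 0 < L) {φ : Space3 → ℝ} (hφ : Measurable φ) (h0 : ∀ x, 0 ≤ φ x)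
    (hi : Integrable φ) (x : Space3) :
    ∫ y, φ (torusRep L (x - y)) ∂boxMeasure L ≤ ∫ z, φ z := by
  have hm := measurePreserving_torusRep_const_sub hL x
  rw [← integral_map (f := φ) hm.measurable.aemeasurable hφ.aestronglyMeasurable, hm.map_eq]
  exact setIntegral_le_integral hi (.of_forall h0)

end Torus

/-! ### The Laplacian of radial functions and at maxima -/

section Laplacian

open InnerProductSpace Filter Topology

variable {E : Type*} [NormedAddCommGroup E] [InnerProductSpace ℝ E] [FiniteDimensional ℝ E]

lemma hasFDerivAt_norm {x : E} (hx : x ≠ 0) :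
    HasFDerivAt (fun y : E => ‖y‖) (‖x‖⁻¹ • innerSL ℝ x) x := by
  have h1 : ‖x‖ ^ 2 ≠ 0 := pow_ne_zero 2 (norm_ne_zero_iff.2 hx)
  have h2 := (hasStrictFDerivAt_norm_sq x).hasFDerivAt.sqrt h1
  simp only [Real.sqrt_sq (norm_nonneg _)] at h2
  convert h2 using 1
  rw [← Nat.cast_smul_eq_nsmul ℝ, smul_smul]
  congr 1
  field_simp
  norm_num

lemma hasFDerivAt_radial {φ : ℝ → ℝ} {φ' : ℝ} {x : E} (hx : x ≠ 0) (h : HasDerivAt φ φ' ‖x‖) :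
    HasFDerivAt (fun y : E => φ ‖y‖) ((φ' / ‖x‖) • innerSL ℝ x) x := by
  have := h.comp_hasFDerivAt x (hasFDerivAt_norm hx)
  rwa [smul_smul, ← div_eq_mul_inv] at this

/-- The Laplacian of a radial function in three dimensions. -/
lemma laplacian_radial {φ φ' : ℝ → ℝ} {φ'' : ℝ} {x : Space3} (hx : x ≠ 0)
    (h1 : ∀ᶠ r in 𝓝 ‖x‖, HasDerivAt φ (φ' r) r) (h2 : HasDerivAt φ' φ'' ‖x‖) :
    (Δ fun y : Space3 => φ ‖y‖) x = φ'' + 2 * φ' ‖x‖ / ‖x‖ := by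
  have hr : ‖x‖ ≠ 0 := norm_ne_zero_iff.2 hx
  have hfd : fderiv ℝ (fun y : Space3 => φ ‖y‖) =ᶠ[𝓝 x]
      fun y => (φ' ‖y‖ / ‖y‖) • innerSL ℝ y := by
    filter_upwards [continuous_norm.continuousAt.eventually h1,
      isOpen_ne.mem_nhds hx] with y hy hy0
    exact (hasFDerivAt_radial hy0 hy).fderiv
  have hq : HasDerivAt (fun r => φ' r / r) ((φ'' * ‖x‖ - φ' ‖x‖) / ‖x‖ ^ 2) ‖x‖ := by
    have := h2.div (hasDerivAt_id' ‖x‖) hr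
    rwa [mul_one] at this
  have hd : HasFDerivAt (fun y : Space3 => (φ' ‖y‖ / ‖y‖) • innerSL ℝ y) _ x :=
    (hasFDerivAt_radial hx hq).smul (innerSL ℝ (E := Space3)).hasFDerivAt
  rw [laplacian_eq_iteratedFDeriv_orthonormalBasis _ (EuclideanSpace.basisFun (Fin 3) ℝ)]
  simp only [iteratedFDeriv_two_apply, hfd.fderiv_eq]
  rw [HasFDerivAt.fderiv hd]
  simp only [Fin.sum_univ_three, EuclideanSpace.basisFun_apply, Matrix.cons_val_zero,
    Matrix.cons_val_one, add_apply, smul_apply,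
    ContinuousLinearMap.smulRight_apply, innerSL_apply_apply, smul_eq_mul,
    EuclideanSpace.inner_single_right]
  have hn : ‖x‖ ^ 2 = x 0 ^ 2 + x 1 ^ 2 + x 2 ^ 2 := by
    rw [EuclideanSpace.real_norm_sq_eq, Fin.sum_univ_three]
  have hs : ∀ i : Fin 3, innerSL ℝ (EuclideanSpace.single i (1 : ℝ)) (EuclideanSpace.single i 1) =
      1 := fun i => by
    rw [innerSL_apply_apply, real_inner_self_eq_norm_sq]
    simp
  simp only [hs, conj_trivial]
  field_simp
  linear_combination -(‖x‖ * φ'' - φ' ‖x‖) * hn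

/-- At a local maximum the Laplacian is nonpositive. -/
lemma laplacian_nonpos_of_isLocalMax {h : Space3 → ℝ} {x : Space3} (hc : ContDiffAt ℝ 2 h x)
    (hmax : IsLocalMax h x) : (Δ h) x ≤ 0 := by
  rw [laplacian_eq_iteratedFDeriv_orthonormalBasis _ (EuclideanSpace.basisFun (Fin 3) ℝ)]
  refine Finset.sum_nonpos fun i _ => ?_
  set v := EuclideanSpace.basisFun (Fin 3) ℝ i
  simp only [iteratedFDeriv_two_apply, Matrix.cons_val_zero, Matrix.cons_val_one]
  set γ : ℝ → Space3 := fun t => x + t • v with hγ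
  have hγd : ∀ t, HasDerivAt γ v t := fun t => by
    have := ((hasDerivAt_id' t).smul_const v).const_add x
    rwa [one_smul] at this
  have hγ0 : γ 0 = x := by simp [hγ]
  have hγc : Tendsto γ (𝓝 0) (𝓝 x) := by simpa [hγ0] using (hγd 0).continuousAt.tendsto
  have hdiff : ∀ᶠ y in 𝓝 x, DifferentiableAt ℝ h y :=
    (hc.eventually (by simp)).mono fun y hy => hy.differentiableAt (by simp)
  have h1 : deriv (h ∘ γ) =ᶠ[𝓝 0] fun t => fderiv ℝ h (γ t) v := by
    filter_upwards [hγc.eventually hdiff] with t ht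
    exact (ht.hasFDerivAt.comp_hasDerivAt t (hγd t)).deriv
  have h2 : deriv (deriv (h ∘ γ)) 0 = fderiv ℝ (fderiv ℝ h) x v v := by
    rw [h1.deriv_eq]
    have hd : DifferentiableAt ℝ (fderiv ℝ h) (γ 0) := by
      rw [hγ0]
      exact (hc.fderiv_right (m := 1) (by norm_num)).differentiableAt (by simp)
    have := (hd.hasFDerivAt.comp_hasDerivAt 0 (hγd 0)).clm_apply (hasDerivAt_const 0 v)
    simpa [hγ0] using this.deriv
  rw [← h2]
  by_contra! hpos
  have hmax' : IsLocalMax (h ∘ γ) 0 := by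
    have := hγc.eventually hmax
    filter_upwards [this] with t ht
    simpa [hγ0] using ht
  have hcont : ContinuousAt (h ∘ γ) 0 := by
    have : ContinuousAt h (γ 0) := by rw [hγ0]; exact hc.continuousAt
    exact this.comp (hγd 0).continuousAt
  have hmin := isLocalMin_of_deriv_deriv_pos hpos hmax'.deriv_eq_zero hcont
  have hconst : h ∘ γ =ᶠ[𝓝 0] fun _ => (h ∘ γ) 0 := by
    filter_upwards [hmax', hmin] with t h1 h2 using le_antisymm h1 h2
  have hz : deriv (h ∘ γ) =ᶠ[𝓝 0] fun _ => 0 := by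
    simpa using hconst.deriv
  rw [hz.deriv_eq] at hpos
  simp at hpos

end Laplacian

/-! ### Comparison principle for hard-core Neumann eigenfunctions -/

section GroundState

open Filter Topology

/-- The radial solution `sin (k (r - b)) / r` of `-Δ u = k² u`, which vanishes at `r = b`. -/
noncomputable def sineProfile (k b r : ℝ) : ℝ := Real.sin (k * (r - b)) / r

/-- The derivative of `sineProfile`, multiplied by `r²`. -/
noncomputable def sineFlux (k b r : ℝ) : ℝ :=
  k * r * Real.cos (k * (r - b)) - Real.sin (k * (r - b))

variable {k b r a ℓ : ℝ}

lemma hasDerivAt_sineProfile (k b : ℝ) (hr : r ≠ 0) :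
    HasDerivAt (sineProfile k b) (sineFlux k b r / r ^ 2) r := by
  have h := (((hasDerivAt_id' r).sub_const b).const_mul k).sin.div (hasDerivAt_id' r) hr
  refine h.congr_deriv ?_
  rw [sineFlux]
  ring

lemma hasDerivAt_sineFlux (k b r : ℝ) :
    HasDerivAt (sineFlux k b) (-(k ^ 2 * r * Real.sin (k * (r - b)))) r := by
  have h1 := ((hasDerivAt_id' r).sub_const b).const_mul k
  have h := (((hasDerivAt_id' r).const_mul k).mul h1.cos).sub h1.sin
  refine h.congr_deriv ?_
  ring

lemma laplacian_sineProfile (k b : ℝ) {x : Space3} (hx : x ≠ 0) :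
    (Δ fun y : Space3 => sineProfile k b ‖y‖) x = -(k ^ 2) * sineProfile k b ‖x‖ := by
  have hr : ‖x‖ ≠ 0 := norm_ne_zero_iff.2 hx
  have h1 : ∀ᶠ r in 𝓝 ‖x‖, HasDerivAt (sineProfile k b) (sineFlux k b r / r ^ 2) r := by
    filter_upwards [isOpen_ne.mem_nhds hr] with r hr0 using hasDerivAt_sineProfile k b hr0
  have h2 := (hasDerivAt_sineFlux k b ‖x‖).div (hasDerivAt_pow 2 ‖x‖) (pow_ne_zero 2 hr)
  rw [laplacian_radial hx h1 h2, sineProfile]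
  simp only [Nat.cast_ofNat]
  field_simp
  ring

lemma contDiffAt_sineProfile (k b : ℝ) {x : Space3} (hx : x ≠ 0) :
    ContDiffAt ℝ 2 (fun y : Space3 => sineProfile k b ‖y‖) x := by
  have h1 : ContDiffAt ℝ 2 (fun y : Space3 => ‖y‖) x := contDiffAt_norm ℝ hx
  exact (Real.contDiff_sin.contDiffAt.comp x (contDiffAt_const.mul (h1.sub contDiffAt_const))).div
    h1 (norm_ne_zero_iff.2 hx)

/-- Comparison principle on the annulus `a ≤ ‖x‖ ≤ ℓ`: if `-Δ g = μ g` with `μ < k²`, then `g`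
is nonpositive as soon as its quotient by the positive function `sineProfile k b` has no positive
maximum on the boundary. -/
lemma nonpos_of_no_boundary_max (ha : 0 < a)
    (hpos : ∀ r, a ≤ r → r ≤ ℓ → 0 < sineProfile k b r) {μ : ℝ} (hμ : μ < k ^ 2)
    {g : Space3 → ℝ} (hc : ContinuousOn g {x | a ≤ ‖x‖ ∧ ‖x‖ ≤ ℓ})
    (hC2 : ContDiffOn ℝ 2 g {x | a < ‖x‖ ∧ ‖x‖ < ℓ})
    (heig : ∀ x, a < ‖x‖ → ‖x‖ < ℓ → -(Δ g) x = μ * g x) (hga : ∀ x, ‖x‖ = a → g x ≤ 0)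
    (hgl : ∀ x, ‖x‖ = ℓ → 0 < g x → ¬ ∀ y, a ≤ ‖y‖ → ‖y‖ ≤ ℓ →
      g y / sineProfile k b ‖y‖ ≤ g x / sineProfile k b ‖x‖)
    (x : Space3) (hx : a ≤ ‖x‖) (hx' : ‖x‖ ≤ ℓ) : g x ≤ 0 := by
  by_contra! hgx
  set K : Set Space3 := {x | a ≤ ‖x‖ ∧ ‖x‖ ≤ ℓ} with hK
  have hKc : IsCompact K := by
    refine (isCompact_closedBall (0 : Space3) ℓ).of_isClosed_subset ?_ fun y hy => by
      simpa using hy.2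
    exact (isClosed_le continuous_const continuous_norm).inter
      (isClosed_le continuous_norm continuous_const)
  have hne : ∀ y ∈ K, y ≠ 0 := fun y hy => norm_pos_iff.1 (ha.trans_le hy.1)
  have hψc : ContinuousOn (fun y : Space3 => sineProfile k b ‖y‖) K := fun y hy =>
    (contDiffAt_sineProfile k b (hne y hy)).continuousAt.continuousWithinAt
  obtain ⟨x0, hx0, hmax⟩ := hKc.exists_isMaxOn ⟨x, hx, hx'⟩
    (hc.div hψc fun y hy => (hpos _ hy.1 hy.2).ne')
  have hψ0 := hpos _ hx0.1 hx0.2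
  have ht : 0 < g x0 / sineProfile k b ‖x0‖ :=
    (div_pos hgx (hpos _ hx hx')).trans_le (hmax ⟨hx, hx'⟩)
  have hg0 : 0 < g x0 := by
    by_contra! h
    exact absurd (div_nonpos_of_nonpos_of_nonneg h hψ0.le) ht.not_ge
  have ha0 : a < ‖x0‖ := lt_of_le_of_ne hx0.1 fun h => (hga x0 h.symm).not_gt hg0
  have hl0 : ‖x0‖ < ℓ := lt_of_le_of_ne hx0.2 fun h =>
    hgl x0 h hg0 fun y hy hy' => hmax ⟨hy, hy'⟩
  set t := g x0 / sineProfile k b ‖x0‖ with htdef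
  have hgt : g x0 = t * sineProfile k b ‖x0‖ := by rw [htdef, div_mul_cancel₀ _ hψ0.ne']
  have hopen : IsOpen {x : Space3 | a < ‖x‖ ∧ ‖x‖ < ℓ} :=
    (isOpen_lt continuous_const continuous_norm).inter (isOpen_lt continuous_norm continuous_const)
  have hnhds := hopen.mem_nhds (x := x0) ⟨ha0, hl0⟩
  have hgC : ContDiffAt ℝ 2 g x0 := hC2.contDiffAt hnhds
  have hψC := contDiffAt_sineProfile k b (hne x0 hx0)
  have hloc : IsLocalMax (g - t • fun y : Space3 => sineProfile k b ‖y‖) x0 := by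
    filter_upwards [hnhds] with y hy
    have h1 := hmax (show y ∈ K from ⟨hy.1.le, hy.2.le⟩)
    have h2 := hpos _ hy.1.le hy.2.le
    have h3 : g y ≤ t * sineProfile k b ‖y‖ := (div_le_iff₀ h2).1 h1
    simp only [Pi.sub_apply, Pi.smul_apply, smul_eq_mul]
    linarith
  have hsC : ContDiffAt ℝ 2 (t • fun y : Space3 => sineProfile k b ‖y‖) x0 :=
    contDiffAt_const.smul hψC
  have h1 := laplacian_nonpos_of_isLocalMax (h := g - t • fun y : Space3 => sineProfile k b ‖y‖)
    (hgC.sub hsC) hloc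
  rw [ContDiffAt.laplacian_sub hgC hsC,
    InnerProductSpace.laplacian_smul t hψC, laplacian_sineProfile k b (hne x0 hx0)] at h1
  have h2 := heig x0 ha0 hl0
  rw [smul_eq_mul, show t * (-(k ^ 2) * sineProfile k b ‖x0‖) =
    -(k ^ 2) * (t * sineProfile k b ‖x0‖) by ring, ← hgt] at h1
  nlinarith

/-- Eigenfunctions vanish on the sphere of radius `a`, by continuity. -/
lemma IsHardCoreNeumannEigenfunction.eq_zero {lam : ℝ} {g : Space3 → ℝ}
    (hg : IsHardCoreNeumannEigenfunction a ℓ lam g) (ha : 0 < a) (haℓ : a < ℓ) {x : Space3}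
    (hx : ‖x‖ ≤ a) : g x = 0 := by
  rcases hx.lt_or_eq with h | h
  · exact hg.hardCore x h (hx.trans haℓ.le)
  have h1 : Tendsto (fun t : ℝ => t • x) (𝓝[<] 1) (𝓝 x) := by
    have : Tendsto (fun t : ℝ => t • x) (𝓝 1) (𝓝 ((1 : ℝ) • x)) :=
      (continuous_id.smul continuous_const).continuousAt
    rw [one_smul] at this
    exact this.mono_left nhdsWithin_le_nhds
  have hlt : ∀ᶠ t : ℝ in 𝓝[<] 1, ‖t • x‖ < a := by
    have h0 : Set.Ioo (0 : ℝ) 1 ∈ 𝓝[<] (1 : ℝ) := Ioo_mem_nhdsLT one_pos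
    filter_upwards [h0] with t ht
    rw [norm_smul, Real.norm_eq_abs, abs_of_pos ht.1, h]
    nlinarith [ht.2]
  have hmem : x ∈ Metric.closedBall (0 : Space3) ℓ := by simpa using hx.trans haℓ.le
  have h2 : Tendsto (fun t : ℝ => g (t • x)) (𝓝[<] 1) (𝓝 (g x)) := by
    refine (hg.continuousOn x hmem).tendsto.comp (tendsto_nhdsWithin_iff.2 ⟨h1, ?_⟩)
    filter_upwards [hlt] with t ht
    simpa using (ht.trans haℓ).le
  refine tendsto_nhds_unique h2 (tendsto_const_nhds.congr' ?_)
  filter_upwards [hlt] with t ht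
  exact (hg.hardCore _ ht (ht.trans haℓ).le).symm

lemma IsHardCoreNeumannEigenfunction.neg {lam : ℝ} {g : Space3 → ℝ}
    (hg : IsHardCoreNeumannEigenfunction a ℓ lam g) :
    IsHardCoreNeumannEigenfunction a ℓ lam (-g) where
  continuousOn := hg.continuousOn.neg
  contDiffOn := hg.contDiffOn.neg
  eigen x h h' := by
    rw [InnerProductSpace.laplacian_neg, Pi.neg_apply, Pi.neg_apply, hg.eigen x h h']
    ring
  hardCore x h h' := by simp [hg.hardCore x h h']
  neumann x h := by
    have := (hg.neumann x h).neg
    rw [neg_zero] at this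
    exact this
  nontrivial := by
    obtain ⟨x, hx, hx'⟩ := hg.nontrivial
    exact ⟨x, hx, by simpa using hx'⟩

lemma IsHardCoreNeumannEigenfunction.continuousOn_annulus {lam : ℝ} {g : Space3 → ℝ}
    (hg : IsHardCoreNeumannEigenfunction a ℓ lam g) :
    ContinuousOn g {x | a ≤ ‖x‖ ∧ ‖x‖ ≤ ℓ} :=
  hg.continuousOn.mono fun x hx => by simpa using hx.2

/-- The quotient of a Neumann eigenfunction by a function with positive outward derivative has no
positive maximum on the outer sphere. -/
lemma IsHardCoreNeumannEigenfunction.not_max {lam : ℝ} {g : Space3 → ℝ}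
    (hg : IsHardCoreNeumannEigenfunction a ℓ lam g) (ha : 0 < a) (haℓ : a < ℓ)
    (hpos : ∀ r, a ≤ r → r ≤ ℓ → 0 < sineProfile k b r) (hflux : 0 < sineFlux k b ℓ)
    {x : Space3} (hx : ‖x‖ = ℓ) (hgx : 0 < g x) :
    ¬ ∀ y, a ≤ ‖y‖ → ‖y‖ ≤ ℓ → g y / sineProfile k b ‖y‖ ≤ g x / sineProfile k b ‖x‖ := by
  intro hmax
  have hℓ : 0 < ℓ := ha.trans haℓ
  have hψ := hpos ℓ haℓ.le le_rfl
  rw [hx] at hmax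
  set t := g x / sineProfile k b ℓ with ht
  have ht0 : 0 < t := div_pos hgx hψ
  have hd : HasDerivWithinAt (fun s : ℝ => t * sineProfile k b (s * ℓ) - g (s • x))
      (t * (sineFlux k b ℓ / ℓ ^ 2 * ℓ) - 0) (Set.Iic 1) 1 := by
    have h1 : HasDerivAt (fun s : ℝ => sineProfile k b (s * ℓ))
        (sineFlux k b ℓ / ℓ ^ 2 * ℓ) 1 := by
      have h2 : HasDerivAt (sineProfile k b) (sineFlux k b ℓ / ℓ ^ 2) (1 * ℓ) := by
        rw [one_mul]; exact hasDerivAt_sineProfile k b hℓ.ne'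
      have h3 := (hasDerivAt_id' (1 : ℝ)).mul_const ℓ
      rw [one_mul] at h3
      exact h2.comp (1 : ℝ) h3
    exact (h1.const_mul t).hasDerivWithinAt.sub (hg.neumann x hx)
  rw [hasDerivWithinAt_iff_tendsto_slope] at hd
  have hset : Set.Iic (1 : ℝ) \ {1} = Set.Iio 1 := by
    ext s; simp [lt_iff_le_and_ne]
  rw [hset] at hd
  have hle : t * (sineFlux k b ℓ / ℓ ^ 2 * ℓ) - 0 ≤ 0 := by
    refine le_of_tendsto hd ?_
    have h0 : Set.Ioo (a / ℓ) 1 ∈ 𝓝[<] (1 : ℝ) := Ioo_mem_nhdsLT ((div_lt_one hℓ).2 haℓ)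
    filter_upwards [h0] with s hs
    have hs0 : 0 < s := (div_pos ha hℓ).trans hs.1
    have hns : ‖s • x‖ = s * ℓ := by rw [norm_smul, Real.norm_eq_abs, abs_of_pos hs0, hx]
    have h1 : a ≤ s * ℓ := ((div_lt_iff₀ hℓ).1 hs.1).le
    have h2 : s * ℓ ≤ ℓ := by nlinarith [hs.2]
    have h3 := hmax (s • x) (by rwa [hns]) (by rwa [hns])
    rw [hns, div_le_iff₀ (hpos _ h1 h2)] at h3
    rw [slope_def_field, one_mul, one_smul]
    refine div_nonpos_of_nonneg_of_nonpos ?_ (by linarith [hs.2])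
    have : t * sineProfile k b ℓ = g x := by rw [ht, div_mul_cancel₀ _ hψ.ne']
    linarith
  have : 0 < t * (sineFlux k b ℓ / ℓ ^ 2 * ℓ) - 0 := by
    rw [sub_zero]; positivity
  linarith

/-- A positive supersolution with positive outward derivative excludes small eigenvalues. -/
lemma IsHardCoreNeumannEigenfunction.sq_le {lam : ℝ} {g : Space3 → ℝ}
    (hg : IsHardCoreNeumannEigenfunction a ℓ lam g) (ha : 0 < a) (haℓ : a < ℓ)
    (hpos : ∀ r, a ≤ r → r ≤ ℓ → 0 < sineProfile k b r) (hflux : 0 < sineFlux k b ℓ) :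
    k ^ 2 ≤ lam := by
  by_contra! hlt
  have key : ∀ {g : Space3 → ℝ}, IsHardCoreNeumannEigenfunction a ℓ lam g →
      ∀ x, a ≤ ‖x‖ → ‖x‖ ≤ ℓ → g x ≤ 0 := fun hg =>
    nonpos_of_no_boundary_max ha hpos hlt hg.continuousOn_annulus hg.contDiffOn hg.eigen
      (fun x hx => (hg.eq_zero ha haℓ hx.le).le)
      (fun x hx hgx => hg.not_max ha haℓ hpos hflux hx hgx)
  obtain ⟨x, hx, hgx⟩ := hg.nontrivial
  have hxa : a ≤ ‖x‖ := by
    by_contra! h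
    exact hgx (hg.eq_zero ha haℓ h.le)
  refine hgx (le_antisymm (key hg x hxa hx) ?_)
  simpa using key hg.neg x hxa hx

/-- Eigenfunctions are determined by their eigenvalue and their boundary values as soon as there is
a positive strict supersolution. -/
lemma IsHardCoreNeumannEigenfunction.eq_of_boundary {lam : ℝ} {g h : Space3 → ℝ}
    (hg : IsHardCoreNeumannEigenfunction a ℓ lam g)
    (hh : IsHardCoreNeumannEigenfunction a ℓ lam h) (ha : 0 < a) (haℓ : a < ℓ)
    (hpos : ∀ r, a ≤ r → r ≤ ℓ → 0 < sineProfile k b r) (hlam : lam < k ^ 2)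
    (hb : ∀ x, ‖x‖ = ℓ → g x = h x) (x : Space3) (hx : ‖x‖ ≤ ℓ) : g x = h x := by
  have hopen : IsOpen {x : Space3 | a < ‖x‖ ∧ ‖x‖ < ℓ} :=
    (isOpen_lt continuous_const continuous_norm).inter (isOpen_lt continuous_norm continuous_const)
  have key : ∀ {g h : Space3 → ℝ}, IsHardCoreNeumannEigenfunction a ℓ lam g →
      IsHardCoreNeumannEigenfunction a ℓ lam h → (∀ x, ‖x‖ = ℓ → g x = h x) →
      ∀ x, a ≤ ‖x‖ → ‖x‖ ≤ ℓ → (g - h) x ≤ 0 := fun {g h} hg hh hb =>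
    nonpos_of_no_boundary_max ha hpos hlam (hg.continuousOn_annulus.sub hh.continuousOn_annulus)
      (hg.contDiffOn.sub hh.contDiffOn)
      (fun x hx hx' => by
        have hn := hopen.mem_nhds (x := x) ⟨hx, hx'⟩
        rw [ContDiffAt.laplacian_sub (hg.contDiffOn.contDiffAt hn) (hh.contDiffOn.contDiffAt hn),
          Pi.sub_apply]
        linarith [hg.eigen x hx hx', hh.eigen x hx hx'])
      (fun x hx => by simp [hg.eq_zero ha haℓ hx.le, hh.eq_zero ha haℓ hx.le])
      (fun x hx hgx => by simp [hb x hx] at hgx)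
  rcases le_total ‖x‖ a with h1 | h1
  · rw [hg.eq_zero ha haℓ h1, hh.eq_zero ha haℓ h1]
  · have h2 := key hg hh hb x h1 hx
    have h3 := key hh hg (fun x hx => (hb x hx).symm) x h1 hx
    simp only [Pi.sub_apply] at h2 h3
    linarith

end GroundState

/-! ### The ground state -/

section Profile

open Filter Topology

variable {k a ℓ r : ℝ}

/-- The Neumann condition at `ℓ`, `tan (k (ℓ - a)) = k ℓ`, has a solution below the pole. -/
lemma exists_sineFlux_eq_zero (ha : 0 < a) (haℓ : a < ℓ) :
    ∃ k : ℝ, 0 < k ∧ k * (ℓ - a) < Real.pi / 2 ∧ sineFlux k a ℓ = 0 := by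
  set s := ℓ - a with hs
  have hs0 : 0 < s := sub_pos.2 haℓ
  have hℓ : 0 < ℓ := ha.trans haℓ
  set k1 := √(a / ℓ) / s with hk1
  have hq : 0 < a / ℓ := div_pos ha hℓ
  have hk1s : k1 * s = √(a / ℓ) := div_mul_cancel₀ _ hs0.ne'
  have hk10 : 0 < k1 := div_pos (Real.sqrt_pos.2 hq) hs0
  have hlt1 : k1 * s < 1 := by
    rw [hk1s, Real.sqrt_lt' one_pos, one_pow]
    exact (div_lt_one hℓ).2 haℓ
  have hsq : (k1 * s) ^ 2 * ℓ = a := by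
    rw [hk1s, Real.sq_sqrt hq.le, div_mul_cancel₀ _ hℓ.ne']
  have h1 : 0 < sineFlux k1 a ℓ := by
    have hc := Real.one_sub_sq_div_two_le_cos (x := k1 * s)
    have hsin := Real.sin_le (mul_pos hk10 hs0).le
    rw [sineFlux, ← hs]
    have : k1 * ℓ * (1 - (k1 * s) ^ 2 / 2) ≤ k1 * ℓ * Real.cos (k1 * s) :=
      mul_le_mul_of_nonneg_left hc (by positivity)
    have e : k1 * ℓ * (1 - (k1 * s) ^ 2 / 2) = k1 * ℓ - k1 * a / 2 := by
      linear_combination (-(k1 / 2)) * hsq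
    have : k1 * s = k1 * ℓ - k1 * a := by rw [hs]; ring
    nlinarith [mul_pos hk10 ha]
  set k2 := Real.pi / 2 / s with hk2
  have hk2s : k2 * s = Real.pi / 2 := div_mul_cancel₀ _ hs0.ne'
  have h2 : sineFlux k2 a ℓ = -1 := by
    rw [sineFlux, ← hs, hk2s]
    simp
  have h12 : k1 ≤ k2 := by
    refine le_of_mul_le_mul_right ?_ hs0
    rw [hk2s]
    linarith [Real.pi_gt_three]
  have hcont : ContinuousOn (fun k => sineFlux k a ℓ) (Set.Icc k1 k2) := by
    unfold sineFlux
    fun_prop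
  obtain ⟨k, hk, hk0⟩ := intermediate_value_Icc' h12 hcont
    (show (0 : ℝ) ∈ Set.Icc _ _ from ⟨by rw [h2]; norm_num, h1.le⟩)
  refine ⟨k, hk10.trans_le hk.1, ?_, hk0⟩
  rw [← hk2s]
  refine mul_lt_mul_of_pos_right (lt_of_le_of_ne hk.2 fun h => ?_) hs0
  simp only [h, h2] at hk0
  norm_num at hk0

/-- Below the first zero in `k` the flux through the outer sphere is positive, since it is strictly
concave in `k` and vanishes at `k = 0`. -/
lemma sineFlux_pos (haℓ : a < ℓ) (ha : 0 < a) (hθ : k * (ℓ - a) < Real.pi / 2)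
    (hk0 : sineFlux k a ℓ = 0) {k' : ℝ} (hk' : 0 < k') (hkk : k' < k) :
    0 < sineFlux k' a ℓ := by
  set s := ℓ - a with hs
  have hs0 : 0 < s := sub_pos.2 haℓ
  have hk : 0 < k := hk'.trans hkk
  set G : ℝ → ℝ := fun k => sineFlux k a ℓ with hG
  have hd1 : ∀ x, HasDerivAt G (ℓ * Real.cos (x * s) - x * ℓ * s * Real.sin (x * s) -
      s * Real.cos (x * s)) x := fun x => by
    have h1 := (hasDerivAt_id' x).mul_const s
    have h := (((hasDerivAt_id' x).mul_const ℓ).mul h1.cos).sub h1.sin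
    refine h.congr_deriv ?_
    ring
  have hd2 : ∀ x, HasDerivAt (fun x => ℓ * Real.cos (x * s) - x * ℓ * s * Real.sin (x * s) -
      s * Real.cos (x * s)) (-(s * (2 * ℓ - s)) * Real.sin (x * s) -
        x * ℓ * s ^ 2 * Real.cos (x * s)) x := fun x => by
    have h1 := (hasDerivAt_id' x).mul_const s
    have h := ((h1.cos.const_mul ℓ).sub
      ((((hasDerivAt_id' x).mul_const ℓ).mul_const s).mul h1.sin)).sub (h1.cos.const_mul s)
    refine h.congr_deriv ?_
    ring
  have hconc : StrictConcaveOn ℝ (Set.Icc 0 k) G := by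
    refine strictConcaveOn_of_deriv2_neg (convex_Icc 0 k)
      (fun x _ => (hd1 x).continuousAt.continuousWithinAt) fun x hx => ?_
    rw [interior_Icc] at hx
    have : deriv G = _ := funext fun x => (hd1 x).deriv
    rw [iterate_succ_apply, iterate_one, this, (hd2 x).deriv]
    have hxs : 0 < x * s := mul_pos hx.1 hs0
    have hxs' : x * s < Real.pi / 2 := (mul_lt_mul_of_pos_right hx.2 hs0).trans hθ
    have h1 := Real.sin_pos_of_pos_of_lt_pi hxs (by linarith)
    have h2 := Real.cos_pos_of_mem_Ioo ⟨by linarith, hxs'⟩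
    have h3 : 0 < s * (2 * ℓ - s) := mul_pos hs0 (by rw [hs]; linarith)
    have h4 : 0 < x * ℓ * s ^ 2 * Real.cos (x * s) := by
      have := ha.trans haℓ
      have := hx.1
      positivity
    nlinarith [mul_pos h3 h1]
  have h := hconc.2 (Set.left_mem_Icc.2 hk.le) (Set.right_mem_Icc.2 hk.le) hk.ne
    (show 0 < 1 - k' / k from sub_pos.2 ((div_lt_one hk).2 hkk)) (div_pos hk' hk)
    (by ring)
  have hG0 : G 0 = 0 := by simp [hG, sineFlux]
  rw [hG0, show G k = 0 from hk0] at h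
  simpa [div_mul_cancel₀ _ hk.ne'] using h

/-- The radial profile of the ground state. The radius is clamped to `[a, ℓ]`, so that the profile
vanishes in the core and is `1` beyond `ℓ`. -/
noncomputable def hardCoreProfile (k a ℓ r : ℝ) : ℝ :=
  ℓ / Real.sin (k * (ℓ - a)) * sineProfile k a (max a (min r ℓ))

/-- The data of the ground state: `k` solves the Neumann condition below the pole. -/
structure IsWavenumber (a ℓ k : ℝ) : Prop where
  a_pos : 0 < a
  a_lt : a < ℓ
  k_pos : 0 < k
  lt_pi : k * (ℓ - a) < Real.pi / 2
  flux : sineFlux k a ℓ = 0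

namespace IsWavenumber

lemma l_pos (H : IsWavenumber a ℓ k) : 0 < ℓ := H.a_pos.trans H.a_lt

lemma angle_pos (H : IsWavenumber a ℓ k) : 0 < k * (ℓ - a) :=
  mul_pos H.k_pos (sub_pos.2 H.a_lt)

lemma sin_pos (H : IsWavenumber a ℓ k) : 0 < Real.sin (k * (ℓ - a)) :=
  Real.sin_pos_of_pos_of_lt_pi H.angle_pos (by linarith [H.lt_pi, Real.pi_pos])

lemma amplitude_pos (H : IsWavenumber a ℓ k) : 0 < ℓ / Real.sin (k * (ℓ - a)) :=
  div_pos H.l_pos H.sin_pos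

lemma profile_eq (_ : IsWavenumber a ℓ k) (h : a ≤ r) (h' : r ≤ ℓ) :
    hardCoreProfile k a ℓ r = ℓ / Real.sin (k * (ℓ - a)) * sineProfile k a r := by
  rw [hardCoreProfile, min_eq_left h', max_eq_right h]

lemma profile_of_le (H : IsWavenumber a ℓ k) (h : r ≤ a) : hardCoreProfile k a ℓ r = 0 := by
  rw [hardCoreProfile, min_eq_left (h.trans H.a_lt.le), max_eq_left h]
  simp [sineProfile]

lemma profile_of_ge (H : IsWavenumber a ℓ k) (h : ℓ ≤ r) : hardCoreProfile k a ℓ r = 1 := by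
  rw [hardCoreProfile, min_eq_right h, max_eq_right H.a_lt.le, sineProfile]
  have := H.sin_pos.ne'
  have := H.l_pos.ne'
  field_simp

lemma continuous_profile (H : IsWavenumber a ℓ k) : Continuous (hardCoreProfile k a ℓ) := by
  unfold hardCoreProfile sineProfile
  refine continuous_const.mul (Continuous.div (by fun_prop) (by fun_prop) fun r => ?_)
  exact (H.a_pos.trans_le (le_max_left _ _)).ne'

lemma antitoneOn_sineFlux (H : IsWavenumber a ℓ k) :
    AntitoneOn (sineFlux k a) (Set.Icc a ℓ) := by
  refine antitoneOn_of_deriv_nonpos (convex_Icc a ℓ)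
    (fun x _ => (hasDerivAt_sineFlux k a x).continuousAt.continuousWithinAt)
    (fun x _ => (hasDerivAt_sineFlux k a x).differentiableAt.differentiableWithinAt) fun x hx => ?_
  rw [interior_Icc] at hx
  rw [(hasDerivAt_sineFlux k a x).deriv, neg_nonpos]
  have h1 : 0 < k * (x - a) := mul_pos H.k_pos (sub_pos.2 hx.1)
  have h2 : k * (x - a) ≤ k * (ℓ - a) :=
    mul_le_mul_of_nonneg_left (sub_le_sub_right hx.2.le a) H.k_pos.le
  have h3 := Real.sin_pos_of_pos_of_lt_pi h1 (by linarith [H.lt_pi, Real.pi_pos])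
  have := H.a_pos.trans hx.1
  positivity

lemma sineFlux_nonneg (H : IsWavenumber a ℓ k) (h : a ≤ r) (h' : r ≤ ℓ) :
    0 ≤ sineFlux k a r := by
  rw [← H.flux]
  exact H.antitoneOn_sineFlux ⟨h, h'⟩ (Set.right_mem_Icc.2 H.a_lt.le) h'

lemma sineFlux_le (H : IsWavenumber a ℓ k) (h : a ≤ r) (h' : r ≤ ℓ) :
    sineFlux k a r ≤ k * a := by
  have := H.antitoneOn_sineFlux (Set.left_mem_Icc.2 H.a_lt.le) ⟨h, h'⟩ h
  refine this.trans_eq ?_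
  simp [sineFlux]

lemma monotoneOn_sineProfile (H : IsWavenumber a ℓ k) :
    MonotoneOn (sineProfile k a) (Set.Icc a ℓ) := by
  have hd : ∀ x ∈ Set.Icc a ℓ, HasDerivAt (sineProfile k a) (sineFlux k a x / x ^ 2) x :=
    fun x hx => hasDerivAt_sineProfile k a (H.a_pos.trans_le hx.1).ne'
  refine monotoneOn_of_deriv_nonneg (convex_Icc a ℓ)
    (fun x hx => (hd x hx).continuousAt.continuousWithinAt)
    (fun x hx => (hd x (interior_subset hx)).differentiableAt.differentiableWithinAt) fun x hx => ?_
  have hx' := interior_subset hx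
  rw [(hd x hx').deriv]
  exact div_nonneg (H.sineFlux_nonneg hx'.1 hx'.2) (sq_nonneg x)

lemma profile_nonneg (H : IsWavenumber a ℓ k) (r : ℝ) : 0 ≤ hardCoreProfile k a ℓ r := by
  have hm : max a (min r ℓ) ∈ Set.Icc a ℓ :=
    ⟨le_max_left _ _, max_le H.a_lt.le (min_le_right _ _)⟩
  refine mul_nonneg H.amplitude_pos.le ?_
  refine le_trans (le_of_eq ?_) (H.monotoneOn_sineProfile (Set.left_mem_Icc.2 H.a_lt.le) hm hm.1)
  simp [sineProfile]

lemma profile_le_one (H : IsWavenumber a ℓ k) (r : ℝ) : hardCoreProfile k a ℓ r ≤ 1 := by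
  have hm : max a (min r ℓ) ∈ Set.Icc a ℓ :=
    ⟨le_max_left _ _, max_le H.a_lt.le (min_le_right _ _)⟩
  rw [← H.profile_of_ge le_rfl, H.profile_eq H.a_lt.le le_rfl]
  exact mul_le_mul_of_nonneg_left (H.monotoneOn_sineProfile hm (Set.right_mem_Icc.2 H.a_lt.le) hm.2)
    H.amplitude_pos.le

/-- By concavity of `r ↦ r f(r)` the profile is at least the zero-energy scattering solution
`1 - a / r`. -/
lemma one_sub_profile_le (H : IsWavenumber a ℓ k) (hr : 0 < r) :
    1 - hardCoreProfile k a ℓ r ≤ a / r := by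
  rcases le_total r a with h | h
  · have : 1 ≤ a / r := (one_le_div hr).2 h
    linarith [H.profile_nonneg r]
  rcases le_total ℓ r with h' | h'
  · rw [H.profile_of_ge h', sub_self]
    exact (div_pos H.a_pos hr).le
  rw [H.profile_eq h h', sineProfile, sub_le_iff_le_add]
  have hs : 0 < ℓ - a := sub_pos.2 H.a_lt
  have ht1 : (r - a) / (ℓ - a) ≤ 1 := (div_le_one hs).2 (by linarith)
  have ht0 : 0 ≤ (r - a) / (ℓ - a) := div_nonneg (sub_nonneg.2 h) hs.le
  have hc := strictConcaveOn_sin_Icc.concaveOn.2 (x := 0) (y := k * (ℓ - a))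
    ⟨le_rfl, Real.pi_pos.le⟩ ⟨H.angle_pos.le, by linarith [H.lt_pi, Real.pi_pos]⟩
    (sub_nonneg.2 ht1) ht0 (by ring)
  have e : (r - a) / (ℓ - a) * (k * (ℓ - a)) = k * (r - a) := by field_simp
  simp only [smul_eq_mul, mul_zero, Real.sin_zero, zero_add, e] at hc
  have h1 : ℓ * ((r - a) / (ℓ - a)) ≤
      ℓ / Real.sin (k * (ℓ - a)) * Real.sin (k * (r - a)) := by
    calc ℓ * ((r - a) / (ℓ - a)) = ℓ / Real.sin (k * (ℓ - a)) *
          ((r - a) / (ℓ - a) * Real.sin (k * (ℓ - a))) := by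
          rw [mul_comm ((r - a) / (ℓ - a)) (Real.sin _), ← mul_assoc,
            div_mul_cancel₀ _ H.sin_pos.ne']
      _ ≤ _ := mul_le_mul_of_nonneg_left hc H.amplitude_pos.le
  have h2 : r - a ≤ ℓ * ((r - a) / (ℓ - a)) := by
    rw [mul_div_assoc', le_div_iff₀ hs]
    nlinarith [H.a_pos, sub_nonneg.2 h]
  rw [mul_div_assoc', ← add_div, le_div_iff₀ hr]
  linarith

/-- For `2 a ≤ ℓ` the angle `k (ℓ - a)` stays away from `π / 2`. -/
lemma amplitude_mul_le (H : IsWavenumber a ℓ k) (h2 : 2 * a ≤ ℓ) :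
    ℓ / Real.sin (k * (ℓ - a)) * k ≤ 4 := by
  set θ := k * (ℓ - a) with hθ
  have hc : 0 < Real.cos θ :=
    Real.cos_pos_of_mem_Ioo ⟨by linarith [H.angle_pos, Real.pi_pos], H.lt_pi⟩
  have hfl : k * ℓ * Real.cos θ = Real.sin θ := sub_eq_zero.1 H.flux
  have hkl0 : 0 < k * ℓ := mul_pos H.k_pos H.l_pos
  have hkl : k * ℓ ≤ Real.pi := by
    have : k * ℓ ≤ 2 * θ := by rw [hθ]; nlinarith [H.k_pos]
    linarith [H.lt_pi]
  have hpi := Real.pi_lt_d2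
  have hsq := Real.sin_sq_add_cos_sq θ
  rw [← hfl] at hsq
  have h4 : 1 / 4 ≤ Real.cos θ := by
    by_contra! hlt
    have h5 : (k * ℓ) ^ 2 ≤ 3.15 ^ 2 := pow_le_pow_left₀ hkl0.le (by linarith) 2
    have h6 : Real.cos θ ^ 2 < (1 / 4) ^ 2 := pow_lt_pow_left₀ hlt hc.le two_ne_zero
    nlinarith [sq_nonneg (Real.cos θ)]
  rw [div_mul_eq_mul_div, div_le_iff₀ H.sin_pos, ← hfl]
  nlinarith

lemma profile_eventuallyEq (H : IsWavenumber a ℓ k) {x : Space3} (h : a < ‖x‖) (h' : ‖x‖ < ℓ) :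
    (fun y : Space3 => hardCoreProfile k a ℓ ‖y‖) =ᶠ[𝓝 x]
      (ℓ / Real.sin (k * (ℓ - a))) • fun y : Space3 => sineProfile k a ‖y‖ := by
  have hopen : IsOpen {x : Space3 | a < ‖x‖ ∧ ‖x‖ < ℓ} :=
    (isOpen_lt continuous_const continuous_norm).inter (isOpen_lt continuous_norm continuous_const)
  filter_upwards [hopen.mem_nhds (x := x) ⟨h, h'⟩] with y hy
  rw [H.profile_eq hy.1.le hy.2.le]
  rfl

/-- On the sphere of radius `ℓ` the function has a maximum and its gradient vanishes. -/
lemma norm_gradient_le (H : IsWavenumber a ℓ k) (h2 : 2 * a ≤ ℓ) {x : Space3} (hx : a < ‖x‖) :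
    ‖(∇ fun y : Space3 => hardCoreProfile k a ℓ ‖y‖) x‖ ≤ 4 * a / ‖x‖ ^ 2 := by
  have hx0 : 0 < ‖x‖ := H.a_pos.trans hx
  rw [gradient, LinearIsometryEquiv.norm_map]
  rcases lt_or_ge ‖x‖ ℓ with h | h
  · rw [(H.profile_eventuallyEq hx h).fderiv_eq]
    have hd := (hasFDerivAt_radial (norm_pos_iff.1 hx0)
      (hasDerivAt_sineProfile k a hx0.ne')).const_smul (ℓ / Real.sin (k * (ℓ - a)))
    rw [hd.fderiv, norm_smul, norm_smul, innerSL_apply_norm, Real.norm_eq_abs, Real.norm_eq_abs,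
      abs_of_pos H.amplitude_pos, abs_of_nonneg (div_nonneg (div_nonneg
        (H.sineFlux_nonneg hx.le h.le) (sq_nonneg _)) hx0.le), div_mul_cancel₀ _ hx0.ne',
      mul_div_assoc', div_le_div_iff_of_pos_right (by positivity)]
    calc _ ≤ ℓ / Real.sin (k * (ℓ - a)) * (k * a) :=
          mul_le_mul_of_nonneg_left (H.sineFlux_le hx.le h.le) H.amplitude_pos.le
      _ = ℓ / Real.sin (k * (ℓ - a)) * k * a := by ring
      _ ≤ 4 * a := mul_le_mul_of_nonneg_right (H.amplitude_mul_le h2) H.a_pos.le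
  · have hmax : IsLocalMax (fun y : Space3 => hardCoreProfile k a ℓ ‖y‖) x :=
      .of_forall fun y => (H.profile_le_one _).trans_eq (H.profile_of_ge h).symm
    rw [hmax.fderiv_eq_zero, norm_zero]
    exact div_nonneg (by linarith [H.a_pos]) (sq_nonneg _)

lemma isEigenfunction (H : IsWavenumber a ℓ k) : IsHardCoreNeumannEigenfunction a ℓ (k ^ 2)
    fun x => hardCoreProfile k a ℓ ‖x‖ where
  continuousOn := (H.continuous_profile.comp continuous_norm).continuousOn
  contDiffOn x hx := by
    have hx0 : x ≠ 0 := norm_pos_iff.1 (H.a_pos.trans hx.1)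
    have hs : ContDiffAt ℝ 2 ((ℓ / Real.sin (k * (ℓ - a))) •
        fun y : Space3 => sineProfile k a ‖y‖) x :=
      contDiffAt_const.smul (contDiffAt_sineProfile k a hx0)
    exact (hs.congr_of_eventuallyEq (H.profile_eventuallyEq hx.1 hx.2)).contDiffWithinAt
  eigen x h h' := by
    have hx0 : x ≠ 0 := norm_pos_iff.1 (H.a_pos.trans h)
    rw [InnerProductSpace.laplacian_congr_nhds (H.profile_eventuallyEq h h') |>.eq_of_nhds,
      InnerProductSpace.laplacian_smul _ (contDiffAt_sineProfile k a hx0),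
      laplacian_sineProfile k a hx0, H.profile_eq h.le h'.le, smul_eq_mul]
    ring
  hardCore x h _ := H.profile_of_le h.le
  neumann x hx := by
    have hℓ := H.l_pos
    have h1 : HasDerivAt (fun t : ℝ => ℓ / Real.sin (k * (ℓ - a)) * sineProfile k a (t * ℓ)) 0 1 := by
      have h2 : HasDerivAt (sineProfile k a) (sineFlux k a ℓ / ℓ ^ 2) (1 * ℓ) := by
        rw [one_mul]; exact hasDerivAt_sineProfile k a hℓ.ne'
      have h3 := (h2.comp (1 : ℝ) ((hasDerivAt_id' (1 : ℝ)).mul_const ℓ)).const_mul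
        (ℓ / Real.sin (k * (ℓ - a)))
      rw [H.flux, zero_div, zero_mul, mul_zero] at h3
      exact h3
    refine h1.hasDerivWithinAt.congr_of_eventuallyEq_of_mem ?_ Set.self_mem_Iic
    have h0 : Set.Ioc (a / ℓ) 1 ∈ 𝓝[≤] (1 : ℝ) := Ioc_mem_nhdsLE ((div_lt_one hℓ).2 H.a_lt)
    filter_upwards [h0] with s hs
    have hs0 : 0 < s := (div_pos H.a_pos hℓ).trans hs.1
    rw [norm_smul, Real.norm_eq_abs, abs_of_pos hs0, hx,
      H.profile_eq ((div_lt_iff₀ hℓ).1 hs.1).le (by nlinarith [hs.2])]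
  nontrivial := by
    refine ⟨EuclideanSpace.single 0 ℓ, ?_, ?_⟩
    · simp [abs_of_pos H.l_pos]
    · rw [H.profile_of_ge (by simp [abs_of_pos H.l_pos])]
      exact one_ne_zero

/-- A smaller eigenvalue is excluded by comparison with a radial solution of smaller
wavenumber and core radius, which is positive on the annulus and increasing at `ℓ`. -/
lemma isGroundState (H : IsWavenumber a ℓ k) :
    IsHardCoreGroundState a ℓ fun x => hardCoreProfile k a ℓ ‖x‖ := by
  refine ⟨k ^ 2, ⟨⟨_, H.isEigenfunction⟩, ?_⟩, H.isEigenfunction, fun x hx => H.profile_of_ge hx⟩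
  rintro μ ⟨g, hg⟩
  by_contra! hlt
  -- a wavenumber `k'` with `μ < k' ^ 2 < k ^ 2`, for which the flux through `ℓ` is positive
  set q := (max μ 0 + k ^ 2) / 2 with hq
  have hkp : 0 < k ^ 2 := pow_pos H.k_pos 2
  have hmax : max μ 0 < k ^ 2 := max_lt hlt hkp
  have hq0 : 0 < q := by linarith [le_max_right μ 0]
  have hqk : q < k ^ 2 := by linarith
  have hμq : μ < q := by linarith [le_max_left μ 0]
  set k' := √q with hk'
  have hk'0 : 0 < k' := Real.sqrt_pos.2 hq0
  have hk'k : k' < k := (Real.sqrt_lt' H.k_pos).2 hqk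
  have hk'sq : k' ^ 2 = q := Real.sq_sqrt hq0.le
  have hfl := sineFlux_pos H.a_lt H.a_pos H.lt_pi H.flux hk'0 hk'k
  -- by continuity this persists for a slightly smaller core radius `b`
  have hev : ∀ᶠ b in 𝓝[<] a, 0 < sineFlux k' b ℓ ∧ k' * (ℓ - b) < Real.pi / 2 := by
    have c1 : ContinuousAt (fun b => sineFlux k' b ℓ) a := by unfold sineFlux; fun_prop
    have c2 : ContinuousAt (fun b => k' * (ℓ - b)) a := by fun_prop
    have h2 : k' * (ℓ - a) < Real.pi / 2 :=
      (mul_lt_mul_of_pos_right hk'k (sub_pos.2 H.a_lt)).trans H.lt_pi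
    exact ((c1.eventually_const_lt hfl).and (c2.eventually_lt_const h2)).filter_mono
      nhdsWithin_le_nhds
  obtain ⟨b, ⟨hb1, hb2⟩, hba⟩ := (hev.and self_mem_nhdsWithin).exists
  have hba : b < a := hba
  have hpos : ∀ r, a ≤ r → r ≤ ℓ → 0 < sineProfile k' b r := fun r hr hr' => by
    refine div_pos (Real.sin_pos_of_pos_of_lt_pi (mul_pos hk'0 (by linarith)) ?_)
      (H.a_pos.trans_le hr)
    have : k' * (r - b) ≤ k' * (ℓ - b) := by gcongr
    linarith [Real.pi_pos]
  have := hg.sq_le H.a_pos H.a_lt hpos hb1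
  linarith

/-- Uniqueness of the normalized ground state. The value `1` on the outer sphere turns the Neumann
problem into a Dirichlet problem, to which the comparison principle applies. -/
lemma eq_of_isGroundState (H : IsWavenumber a ℓ k) {f : Space3 → ℝ}
    (hf : IsHardCoreGroundState a ℓ f) : f = fun x => hardCoreProfile k a ℓ ‖x‖ := by
  obtain ⟨lam, hleast, heig, hone⟩ := hf
  obtain ⟨lam', hleast', heig', _⟩ := H.isGroundState
  obtain rfl := hleast.unique hleast'
  have hlam : lam ≤ k ^ 2 := hleast.2 ⟨_, H.isEigenfunction⟩
  ext x
  rcases le_total ℓ ‖x‖ with h | h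
  · rw [hone x h, H.profile_of_ge h]
  -- a strict supersolution with wavenumber `3 k / 2`, positive up to the angle `7 π / 8`
  set b := ℓ - 7 * Real.pi / 8 / (3 / 2 * k) with hb
  have hk : 0 < 3 / 2 * k := by linarith [H.k_pos]
  have hkb : 3 / 2 * k * (ℓ - b) = 7 * Real.pi / 8 := by
    rw [hb, sub_sub_cancel, mul_div_cancel₀ _ hk.ne']
  have hba : b < a := by
    have : 3 / 2 * k * (ℓ - a) < 3 / 2 * k * (ℓ - b) := by
      rw [hkb]
      linarith [H.lt_pi, Real.pi_pos]
    linarith [lt_of_mul_lt_mul_left this hk.le]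
  refine heig.eq_of_boundary (k := 3 / 2 * k) (b := b) heig' H.a_pos H.a_lt (fun r hr hr' => ?_) ?_
    (fun x hx => by rw [hone x hx.ge, H.profile_of_ge hx.ge]) x h
  · refine div_pos (Real.sin_pos_of_pos_of_lt_pi (mul_pos hk (by linarith)) ?_)
      (H.a_pos.trans_le hr)
    have : 3 / 2 * k * (r - b) ≤ 3 / 2 * k * (ℓ - b) := by gcongr
    linarith [Real.pi_pos]
  · nlinarith [H.k_pos]

end IsWavenumber

lemma exists_isWavenumber (ha : 0 < a) (haℓ : a < ℓ) : ∃ k, IsWavenumber a ℓ k := by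
  obtain ⟨k, h1, h2, h3⟩ := exists_sineFlux_eq_zero ha haℓ
  exact ⟨k, ha, haℓ, h1, h2, h3⟩

end Profile

/-! ### Integral estimates -/

section Estimates

variable {Ω : Type*} [MeasurableSpace Ω] {μ : Measure Ω} [IsFiniteMeasure μ] {F e : Ω → Ω → ℝ}
  {U : ℝ}

/-- Young's inequality `‖|F| * u‖₂ ≤ ‖F‖₁ ‖u‖₂`, where `u = 1 - e`. -/
lemma IsRepulsive.integral_sq_conv_le (H : IsRepulsive μ e U) {x : Ω} (hF : BddMeas (F x))
    {A R : ℝ} (hA : ∫ y, |F x y| ∂μ ≤ A) (hR : ∀ y, ∫ z, (1 - e y z) ^ 2 ∂μ ≤ R) :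
    ∫ z, (∫ y, |F x y| * (1 - e y z) ∂μ) ^ 2 ∂μ ≤ A * (A * R) := by
  have bu : BddMeas fun p : Ω × Ω => 1 - e p.1 p.2 := (BddMeas.const 1).sub H.bddMeas
  have bz : ∀ z, BddMeas fun y => 1 - e y z := fun z =>
    bu.comp (measurable_id.prodMk measurable_const)
  have b1 : BddMeas fun p : Ω × Ω => |F x p.2| * (1 - e p.2 p.1) :=
    (hF.abs.comp measurable_snd).mul (bu.comp measurable_swap)
  have b2 : BddMeas fun p : Ω × Ω => (1 - e p.2 p.1) ^ 2 * |F x p.2| :=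
    ((bu.comp measurable_swap).pow 2).mul (hF.abs.comp measurable_snd)
  have hA0 : 0 ≤ A := (integral_nonneg fun y => abs_nonneg _).trans hA
  have hcs : ∀ z, (∫ y, |F x y| * (1 - e y z) ∂μ) ^ 2 ≤
      A * ∫ y, (1 - e y z) ^ 2 * |F x y| ∂μ := fun z => by
    have h := sq_integral_mul_le μ (BddMeas.const 1) (bz z) hF.abs fun y => abs_nonneg _
    simp only [one_mul, one_pow] at h
    simp only [mul_comm |F x _|]
    refine h.trans (mul_le_mul_of_nonneg_right hA ?_)
    exact integral_nonneg fun y => mul_nonneg (sq_nonneg _) (abs_nonneg _)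
  calc _ ≤ ∫ z, A * ∫ y, (1 - e y z) ^ 2 * |F x y| ∂μ ∂μ :=
        integral_mono (((b1.integral μ).pow 2).integrable _)
          (((b2.integral μ).const_mul A).integrable _) hcs
    _ = A * ∫ y, (∫ z, (1 - e y z) ^ 2 ∂μ) * |F x y| ∂μ := by
        rw [integral_const_mul, integral_integral_swap (b2.integrable _)]
        simp only [integral_mul_const]
    _ ≤ A * (A * R) := by
        refine mul_le_mul_of_nonneg_left ?_ hA0
        rcases isEmpty_or_nonempty Ω with hΩ | ⟨⟨y0⟩⟩
        · exact isEmptyElim x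
        have hR0 : 0 ≤ R := (integral_nonneg fun z => sq_nonneg _).trans (hR y0)
        calc _ ≤ ∫ y, R * |F x y| ∂μ :=
              integral_mono ((((bu.pow 2).integral μ).mul hF.abs).integrable _)
                ((hF.abs.const_mul R).integrable _) fun y =>
                  mul_le_mul_of_nonneg_right (hR y) (abs_nonneg _)
          _ = R * ∫ y, |F x y| ∂μ := integral_const_mul _ _
          _ ≤ A * R := by rw [mul_comm A]; exact mul_le_mul_of_nonneg_left hA hR0

/-- If `|F| ≤ K s³`, the integral of `|F| |F| u` with `u = 1 - e` is controlled by the integrals of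
`s⁴` and `u²`. Pointwise this is the inequality of arithmetic and geometric means for
`(s s')² · (s s' u)`, with a weight `t` to be chosen. -/
lemma IsRepulsive.integral_triangle_le (H : IsRepulsive μ e U) {x : Ω} (hF : BddMeas (F x))
    {s : Ω → ℝ} (hs : BddMeas s) (hs0 : ∀ y, 0 ≤ s y) {K : ℝ} (hFs : ∀ y, |F x y| ≤ K * s y ^ 3)
    {Q R t : ℝ} (ht : 0 < t) (hQ : ∫ y, s y ^ 4 ∂μ ≤ Q)
    (hR : ∀ y, ∫ z, (1 - e y z) ^ 2 ∂μ ≤ R) :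
    ∫ y, ∫ z, |F x y| * |F x z| * (1 - e y z) ∂μ ∂μ ≤
      K ^ 2 * (t * Q ^ 2 / 2 + Q * R / (2 * t)) := by
  have be : BddMeas fun p : Ω × Ω => 1 - e p.1 p.2 := (BddMeas.const 1).sub H.bddMeas
  have b1 : BddMeas fun p : Ω × Ω => |F x p.1| * |F x p.2| * (1 - e p.1 p.2) :=
    ((hF.abs.comp measurable_fst).mul (hF.abs.comp measurable_snd)).mul be
  have s1 : BddMeas fun p : Ω × Ω => s p.1 ^ 4 := (hs.pow 4).comp measurable_fst
  have s2 : BddMeas fun p : Ω × Ω => s p.2 ^ 4 := (hs.pow 4).comp measurable_snd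
  have b2 : BddMeas fun p : Ω × Ω => s p.1 ^ 4 * s p.2 ^ 4 := s1.mul s2
  have b3 : BddMeas fun p : Ω × Ω => s p.1 ^ 4 * (1 - e p.1 p.2) ^ 2 := s1.mul (be.pow 2)
  have b4 : BddMeas fun p : Ω × Ω => s p.2 ^ 4 * (1 - e p.1 p.2) ^ 2 := s2.mul (be.pow 2)
  have hQ0 : 0 ≤ Q := (integral_nonneg fun y => pow_nonneg (hs0 y) 4).trans hQ
  have hpt : ∀ p : Ω × Ω, |F x p.1| * |F x p.2| * (1 - e p.1 p.2) ≤
      K ^ 2 * (t / 2) * (s p.1 ^ 4 * s p.2 ^ 4) +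
        K ^ 2 / (4 * t) * (s p.1 ^ 4 * (1 - e p.1 p.2) ^ 2 + s p.2 ^ 4 * (1 - e p.1 p.2) ^ 2) := by
    intro p
    set σ := s p.1 with hσ
    set σ' := s p.2 with hσ'
    set u := 1 - e p.1 p.2 with hu
    have hu0 : 0 ≤ u := sub_nonneg.2 (H.le_one _ _)
    have h1 : |F x p.1| * |F x p.2| * u ≤ K ^ 2 * (σ ^ 3 * σ' ^ 3 * u) := by
      calc _ ≤ (K * σ ^ 3) * (K * σ' ^ 3) * u := by
            refine mul_le_mul_of_nonneg_right (mul_le_mul (hFs _) (hFs _) (abs_nonneg _)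
              ((abs_nonneg _).trans (hFs _))) hu0
        _ = _ := by ring
    refine h1.trans ?_
    have h2 : σ ^ 3 * σ' ^ 3 * u ≤ t / 2 * (σ ^ 4 * σ' ^ 4) +
        1 / (4 * t) * (σ ^ 4 * u ^ 2 + σ' ^ 4 * u ^ 2) := by
      have e1 : t / 2 * (σ ^ 4 * σ' ^ 4) + 1 / (4 * t) * (σ ^ 4 * u ^ 2 + σ' ^ 4 * u ^ 2) -
          σ ^ 3 * σ' ^ 3 * u = (2 * (t * (σ ^ 2 * σ' ^ 2) - σ * σ' * u) ^ 2 +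
            (σ ^ 2 - σ' ^ 2) ^ 2 * u ^ 2) / (4 * t) := by
        field_simp
        ring
      have : 0 ≤ (2 * (t * (σ ^ 2 * σ' ^ 2) - σ * σ' * u) ^ 2 +
            (σ ^ 2 - σ' ^ 2) ^ 2 * u ^ 2) / (4 * t) := by positivity
      linarith
    calc _ ≤ K ^ 2 * (t / 2 * (σ ^ 4 * σ' ^ 4) +
          1 / (4 * t) * (σ ^ 4 * u ^ 2 + σ' ^ 4 * u ^ 2)) :=
          mul_le_mul_of_nonneg_left h2 (sq_nonneg K)
      _ = _ := by ring
  have i2 : ∫ p, s p.1 ^ 4 * s p.2 ^ 4 ∂μ.prod μ ≤ Q * Q := by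
    rw [integral_prod_mul (fun y => s y ^ 4) fun y => s y ^ 4]
    exact mul_le_mul hQ hQ (integral_nonneg fun y => pow_nonneg (hs0 y) 4) hQ0
  have i3 : ∫ p, s p.1 ^ 4 * (1 - e p.1 p.2) ^ 2 ∂μ.prod μ ≤ Q * R := by
    rw [integral_prod _ (b3.integrable _)]
    simp only [integral_const_mul]
    have hR0 : 0 ≤ R := (integral_nonneg fun z => sq_nonneg _).trans (hR x)
    calc _ ≤ ∫ y, s y ^ 4 * R ∂μ :=
          integral_mono (((hs.pow 4).mul ((be.pow 2).integral μ)).integrable _)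
            (((hs.pow 4).mul (.const R)).integrable _) fun y =>
              mul_le_mul_of_nonneg_left (hR y) (pow_nonneg (hs0 y) 4)
      _ ≤ Q * R := by
          rw [integral_mul_const]
          exact mul_le_mul_of_nonneg_right hQ hR0
  have i4 : ∫ p, s p.2 ^ 4 * (1 - e p.1 p.2) ^ 2 ∂μ.prod μ ≤ Q * R := by
    rw [← integral_prod_swap]
    simp only [Prod.fst_swap, Prod.snd_swap]
    refine le_trans (le_of_eq ?_) i3
    refine integral_congr_ae (.of_forall fun p => ?_)
    simp only
    rw [H.symm]
  have h1 := integral_prod _ (b1.integrable (μ.prod μ))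
  simp only at h1
  rw [← h1]
  calc _ ≤ ∫ p, (K ^ 2 * (t / 2) * (s p.1 ^ 4 * s p.2 ^ 4) + K ^ 2 / (4 * t) *
        (s p.1 ^ 4 * (1 - e p.1 p.2) ^ 2 + s p.2 ^ 4 * (1 - e p.1 p.2) ^ 2)) ∂μ.prod μ :=
        integral_mono (b1.integrable _)
          (((b2.const_mul _).add ((b3.add b4).const_mul _)).integrable _) hpt
    _ = K ^ 2 * (t / 2) * ∫ p, s p.1 ^ 4 * s p.2 ^ 4 ∂μ.prod μ + K ^ 2 / (4 * t) *
        (∫ p, s p.1 ^ 4 * (1 - e p.1 p.2) ^ 2 ∂μ.prod μ +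
          ∫ p, s p.2 ^ 4 * (1 - e p.1 p.2) ^ 2 ∂μ.prod μ) := by
        rw [integral_add ((b2.const_mul _).integrable _) (((b3.add b4).const_mul _).integrable _),
          integral_const_mul, integral_const_mul, integral_add (b3.integrable _) (b4.integrable _)]
    _ ≤ K ^ 2 * (t / 2) * (Q * Q) + K ^ 2 / (4 * t) * (Q * R + Q * R) := by gcongr
    _ = _ := by
        field_simp
        ring

/-- Integration of radial functions with an integrable singularity at the origin. -/
lemma integral_radial_le {φ : ℝ → ℝ} (hφ : Measurable φ) (h0 : ∀ r, 0 ≤ φ r) {K p ℓ : ℝ}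
    (hp : p < 3) (hℓ : 0 < ℓ) (hle : ∀ r, 0 < r → r ≤ ℓ → φ r ≤ K * r ^ (-p))
    (hz : ∀ r, ℓ < r → φ r = 0) :
    Integrable (fun x : Space3 => φ ‖x‖) ∧
      ∫ x : Space3, φ ‖x‖ ≤ 4 * Real.pi * K * ℓ ^ (3 - p) / (3 - p) := by
  have hint : IntervalIntegrable (fun r : ℝ => r ^ (2 - p)) volume 0 ℓ :=
    intervalIntegral.intervalIntegrable_rpow' (by linarith)
  have hint2 : IntegrableOn (fun r : ℝ => K * r ^ (2 - p)) (Set.Ioc 0 ℓ) :=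
    ((intervalIntegrable_iff_integrableOn_Ioc_of_le hℓ.le).1 hint).const_mul K
  have hind : IntegrableOn ((Set.Ioc 0 ℓ).indicator fun r : ℝ => K * r ^ (2 - p)) (Set.Ioi 0) :=
    (integrable_indicator_iff measurableSet_Ioc).2 hint2 |>.integrableOn
  have hdom : ∀ r ∈ Set.Ioi (0 : ℝ), r ^ 2 * φ r ≤
      (Set.Ioc 0 ℓ).indicator (fun r : ℝ => K * r ^ (2 - p)) r := fun r hr => by
    have hr : 0 < r := hr
    by_cases h : r ≤ ℓ
    · rw [Set.indicator_of_mem (show r ∈ Set.Ioc 0 ℓ from ⟨hr, h⟩)]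
      calc r ^ 2 * φ r ≤ r ^ 2 * (K * r ^ (-p)) := by gcongr; exact hle r hr h
        _ = K * (r ^ (2 : ℝ) * r ^ (-p)) := by rw [Real.rpow_two]; ring
        _ = K * r ^ (2 - p) := by rw [← Real.rpow_add hr, sub_eq_add_neg]
    · rw [Set.indicator_of_notMem fun hm => h hm.2, hz r (not_le.1 h), mul_zero]
  have hdim : Module.finrank ℝ Space3 = 3 := by simp
  have hnn : ∀ r : ℝ, 0 ≤ r ^ 2 * φ r := fun r => mul_nonneg (sq_nonneg r) (h0 r)
  have hI : IntegrableOn (fun r => r ^ 2 * φ r) (Set.Ioi 0) := by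
    refine Integrable.mono' hind
      ((measurable_id.pow_const 2).mul hφ).aestronglyMeasurable ?_
    refine (ae_restrict_iff' measurableSet_Ioi).2 (.of_forall fun r hr => ?_)
    rw [Real.norm_eq_abs, abs_of_nonneg (hnn r)]
    exact hdom r hr
  constructor
  · rw [integrable_fun_norm_addHaar volume, hdim]
    simpa using hI
  · rw [integral_fun_norm_addHaar volume φ, hdim]
    have hball : (volume : Measure Space3).real (Metric.ball 0 1) = Real.pi * 4 / 3 := by
      rw [measureReal_def, EuclideanSpace.volume_ball_fin_three]
      simp
      positivity
    rw [hball]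
    simp only [nsmul_eq_mul, smul_eq_mul, Nat.cast_ofNat]
    have h1 : ∫ r in Set.Ioi (0 : ℝ), r ^ 2 * φ r ≤ K * (ℓ ^ (3 - p) / (3 - p)) := by
      calc _ ≤ ∫ r in Set.Ioi (0 : ℝ), (Set.Ioc 0 ℓ).indicator (fun r : ℝ => K * r ^ (2 - p)) r :=
            setIntegral_mono_on hI hind measurableSet_Ioi hdom
        _ = ∫ r in (0 : ℝ)..ℓ, K * r ^ (2 - p) := by
            rw [intervalIntegral.integral_of_le hℓ.le, setIntegral_indicator measurableSet_Ioc,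
              Set.inter_eq_right.2 Set.Ioc_subset_Ioi_self]
        _ = _ := by
            rw [intervalIntegral.integral_const_mul, integral_rpow (Or.inl (by linarith)),
              show 2 - p + 1 = 3 - p by ring, Real.zero_rpow (by linarith), sub_zero]
    calc _ ≤ 3 * (Real.pi * 4 / 3 * (K * (ℓ ^ (3 - p) / (3 - p)))) := by
          have := Real.pi_pos
          gcongr
      _ = _ := by ring

end Estimates

/-! ### The Jastrow gas on the torus -/

section Application

variable {L : ℝ} {f : Space3 → ℝ}

/-- The squared Jastrow factor of a pair of particles on the torus. -/
noncomputable def pairFactor (f : Space3 → ℝ) (L : ℝ) (x y : Space3) : ℝ := torusExtend L f (x - y) ^ 2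

/-- The coordinate `c` of `f ∇f = f² (∇f / f)` for a pair of particles on the torus. -/
noncomputable def pairForce (f : Space3 → ℝ) (L : ℝ) (c : Fin 3) (x y : Space3) : ℝ :=
  torusExtend L f (x - y) * (∇ (torusExtend L f)) (x - y) c

lemma pairWeight_eq_mul {Ω : Type*} [MeasurableSpace Ω] (e : Ω → Ω → ℝ) {n : ℕ} (X : Fin (n + 1) → Ω) :
    pairWeight e X = (∏ j : Fin n, e (X 0) (X j.succ)) * pairWeight e fun j : Fin n => X j.succ := by
  rw [← pairWeight_cons]
  congr 1
  exact (Fin.cons_self_tail X).symm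

/-- Where `f` vanishes both sides are zero, the left one because `f⁻¹` is then zero by convention. -/
lemma threeBodyIntegrand_eq_sum {n : ℕ} (X : Fin (n + 3) → Space3) :
    threeBodyIntegrand f L 0 1 2 X =
      ∑ c, threeBody (pairForce f L c) (pairFactor f L) X := by
  have hJ : jastrowSq f L X = pairWeight (pairFactor f L) X := rfl
  have hw : ∀ t : ℝ, t⁻¹ * t ^ 2 = t := fun t => by
    by_cases h : t = 0
    · simp [h]
    · field_simp
  rw [threeBodyIntegrand, hJ, pairWeight_eq_mul, pairWeight_eq_mul, pairWeight_eq_mul,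
    PiLp.inner_apply, Finset.sum_mul]
  refine Finset.sum_congr rfl fun c _ => ?_
  simp only [Fin.prod_univ_succ, Fin.succ_zero_eq_one, Fin.succ_one_eq_two, logGrad,
    PiLp.smul_apply, smul_eq_mul, threeBody, pairForce, pinnedDensity, RCLike.inner_apply,
    conj_trivial]
  simp only [pairFactor]
  have h1 := hw (torusExtend L f (X 0 - X 1))
  have h2 := hw (torusExtend L f (X 0 - X 2))
  generalize torusExtend L f (X 0 - X 1) = u at *
  generalize torusExtend L f (X 0 - X 2) = v at *
  nth_rewrite 3 [← h1]
  nth_rewrite 3 [← h2]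
  ring

lemma torusExtend_torusRep_sub (hL : 0 < L) (c w : Space3) :
    torusExtend L f (torusRep L c - w) = torusExtend L f (c - w) ∧
      (∇ (torusExtend L f)) (torusRep L c - w) = (∇ (torusExtend L f)) (c - w) := by
  rw [torusRep_eq_sub, sub_right_comm, torusExtend_sub_latticeVector hL,
    gradient_torusExtend_sub_latticeVector hL]
  exact ⟨rfl, rfl⟩

section Reflection

variable (hL : 0 < L) (hf : ∀ x y, ‖x‖ = ‖y‖ → f x = f y)
include hL hf

lemma torusExtend_sub_comm (x y : Space3) :
    torusExtend L f (x - y) = torusExtend L f (y - x) := by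
  rw [← neg_sub, torusExtend_neg hL hf]

lemma pairFactor_reflect_reflect (x y z : Space3) :
    pairFactor f L (torusRep L (x + x - y)) (torusRep L (x + x - z)) = pairFactor f L y z := by
  rw [pairFactor, (torusExtend_torusRep_sub hL _ _).1, torusExtend_sub_comm hL hf,
    (torusExtend_torusRep_sub hL _ _).1, sub_sub_sub_cancel_left, pairFactor]

lemma pairFactor_reflect (x y : Space3) :
    pairFactor f L x (torusRep L (x + x - y)) = pairFactor f L x y := by
  rw [pairFactor, torusExtend_sub_comm hL hf, (torusExtend_torusRep_sub hL _ _).1, pairFactor]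
  congr 2
  abel

lemma pairForce_reflect (c : Fin 3) (x y : Space3) :
    pairForce f L c x (torusRep L (x + x - y)) = - pairForce f L c x y := by
  have h : x + x - y - x = x - y := by abel
  rw [pairForce, torusExtend_sub_comm hL hf, ← neg_sub _ x, gradient_torusExtend_neg hL hf,
    (torusExtend_torusRep_sub hL _ _).1, (torusExtend_torusRep_sub hL _ _).2, h, pairForce,
    PiLp.neg_apply, mul_neg]

end Reflection

lemma measurable_gradient (g : Space3 → ℝ) : Measurable (∇ g) :=
  (InnerProductSpace.toDual ℝ Space3).symm.continuous.measurable.comp (measurable_fderiv ℝ g)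

lemma measurable_uncurry_sub {g : Space3 → ℝ} (hg : Measurable g) :
    Measurable (uncurry fun x y => g (x - y)) :=
  hg.comp (measurable_fst.sub measurable_snd)

/-- Integration over the torus of a radial function with an integrable singularity. -/
lemma integral_torus_radial_le (hL : 0 < L) {φ : ℝ → ℝ} (hφ : Measurable φ) (h0 : ∀ r, 0 ≤ φ r)
    {K p ℓ : ℝ} (hp : p < 3) (hℓ : 0 < ℓ) (hle : ∀ r, 0 < r → r ≤ ℓ → φ r ≤ K * r ^ (-p))
    (hz : ∀ r, ℓ < r → φ r = 0) (x : Space3) :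
    ∫ y, φ ‖torusRep L (x - y)‖ ∂boxMeasure L ≤ 4 * Real.pi * K * ℓ ^ (3 - p) / (3 - p) := by
  have h := integral_radial_le hφ h0 hp hℓ hle hz
  exact (integral_torusRep_le hL (hφ.comp measurable_norm) (fun x => h0 _) h.1 x).trans h.2

namespace IsWavenumber

variable {a ℓ k : ℝ}

lemma one_sub_sq_profile_nonneg (H : IsWavenumber a ℓ k) (r : ℝ) :
    0 ≤ 1 - hardCoreProfile k a ℓ r ^ 2 := by
  nlinarith [H.profile_nonneg r, H.profile_le_one r]

lemma one_sub_sq_profile_le (H : IsWavenumber a ℓ k) {r : ℝ} (hr : 0 < r) :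
    1 - hardCoreProfile k a ℓ r ^ 2 ≤ 2 * a / r := by
  have h := H.one_sub_profile_le hr
  rw [mul_div_assoc]
  nlinarith [H.profile_nonneg r, H.profile_le_one r]

lemma measurable_one_sub_sq_profile (H : IsWavenumber a ℓ k) :
    Measurable fun r => 1 - hardCoreProfile k a ℓ r ^ 2 :=
  measurable_const.sub (H.continuous_profile.measurable.pow_const 2)

lemma measurable_torusExtend (H : IsWavenumber a ℓ k) (L : ℝ) :
    Measurable (torusExtend L fun x => hardCoreProfile k a ℓ ‖x‖) :=
  H.continuous_profile.measurable.comp (measurable_norm.comp (measurable_torusRep L))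

lemma isRepulsive_pairFactor (H : IsWavenumber a ℓ k) (hL : 0 < L) :
    IsRepulsive (boxMeasure L) (pairFactor (fun x => hardCoreProfile k a ℓ ‖x‖) L)
      (4 * Real.pi * a * ℓ ^ 2) where
  measurable := measurable_uncurry_sub ((H.measurable_torusExtend L).pow_const 2)
  nonneg x y := sq_nonneg _
  le_one x y := sub_nonneg.1 (H.one_sub_sq_profile_nonneg _)
  symm x y := by
    rw [pairFactor, pairFactor, torusExtend_sub_comm hL fun x y h => by rw [h]]
  integral_le x := by
    refine (integral_torus_radial_le hL H.measurable_one_sub_sq_profile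
      H.one_sub_sq_profile_nonneg (K := 2 * a) (p := 1) (by norm_num) H.l_pos
      (fun r hr _ => ?_) (fun r hr => ?_) x).trans_eq ?_
    · rw [Real.rpow_neg_one, ← div_eq_mul_inv]
      exact H.one_sub_sq_profile_le hr
    · rw [H.profile_of_ge hr.le]; norm_num
    · rw [show (3 : ℝ) - 1 = 2 by norm_num, Real.rpow_two]; ring

lemma integral_sq_one_sub_pairFactor_le (H : IsWavenumber a ℓ k) (hL : 0 < L) (x : Space3) :
    ∫ y, (1 - pairFactor (fun x => hardCoreProfile k a ℓ ‖x‖) L x y) ^ 2 ∂boxMeasure L ≤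
      16 * Real.pi * a ^ 2 * ℓ := by
  refine (integral_torus_radial_le hL (H.measurable_one_sub_sq_profile.pow_const 2)
    (fun r => sq_nonneg _) (K := 4 * a ^ 2) (p := 2) (by norm_num) H.l_pos
    (fun r hr _ => ?_) (fun r hr => ?_) x).trans_eq ?_
  · rw [Real.rpow_neg hr.le, Real.rpow_two, ← div_eq_mul_inv]
    calc _ ≤ (2 * a / r) ^ 2 :=
          pow_le_pow_left₀ (H.one_sub_sq_profile_nonneg r) (H.one_sub_sq_profile_le hr) 2
      _ = _ := by ring
  · rw [H.profile_of_ge hr.le]; norm_num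
  · rw [show (3 : ℝ) - 2 = 1 by norm_num, Real.rpow_one]; ring

/-- The function `r ↦ r ^ (-2/3)`, cut off to `a < r ≤ ℓ`. Its cube dominates the
force, and its fourth power is still integrable at the origin as `a → 0`, unlike the square of the
force. -/
noncomputable def _root_.forceRoot (a ℓ r : ℝ) : ℝ := (Set.Ioc a ℓ).indicator (fun r => r ^ (-(2 / 3) : ℝ)) r

lemma _root_.measurable_forceRoot (a ℓ : ℝ) : Measurable (forceRoot a ℓ) :=
  (measurable_id.pow_const _).indicator measurableSet_Ioc

lemma forceRoot_nonneg (H : IsWavenumber a ℓ k) (r : ℝ) : 0 ≤ forceRoot a ℓ r :=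
  Set.indicator_nonneg (fun _ hr => Real.rpow_nonneg (H.a_pos.trans hr.1).le _) r

lemma forceRoot_le (H : IsWavenumber a ℓ k) (r : ℝ) : forceRoot a ℓ r ≤ a ^ (-(2 / 3) : ℝ) := by
  by_cases hr : r ∈ Set.Ioc a ℓ
  · rw [forceRoot, Set.indicator_of_mem hr]
    exact Real.rpow_le_rpow_of_nonpos H.a_pos hr.1.le (by norm_num)
  · rw [forceRoot, Set.indicator_of_notMem hr]
    exact Real.rpow_nonneg H.a_pos.le _

lemma forceRoot_pow_le (H : IsWavenumber a ℓ k) (n : ℕ) {r : ℝ} (hr : 0 < r) :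
    forceRoot a ℓ r ^ n ≤ 1 * r ^ (-(2 / 3 * n) : ℝ) := by
  rw [one_mul, ← neg_mul, Real.rpow_mul hr.le, Real.rpow_natCast]
  refine pow_le_pow_left₀ (H.forceRoot_nonneg r) ?_ n
  by_cases h : r ∈ Set.Ioc a ℓ
  · rw [forceRoot, Set.indicator_of_mem h]
  · rw [forceRoot, Set.indicator_of_notMem h]
    exact Real.rpow_nonneg hr.le _

lemma forceRoot_of_gt {r : ℝ} (hr : ℓ < r) : forceRoot a ℓ r = 0 :=
  Set.indicator_of_notMem (fun h => h.2.not_gt hr) _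

lemma integral_forceRoot_pow_le (H : IsWavenumber a ℓ k) (hL : 0 < L) (x : Space3) {n : ℕ}
    (hn : n ≠ 0) (hn' : 2 / 3 * (n : ℝ) < 3) :
    ∫ y, forceRoot a ℓ ‖torusRep L (x - y)‖ ^ n ∂boxMeasure L ≤
      4 * Real.pi * 1 * ℓ ^ (3 - 2 / 3 * n : ℝ) / (3 - 2 / 3 * n) :=
  integral_torus_radial_le hL ((measurable_forceRoot a ℓ).pow_const n)
    (fun r => pow_nonneg (H.forceRoot_nonneg r) n) hn' H.l_pos
    (fun r hr _ => H.forceRoot_pow_le n hr) (fun r hr => by rw [forceRoot_of_gt hr, zero_pow hn]) x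

lemma abs_pairForce_le (H : IsWavenumber a ℓ k) (h2 : 2 * a ≤ ℓ) (hL : 2 * ℓ < L) (c : Fin 3)
    (x y : Space3) :
    |pairForce (fun x => hardCoreProfile k a ℓ ‖x‖) L c x y| ≤
      4 * a * forceRoot a ℓ ‖torusRep L (x - y)‖ ^ 3 := by
  have hL0 : 0 < L := by linarith [H.l_pos]
  have ha := H.a_pos
  set z := torusRep L (x - y) with hz
  have hs := pow_nonneg (H.forceRoot_nonneg ‖z‖) 3
  have hT : torusExtend L (fun x => hardCoreProfile k a ℓ ‖x‖) (x - y) =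
    hardCoreProfile k a ℓ ‖z‖ := rfl
  rw [pairForce, hT]
  rcases le_or_gt ‖z‖ a with h | h
  · rw [H.profile_of_le h, zero_mul, abs_zero]
    positivity
  rcases lt_or_ge ℓ ‖z‖ with h' | h'
  · rw [gradient_torusExtend_eq_zero hL0 (fun x hx => H.profile_of_ge hx) h']
    simp only [PiLp.zero_apply, mul_zero, abs_zero]
    positivity
  rw [gradient_torusExtend hL0 (by linarith), forceRoot, Set.indicator_of_mem (Set.mem_Ioc.2 ⟨h, h'⟩),
    ← Real.rpow_natCast, ← Real.rpow_mul (norm_nonneg _),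
    show (-(2 / 3) * ((3 : ℕ) : ℝ) : ℝ) = -(2 : ℝ) by norm_num, Real.rpow_neg (norm_nonneg _),
    Real.rpow_two, ← div_eq_mul_inv, abs_mul, abs_of_nonneg (H.profile_nonneg _)]
  calc _ ≤ 1 * ‖(∇ fun x : Space3 => hardCoreProfile k a ℓ ‖x‖) z‖ :=
        mul_le_mul (H.profile_le_one _) (PiLp.norm_apply_le _ c) (abs_nonneg _) zero_le_one
    _ ≤ _ := by
        rw [one_mul]
        exact H.norm_gradient_le h2 h

lemma bddMeas_pairForce (H : IsWavenumber a ℓ k) (h2 : 2 * a ≤ ℓ) (hL : 2 * ℓ < L) (c : Fin 3) :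
    BddMeas (uncurry (pairForce (fun x => hardCoreProfile k a ℓ ‖x‖) L c)) := by
  refine ⟨?_, 4 * a * (a ^ (-(2 / 3) : ℝ)) ^ 3, fun p => (H.abs_pairForce_le h2 hL c p.1 p.2).trans ?_⟩
  · refine measurable_uncurry_sub (g := fun z => torusExtend L _ z * (∇ (torusExtend L _)) z c)
      ((H.measurable_torusExtend L).mul ?_)
    exact ((measurable_pi_apply c).comp (PiLp.volume_preserving_ofLp (Fin 3)).measurable).comp
      (measurable_gradient _)
  · have := H.a_pos
    have := H.forceRoot_nonneg ‖torusRep L (p.1 - p.2)‖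
    gcongr
    exact H.forceRoot_le _

/-- The three-body integral of one coordinate, with the estimates for the ground state inserted. -/
lemma abs_integral_threeBody_le (H : IsWavenumber a ℓ k) (h2 : 2 * a ≤ ℓ) (hL : 2 * ℓ < L)
    {n : ℕ} (hn : 0 < n) (hU : 16 * ((n + 3 : ℕ) * (4 * Real.pi * a * ℓ ^ 2)) ≤ L ^ 3)
    (c : Fin 3) :
    |∫ X, threeBody (pairForce (fun x => hardCoreProfile k a ℓ ‖x‖) L c)
        (pairFactor (fun x => hardCoreProfile k a ℓ ‖x‖) L) X
        ∂Measure.pi (fun _ : Fin (n + 3) => boxMeasure L)| ≤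
      (4 * n * (4096 * Real.pi ^ 3 * a ^ 4 * ℓ ^ 3) / L ^ 3 + 2688 * Real.pi ^ 2 * a ^ 3 * ℓ) *
        (2 / L ^ 3) ^ 2 *
        ∫ X, pairWeight (pairFactor (fun x => hardCoreProfile k a ℓ ‖x‖) L) X
          ∂Measure.pi (fun _ : Fin (n + 3) => boxMeasure L) := by
  set f : Space3 → ℝ := fun x => hardCoreProfile k a ℓ ‖x‖ with hf
  have ha := H.a_pos
  have hℓ := H.l_pos
  have hL0 : 0 < L := by linarith
  have hV := volume_torusBox hL0
  have hrad : ∀ x y : Space3, ‖x‖ = ‖y‖ → f x = f y := fun x y h => by simp only [hf, h]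
  have hb := H.bddMeas_pairForce h2 hL c
  have hE := H.isRepulsive_pairFactor hL0
  have hR := H.integral_sq_one_sub_pairFactor_le hL0
  have hFx : ∀ x, BddMeas (pairForce f L c x) := fun x =>
    hb.comp (φ := fun y => (x, y)) (measurable_const.prodMk measurable_id)
  have hs : ∀ x, BddMeas fun y => forceRoot a ℓ ‖torusRep L (x - y)‖ := fun x =>
    ⟨(measurable_forceRoot a ℓ).comp (measurable_norm.comp ((measurable_torusRep L).comp
      (measurable_const.sub measurable_id))), _, fun y => by
        rw [abs_of_nonneg (H.forceRoot_nonneg _)]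
        exact H.forceRoot_le _⟩
  have hA : ∀ x, ∫ y, |pairForce f L c x y| ∂boxMeasure L ≤ 16 * Real.pi * a * ℓ := fun x => by
    calc _ ≤ ∫ y, 4 * a * forceRoot a ℓ ‖torusRep L (x - y)‖ ^ 3 ∂boxMeasure L :=
          integral_mono ((hFx x).abs.integrable _) ((((hs x).pow 3).const_mul _).integrable _)
            fun y => H.abs_pairForce_le h2 hL c x y
      _ ≤ 4 * a * (4 * Real.pi * ℓ) := by
          rw [integral_const_mul]
          refine mul_le_mul_of_nonneg_left ?_ (by positivity)
          refine (H.integral_forceRoot_pow_le hL0 x three_ne_zero (by norm_num)).trans_eq ?_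
          rw [show (3 : ℝ) - 2 / 3 * (3 : ℕ) = 1 by norm_num, Real.rpow_one]
          ring
      _ = _ := by ring
  have hQ : ∀ x, ∫ y, forceRoot a ℓ ‖torusRep L (x - y)‖ ^ 4 ∂boxMeasure L ≤
      12 * Real.pi * ℓ ^ (1 / 3 : ℝ) := fun x => by
    refine (H.integral_forceRoot_pow_le hL0 x four_ne_zero (by norm_num)).trans_eq ?_
    rw [show (3 : ℝ) - 2 / 3 * (4 : ℕ) = 1 / 3 by norm_num]
    ring
  set q := ℓ ^ (1 / 3 : ℝ) with hq
  have hq0 : 0 < q := Real.rpow_pos_of_pos hℓ _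
  have hq3 : q ^ 3 = ℓ := by
    rw [hq, ← Real.rpow_natCast, ← Real.rpow_mul hℓ.le]
    norm_num
  have hκ := fun x => hE.integral_sq_conv_le (hFx x) (hA x) hR
  -- the weight `a * q` balances the two terms of the bound
  have hS := fun x => hE.integral_triangle_le (hFx x) (hs x) (fun y => H.forceRoot_nonneg _)
      (H.abs_pairForce_le h2 hL c x) (t := a * q) (by positivity) (hQ x) hR
  have h := hE.abs_integral_threeBody_le hb (by rw [hV]; positivity) hn (by rwa [hV])
    (σ := fun x y => torusRep L (x + x - y))
    (fun x => measurePreserving_torusRep_const_sub hL0 (x + x))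
    (pairFactor_reflect_reflect hL0 hrad) (pairFactor_reflect hL0 hrad)
    (pairForce_reflect hL0 hrad c) hκ hS
  rw [hV] at h
  refine h.trans_eq ?_
  congr 3
  · ring
  · rw [← hq3]
    field_simp
    ring

end IsWavenumber

/-! ### Scaling of the parameters -/

section Scaling

variable {ρ a ε : ℝ}

lemma corrLength_eq (hρ : 0 < ρ) (ha : 0 < a) :
    corrLength ρ a ε * (ρ * a ^ 3) ^ (1 / 2 : ℝ) = a * (ρ * a ^ 3) ^ ε := by
  have h0 : 0 < ρ * a := mul_pos hρ ha
  have h1 : (ρ * a ^ 3) ^ (1 / 2 : ℝ) = (ρ * a) ^ (1 / 2 : ℝ) * a := by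
    rw [show ρ * a ^ 3 = ρ * a * a ^ 2 by ring, Real.mul_rpow h0.le (sq_nonneg a),
      ← Real.sqrt_eq_rpow (a ^ 2), Real.sqrt_sq ha.le]
  rw [corrLength, h1, Real.rpow_neg h0.le]
  have := Real.rpow_pos_of_pos h0 (1 / 2)
  field_simp

lemma corrLength_pos (hρ : 0 < ρ) (ha : 0 < a) : 0 < corrLength ρ a ε := by
  rw [corrLength]
  positivity

lemma mul_corrLength_sq (hρ : 0 < ρ) (ha : 0 < a) :
    ρ * a * corrLength ρ a ε ^ 2 = (ρ * a ^ 3) ^ (2 * ε) := by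
  have h0 : 0 < ρ * a := mul_pos hρ ha
  have h1 : 0 < ρ * a ^ 3 := by positivity
  rw [corrLength, mul_pow, ← Real.rpow_natCast, ← Real.rpow_natCast, ← Real.rpow_mul h0.le,
    ← Real.rpow_mul h1.le, show -(1 / 2) * ((2 : ℕ) : ℝ) = -1 by norm_num, Real.rpow_neg_one,
    mul_inv_cancel_left₀ h0.ne']
  congr 1
  push_cast
  ring

lemma mul_corrLength (hρ : 0 < ρ) (ha : 0 < a) :
    ρ * a ^ 2 * corrLength ρ a ε = (ρ * a ^ 3) ^ (1 / 2 + ε) := by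
  have h1 : 0 < ρ * a ^ 3 := by positivity
  have h2 : (ρ * a ^ 3) ^ (1 / 2 : ℝ) * (ρ * a ^ 3) ^ (1 / 2 : ℝ) = ρ * a ^ 3 := by
    rw [← Real.rpow_add h1]
    norm_num
  have h3 := corrLength_eq (ε := ε) hρ ha
  have h4 := Real.rpow_pos_of_pos h1 (1 / 2)
  rw [Real.rpow_add h1]
  refine mul_right_cancel₀ h4.ne' ?_
  calc _ = ρ * a ^ 2 * (corrLength ρ a ε * (ρ * a ^ 3) ^ (1 / 2 : ℝ)) := by ring
    _ = (ρ * a ^ 3) * (ρ * a ^ 3) ^ ε := by rw [h3]; ring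
    _ = _ := by
        nth_rewrite 1 [← h2]
        ring

lemma two_mul_le_corrLength (hρ : 0 < ρ) (ha : 0 < a) (h : (ρ * a ^ 3) ^ (1 / 2 - ε) ≤ 1 / 2) :
    2 * a ≤ corrLength ρ a ε := by
  have h1 : 0 < ρ * a ^ 3 := by positivity
  have h3 := corrLength_eq (ε := ε) hρ ha
  have h4 := Real.rpow_pos_of_pos h1 ε
  rw [show (1 / 2 : ℝ) = 1 / 2 - ε + ε by ring, Real.rpow_add h1, ← mul_assoc] at h3
  have h5 := mul_right_cancel₀ h4.ne' h3
  have h6 := corrLength_pos (ε := ε) hρ ha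
  nlinarith

lemma boxSide_pow (hρ : 0 < ρ) (N : ℕ) : boxSide ρ N ^ 3 = N / ρ := by
  rw [boxSide, ← Real.rpow_natCast, ← Real.rpow_mul (by positivity)]
  norm_num

lemma tendsto_boxSide (hρ : 0 < ρ) : Filter.Tendsto (boxSide ρ) Filter.atTop Filter.atTop :=
  (tendsto_rpow_atTop (by norm_num)).comp (tendsto_natCast_atTop_atTop.atTop_div_const hρ)

end Scaling

end Application

/-! ### The limit of large particle number -/

section Limit

/-- At finite particle number: integrability, positivity and the bound of the three-body term. -/
lemma IsWavenumber.threeBodyTerm_le {a ℓ k ρ : ℝ} (H : IsWavenumber a ℓ k) (h2 : 2 * a ≤ ℓ)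
    (hρ : 0 < ρ) {n : ℕ} (hn : 0 < n) (hL : 2 * ℓ < boxSide ρ (n + 3))
    (hU : 64 * Real.pi * (ρ * a * ℓ ^ 2) ≤ 1) {f : Space3 → ℝ}
    (hf : f = fun x => hardCoreProfile k a ℓ ‖x‖) :
    IntegrableOn (threeBodyIntegrand f (boxSide ρ (n + 3)) (0 : Fin (n + 3)) 1 2)
        (configBox (boxSide ρ (n + 3)) (n + 3)) ∧
      IntegrableOn (jastrowSq f (boxSide ρ (n + 3))) (configBox (boxSide ρ (n + 3)) (n + 3)) ∧
      0 < ∫ x in configBox (boxSide ρ (n + 3)) (n + 3), jastrowSq f (boxSide ρ (n + 3)) x ∧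
      |threeBodyTerm f ρ n| ≤ 12 * ρ ^ 2 *
        (4 * ρ * (4096 * Real.pi ^ 3 * a ^ 4 * ℓ ^ 3) + 2688 * Real.pi ^ 2 * a ^ 3 * ℓ) := by
  subst hf
  have hV3 := boxSide_pow hρ (n + 3)
  rw [threeBodyTerm]
  set L := boxSide ρ (n + 3) with hLdef
  set f : Space3 → ℝ := fun x => hardCoreProfile k a ℓ ‖x‖ with hf
  have ha := H.a_pos
  have hℓ := H.l_pos
  have hL0 : 0 < L := by linarith
  have hpi := Real.pi_pos
  have hE := H.isRepulsive_pairFactor hL0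
  have hN : (0 : ℝ) < (n + 3 : ℕ) := by positivity
  have hUV : 16 * ((n + 3 : ℕ) * (4 * Real.pi * a * ℓ ^ 2)) ≤ L ^ 3 := by
    rw [hV3, le_div_iff₀ hρ]
    nlinarith
  have hU0 : 0 ≤ (n + 3 : ℕ) * (4 * Real.pi * a * ℓ ^ 2) := by positivity
  have hJ : ∀ X : Fin (n + 3) → Space3, jastrowSq f L X = pairWeight (pairFactor f L) X :=
    fun _ => rfl
  have hb := fun c => hE.bddMeas_threeBody (n := n) (H.bddMeas_pairForce h2 hL c)
  have hpos := hE.integral_pairWeight_pos (n := n + 3) (by rw [volume_torusBox hL0]; positivity)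
    (by rw [volume_torusBox hL0]; linarith)
  simp only [IntegrableOn, restrict_configBox]
  refine ⟨?_, hE.bddMeas_pairWeight.integrable _, hpos, ?_⟩
  · rw [show threeBodyIntegrand f L (0 : Fin (n + 3)) 1 2 = _ from
      funext threeBodyIntegrand_eq_sum]
    exact integrable_finsetSum _ fun c _ => (hb c).integrable _
  simp only [hJ, threeBodyIntegrand_eq_sum]
  rw [integral_finsetSum _ fun c _ => (hb c).integrable _]
  set D := ∫ X, pairWeight (pairFactor f L) X ∂Measure.pi fun _ : Fin (n + 3) => boxMeasure L
    with hD
  set κ := 4096 * Real.pi ^ 3 * a ^ 4 * ℓ ^ 3 with hκ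
  set S := 2688 * Real.pi ^ 2 * a ^ 3 * ℓ with hS
  have hsum := (Finset.abs_sum_le_sum_abs _ _).trans (Finset.sum_le_sum fun c (_ : c ∈ Finset.univ) =>
    H.abs_integral_threeBody_le h2 hL hn hUV c)
  rw [Finset.sum_const, Finset.card_univ, Fintype.card_fin, nsmul_eq_mul, ← hf, ← hD, hV3] at hsum
  set N : ℝ := ((n + 3 : ℕ) : ℝ) with hNdef
  have hnN : (n : ℝ) = N - 3 := by rw [hNdef]; push_cast; ring
  have hn0 : (0 : ℝ) ≤ n := n.cast_nonneg
  have hκ0 : 0 ≤ κ := by positivity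
  have hS0 : 0 ≤ S := by positivity
  have h1 : 4 * n * κ / (N / ρ) ≤ 4 * ρ * κ := by
    rw [div_le_iff₀ (by positivity)]
    calc 4 * n * κ ≤ 4 * N * κ := by gcongr; linarith
      _ = _ := by field_simp
  rw [abs_mul, abs_div, abs_of_pos hpos, abs_of_nonneg (by nlinarith : 0 ≤ (N - 1) * (N - 2)),
    ← mul_div_assoc, div_le_iff₀ hpos]
  calc _ ≤ N ^ 2 * (3 * ((4 * ρ * κ + S) * (2 / (N / ρ)) ^ 2 * D)) := by
        refine mul_le_mul (by nlinarith) (hsum.trans ?_) (abs_nonneg _) (sq_nonneg N)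
        push_cast
        gcongr
    _ = _ := by
        field_simp
        ring

end Limit

theorem proposition3 (ε : ℝ) (hε : 0 < ε) (hε' : ε < 1 / 2) :
    ∃ C > (0 : ℝ), ∃ δ > (0 : ℝ), ∀ ρ a : ℝ, 0 < ρ → 0 < a → ρ * a ^ 3 < δ →
      (∃! f : Space3 → ℝ, IsHardCoreGroundState a (corrLength ρ a ε) f) ∧
      ∀ f : Space3 → ℝ, IsHardCoreGroundState a (corrLength ρ a ε) f →
        (∀ᶠ n : ℕ in Filter.atTop,
          MeasureTheory.IntegrableOn
            (threeBodyIntegrand f (boxSide ρ (n + 3)) (0 : Fin (n + 3)) 1 2)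
            (configBox (boxSide ρ (n + 3)) (n + 3)) ∧
          MeasureTheory.IntegrableOn (jastrowSq f (boxSide ρ (n + 3)))
            (configBox (boxSide ρ (n + 3)) (n + 3)) ∧
          0 < ∫ x in configBox (boxSide ρ (n + 3)) (n + 3), jastrowSq f (boxSide ρ (n + 3)) x) ∧
        Filter.limsup (fun n : ℕ => ((|threeBodyTerm f ρ n| : ℝ) : EReal)) Filter.atTop ≤
          ((C * (ρ * a) * (ρ * a ^ 3) ^ (1 / 2 + ε) : ℝ) : EReal) := by
  have hpi := Real.pi_pos
  have hη : 0 < 1 / 2 - ε := by linarith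
  -- the two conditions on `δ` ensure `2 a ≤ ℓ` and `64 π ρ a ℓ² ≤ 1`
  refine ⟨12 * (16384 * Real.pi ^ 3 + 2688 * Real.pi ^ 2), by positivity,
    min ((1 / 2) ^ (1 / 2 - ε)⁻¹) ((1 / 256) ^ (2 * ε)⁻¹), by positivity, fun ρ a hρ ha hδ => ?_⟩
  set ℓ := corrLength ρ a ε with hℓ
  have hτ : 0 < ρ * a ^ 3 := by positivity
  have hτ1 : (ρ * a ^ 3) ^ (1 / 2 - ε) ≤ 1 / 2 :=
    ((Real.le_rpow_inv_iff_of_pos hτ.le (by norm_num) hη).1 (hδ.le.trans (min_le_left _ _)))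
  have hτ2 : (ρ * a ^ 3) ^ (2 * ε) ≤ 1 / 256 :=
    ((Real.le_rpow_inv_iff_of_pos hτ.le (by norm_num) (by positivity)).1
      (hδ.le.trans (min_le_right _ _)))
  have h2 : 2 * a ≤ ℓ := two_mul_le_corrLength hρ ha hτ1
  have e1 : ρ * a * ℓ ^ 2 = (ρ * a ^ 3) ^ (2 * ε) := mul_corrLength_sq hρ ha
  have e2 : ρ * a ^ 2 * ℓ = (ρ * a ^ 3) ^ (1 / 2 + ε) := mul_corrLength hρ ha
  have hU : 64 * Real.pi * (ρ * a * ℓ ^ 2) ≤ 1 := by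
    rw [e1]
    nlinarith [Real.pi_lt_four]
  obtain ⟨k, H⟩ := exists_isWavenumber ha (show a < ℓ by linarith)
  refine ⟨⟨_, H.isGroundState, fun g hg => H.eq_of_isGroundState hg⟩, fun f hf => ?_⟩
  have hev : ∀ᶠ n : ℕ in Filter.atTop, 0 < n ∧ 2 * ℓ < boxSide ρ (n + 3) :=
    (Filter.eventually_gt_atTop 0).and
      (((tendsto_boxSide hρ).comp (Filter.tendsto_add_atTop_nat 3)).eventually_gt_atTop _)
  have key := hev.mono fun n hn => H.threeBodyTerm_le h2 hρ hn.1 hn.2 hU (H.eq_of_isGroundState hf)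
  refine ⟨key.mono fun n hn => ⟨hn.1, hn.2.1, hn.2.2.1⟩, ?_⟩
  refine Filter.limsup_le_of_le (by isBoundedDefault) (key.mono fun n hn => ?_)
  refine EReal.coe_le_coe_iff.2 (hn.2.2.2.trans ?_)
  have hP : 0 ≤ (ρ * a ^ 3) ^ (1 / 2 + ε) := by positivity
  calc _ = 12 * (16384 * Real.pi ^ 3 * (ρ * a * ℓ ^ 2) + 2688 * Real.pi ^ 2) *
          (ρ * a) * (ρ * a ^ 2 * ℓ) := by ring
    _ ≤ 12 * (16384 * Real.pi ^ 3 * 1 + 2688 * Real.pi ^ 2) * (ρ * a) * (ρ * a ^ 2 * ℓ) := by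
        rw [e1, e2]
        gcongr
        linarith
    _ = _ := by rw [e2, mul_one]
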